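/- Let $xp=x^0p^0-\mathbf{x}\mathbf{p}$ be the Lorentz product on Minkowski space $\mathbb R^4$, let $\partial^\nu$ denote the derivative with raised index, and let $V_+$ be the open cone of positive timelike vectors. Let $\mathcal A$ be the $*$-algebra generated by the smeared free massless scalar field $\phi_0$, which is linear and real, $\phi_0(f)^*=\phi_0(\bar f)$, and satisfies $$\square\phi_0=0,\qquad [\phi_0(x_1),\phi_0(x_2)]=(2\pi)^{-3}\int dp\,e^{-i(x_1-x_2)p}\,\varepsilon(p_0)\delta(p^2)\cdot 1 .$$ States are positive normalized linear functionals $\omega$ on $\mathcal A$ that are invariant under $\phi_0\mapsto-\phi_0$. For $\beta\in V_+$ let $\omega_\beta$ be the quasifree KMS state with $$\omega_\beta(\phi_0(x_1)\phi_0(x_2))=(2\pi)^{-3}\int dp\,e^{-i(x_1-x_2)p}\,\varepsilon(p_0)\delta(p^2)\,\frac1{1-e^{-\beta p}},$$ and let $\omega_\infty$ be the vacuum state (the limit $\beta\to\infty$). For $B\subset V_+$ compact let $\mathcal C_B$ be the set of all mixtures $\int d\rho(\beta)\,\omega_\beta$, where $\rho$ is a probability measure with support in $B$. For a multi-index $\boldsymbol\mu=(\mu_1,\dots,\mu_m)$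 let $$\theta^{\boldsymbol\mu}(x)=\lim_{\zeta\to0}\partial_\zeta^{\boldsymbol\mu}\big(\phi_0(x+\zeta)\phi_0(x-\zeta)-\omega_\infty(\phi_0(x+\zeta)\phi_0(x-\zeta))\,1\big),\qquad \zeta\ \text{spacelike},$$ where the limit is understood, in the states considered, in the sense of distributions, and let $\Theta^{\boldsymbol\mu}(\beta)=\omega_\beta(\theta^{\boldsymbol\mu}(0))$, $\beta\in V_+$. Let $\mathcal S_x$ be spanned by $1$, $\phi_0(x)$ and all $\theta^{\boldsymbol\mu}(x)$. Let $\mathcal O\subset\mathbb R^4$ be open and let $\omega$ be $\mathcal S_{\mathcal O}$-thermal. This means: the two-point function of $\omega$ is a distribution; $\omega$ extends to all $\theta^{\boldsymbol\mu}(x)$, $x\in\mathcal O$, with $x\mapsto\omega(\theta^{\boldsymbol\mu}(x))$ locally integrable on $\mathcal O$; and for each $x\in\mathcal O$ there is a compact set $B_x\subset V_+$ and a state in $\mathcal C_{B_x}$ that agrees with $\omega$ on $\mathcal S_x$, where the sets $B_x$ can be chosen within a common compact subset of $V_+$ when $x$ varies in a compact subset of $\mathcal O$. Let $p$ be any positive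 lightlike vector ($p_0>0$, $p^2=0$) and let $N_p$ be the particle density of momentum $p$, i.e. the macro-observable with thermal function $$N_p(\beta)=(2\pi)^{-3}\,\frac1{e^{\beta p}-1},\qquad \beta\in V_+ .$$ Its expectation value $\omega(N_p)(x)$ at $x\in\mathcal O$ is the value at $N_p$ of the extension, by continuity with respect to the seminorms $\sup_{\beta\in B}|\Xi(\beta)|$ ($B\subset V_+$ compact), of the lift $\sum c_{\boldsymbol\mu}\Theta^{\boldsymbol\mu}\mapsto\sum c_{\boldsymbol\mu}\,\omega(\theta^{\boldsymbol\mu}(x))$ of $\omega$ at $x$. Then $\omega(N_p)(x)$ exists and is unique for every $x\in\mathcal O$, the function $x\mapsto\omega(N_p)(x)$ is locally integrable on $\mathcal O$, and in the sense of distributions on $\mathcal O$ $$(p\,\partial)\,\omega(N_p)(x)=0,\qquad \square\,\omega(N_p)(x)=0 .$$ -/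

import Mathlib

open MeasureTheory Filter Topology TopologicalSpace
open scoped Distributions LineDeriv ComplexOrder

noncomputable section

namespace FreeField

/-! ### Minkowski space -/

/-- Minkowski space `ℝ⁴`; the coordinate `0` is time. -/
abbrev Mink : Type := Fin 4 → ℝ

/-- Diagonal entries of the metric, signature `(+,-,-,-)`. -/
def metricSign (ν : Fin 4) : ℝ := if ν = 0 then 1 else -1

/-- The Lorentz product `x p = x⁰ p⁰ - 𝐱 𝐩`. -/
def mdot (x y : Mink) : ℝ := ∑ ν, metricSign ν * x ν * y ν

/-- The open forward light cone `V₊` of positive timelike vectors. -/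
def forwardCone : Set Mink := {β | 0 < β 0 ∧ 0 < mdot β β}

/-- Positive lightlike vectors. -/
def IsPositiveLightlike (p : Mink) : Prop := 0 < p 0 ∧ mdot p p = 0

theorem continuous_mdot_self : Continuous fun x : Mink => mdot x x := by
  unfold mdot
  fun_prop

/-- The open set of spacelike vectors. -/
def spacelike : Opens Mink :=
  ⟨{x | mdot x x < 0}, isOpen_lt continuous_mdot_self continuous_const⟩

/-- The unit vector in the direction of the coordinate `ν`. -/
def unitVec (ν : Fin 4) : Mink := Pi.single ν 1

/-- The positive lightlike vector `(|𝐤|, 𝐤)`. -/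
def onShell (k : EuclideanSpace ℝ (Fin 3)) : Mink := Fin.cons ‖k‖ (fun i => k i)

/-! ### Test functions and differential operators -/

/-- Smooth complex functions of compact support on Minkowski space. -/
abbrev Test : Type := 𝓓((⊤ : Opens Mink), ℂ)

/-- Smooth complex functions of compact support of two space-time variables. -/
abbrev Test₂ : Type := 𝓓((⊤ : Opens (Mink × Mink)), ℂ)

/-- The wave operator `□ = ∂₀² - ∂₁² - ∂₂² - ∂₃²`. -/
def box {Ω : Opens Mink} (f : 𝓓(Ω, ℂ)) : 𝓓(Ω, ℂ) :=
  ∑ ν, metricSign ν • ∂_{unitVec ν} (∂_{unitVec ν} f)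

/-- The derivative `∂^ν` with upper index. -/
def upperDeriv (ν : Fin 4) (f : Test) : Test := metricSign ν • ∂_{unitVec ν} f

/-- The iterated derivative `∂^{μ₁} ⋯ ∂^{μ_m}` belonging to a multi-index `(μ₁, …, μ_m)`. -/
def multiDeriv (μ : List (Fin 4)) (f : Test) : Test := μ.foldr upperDeriv f

/-- The complex conjugate test function. -/
def conjTest (f : Test) : Test :=
  TestFunction.postcompCLM (𝕜 := ℝ) (Complex.conjCLE : ℂ →L[ℝ] ℂ) f

/-- The function `(x₁, x₂) ↦ f(x₁) g(x₂)`. -/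
def tensor (f g : Test) : Test₂ where
  toFun z := f z.1 * g z.2
  contDiff' := (f.contDiff.comp contDiff_fst).mul (g.contDiff.comp contDiff_snd)
  hasCompactSupport' := by
    refine HasCompactSupport.intro (f.hasCompactSupport.prod g.hasCompactSupport) ?_
    rintro ⟨x, y⟩ h
    simp only [Set.mem_prod, not_and_or] at h
    rcases h with h | h
    · simp [image_eq_zero_of_notMem_tsupport h]
    · simp [image_eq_zero_of_notMem_tsupport h]
  tsupport_subset' := fun _ _ => trivial

/-- The function `(x₁, x₂) ↦ f((x₁ + x₂)/2) g((x₁ - x₂)/2)`, that is, `f(x) g(ζ)` in the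
variables `x, ζ` with `x₁ = x + ζ`, `x₂ = x - ζ`. -/
def centerRelative {Ω : Opens Mink} (f : 𝓓(Ω, ℂ)) (g : Test) : Test₂ where
  toFun z := f ((2 : ℝ)⁻¹ • (z.1 + z.2)) * g ((2 : ℝ)⁻¹ • (z.1 - z.2))
  contDiff' :=
    (f.contDiff.comp ((contDiff_fst.add contDiff_snd).const_smul _)).mul
      (g.contDiff.comp ((contDiff_fst.sub contDiff_snd).const_smul _))
  hasCompactSupport' := by
    have hK : IsCompact ((fun w : Mink × Mink => (w.1 + w.2, w.1 - w.2)) ''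
        (tsupport f ×ˢ tsupport g)) :=
      (IsCompact.prod f.hasCompactSupport g.hasCompactSupport).image (by fun_prop)
    refine HasCompactSupport.intro hK ?_
    rintro ⟨x, y⟩ h
    by_contra hne
    apply h
    refine ⟨((2 : ℝ)⁻¹ • (x + y), (2 : ℝ)⁻¹ • (x - y)), ⟨?_, ?_⟩, ?_⟩
    · exact subset_tsupport _ (left_ne_zero_of_mul hne)
    · exact subset_tsupport _ (right_ne_zero_of_mul hne)
    · ext i <;> simp <;> ring
  tsupport_subset' := fun _ _ => trivial

/-- The rescaled function `ζ ↦ r⁴ χ(r ζ)` (for `r ≠ 0`), which has the same integral as `χ` and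
is concentrated at the origin for large `r > 0`. -/
def rescale {Ω : Opens Mink} (χ : 𝓓(Ω, ℂ)) (r : ℝ) : Test :=
  if hr : r = 0 then 0 else
  { toFun := fun ζ => (r : ℂ) ^ 4 * χ (r • ζ)
    contDiff' := contDiff_const.mul (χ.contDiff.comp (contDiff_id.const_smul r))
    hasCompactSupport' :=
      (χ.hasCompactSupport.comp_homeomorph (Homeomorph.smulOfNeZero r hr)).mul_left
    tsupport_subset' := fun _ _ => trivial }

/-! ### Two-point functions of the massless field -/

/-- `H(q) = ∫ dx₁ dx₂ h(x₁, x₂) e^{-i (x₁ - x₂) q}`. -/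
def relativeFourier (h : Test₂) (q : Mink) : ℂ :=
  ∫ z : Mink × Mink, h z * Complex.exp (-Complex.I * (mdot (z.1 - z.2) q : ℂ))

/-- The distribution `(2π)⁻³ ∫ dp e^{-i (x₁ - x₂) p} ε(p₀) δ(p²) w(p)` smeared with `h`. On the two
shells `p = ± (|𝐤|, 𝐤)` the measure `ε(p₀) δ(p²) dp` is `± d³k / (2 |𝐤|)`. -/
def shellDistribution (w : Mink → ℝ) (h : Test₂) : ℂ :=
  ((2 * Real.pi) ^ 3 : ℝ)⁻¹ * ∫ k : EuclideanSpace ℝ (Fin 3),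
    ((2 * ‖k‖ : ℝ) : ℂ)⁻¹ * ((w (onShell k) : ℂ) * relativeFourier h (onShell k)
      - (w (-onShell k) : ℂ) * relativeFourier h (-onShell k))

/-- The commutator function of the massless field, smeared with `f ⊗ g`. -/
def commutatorFunction (f g : Test) : ℂ := shellDistribution (fun _ => 1) (tensor f g)

/-- The two-point function of the KMS state with temperature vector `β`. -/
def thermalTwoPoint (β : Mink) : Test₂ → ℂ :=
  shellDistribution fun p => (1 - Real.exp (-mdot β p))⁻¹

/-- The two-point function of the vacuum state, the limit of `thermalTwoPoint β` for `β → ∞`. -/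
def vacuumTwoPoint : Test₂ → ℂ :=
  shellDistribution fun p => if 0 < p 0 then 1 else 0

/-! ### The field algebra and its states -/

/-- The defining relations of the massless free field `φ₀`: linearity, the field equation and the
commutation relation. -/
inductive FieldRel : FreeAlgebra ℂ Test → FreeAlgebra ℂ Test → Prop
  | add (f g : Test) :
      FieldRel (FreeAlgebra.ι ℂ (f + g)) (FreeAlgebra.ι ℂ f + FreeAlgebra.ι ℂ g)
  | smul (c : ℂ) (f : Test) :
      FieldRel (FreeAlgebra.ι ℂ (c • f)) (c • FreeAlgebra.ι ℂ f)
  | wave (f : Test) : FieldRel (FreeAlgebra.ι ℂ (box f)) 0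
  | comm (f g : Test) :
      FieldRel (FreeAlgebra.ι ℂ f * FreeAlgebra.ι ℂ g - FreeAlgebra.ι ℂ g * FreeAlgebra.ι ℂ f)
        (algebraMap ℂ _ (commutatorFunction f g))

/-- The polynomial algebra generated by the smeared fields `φ₀(f)`. -/
abbrev FieldAlgebra : Type := RingQuot FieldRel

/-- The smeared field `φ₀(f)`. -/
def field (f : Test) : FieldAlgebra := RingQuot.mkAlgHom ℂ FieldRel (FreeAlgebra.ι ℂ f)

/-- The monomial `φ₀(f₁) ⋯ φ₀(f_n)`. -/
def monomial (l : List Test) : FieldAlgebra := (l.map field).prod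

/-- The polynomial `A = ∑ a(f₁, …, f_n) φ₀(f₁) ⋯ φ₀(f_n)`. -/
def polynomial (a : List Test →₀ ℂ) : FieldAlgebra := a.sum fun l c => c • monomial l

/-- Its adjoint `A* = ∑ conj a(f₁, …, f_n) φ₀(conj f_n) ⋯ φ₀(conj f₁)`. -/
def polynomialAdjoint (a : List Test →₀ ℂ) : FieldAlgebra :=
  a.sum fun l c => (starRingEnd ℂ c) • monomial (l.map conjTest).reverse

/-- The gauge automorphism, `γ(φ₀(f)) = -φ₀(f)`. -/
def gaugeAut : FieldAlgebra →ₐ[ℂ] FieldAlgebra :=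
  RingQuot.liftAlgHom ℂ ⟨FreeAlgebra.lift ℂ fun f => -field f, by
    intro x y h
    have key := RingQuot.mkAlgHom_rel ℂ h
    cases h with
    | add f g =>
      simp only [FreeAlgebra.lift_ι_apply, map_add] at key ⊢
      change field (f + g) = field f + field g at key
      rw [key, neg_add]
    | smul c f =>
      simp only [FreeAlgebra.lift_ι_apply, map_smul] at key ⊢
      change field (c • f) = c • field f at key
      rw [key, smul_neg]
    | wave f =>
      simp only [FreeAlgebra.lift_ι_apply, map_zero] at key ⊢
      change field (box f) = 0 at key
      rw [key, neg_zero]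
    | comm f g =>
      simp only [FreeAlgebra.lift_ι_apply, map_sub, map_mul, AlgHom.commutes] at key ⊢
      change field f * field g - field g * field f = _ at key
      have e : ∀ a b : FieldAlgebra, -a * -b = a * b := fun a b => neg_mul_neg a b
      rw [e, e, key]⟩

/-- Gauge invariant states: positive normalized linear functionals on the field algebra which are
invariant under `γ`. -/
structure FieldState where
  toLin : FieldAlgebra →ₗ[ℂ] ℂ
  map_one : toLin 1 = 1
  nonneg : ∀ a : List Test →₀ ℂ, 0 ≤ toLin (polynomialAdjoint a * polynomial a)
  gauge_invariant : ∀ A, toLin (gaugeAut A) = toLin A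

/-- The distribution `T` on `ℝ⁴ × ℝ⁴` is the two-point function
`(x₁, x₂) ↦ ω(φ₀(x₁) φ₀(x₂))` of the state. -/
def IsTwoPointDistribution (ω : FieldState) (T : Test₂ →L[ℂ] ℂ) : Prop :=
  ∀ f g : Test, T (tensor f g) = ω.toLin (field f * field g)

/-! ### Thermal reference states -/

/-- Sum over all pairings of products of two-point functions: the smeared `n`-point functions of
the quasifree functional with two-point function `W`. -/
def quasifree (W : Test₂ → ℂ) : List Test → ℂ
  | [] => 1
  | f :: l => ∑ i : Fin l.length, W (tensor f (l.get i)) * quasifree W (l.eraseIdx i)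
termination_by l => l.length
decreasing_by
  have := i.isLt
  simp only [List.length_cons, List.length_eraseIdx]
  split <;> omega

/-- `ω_B ∈ 𝒞_B`: the state is a mixture `∫ dρ(β) ω_β` of the quasifree KMS states `ω_β` with
respect to a normalized measure `ρ` supported in `B`. -/
def IsReferenceState (B : Set Mink) (ωB : FieldState) : Prop :=
  ∃ ρ : Measure Mink, IsProbabilityMeasure ρ ∧ ρ Bᶜ = 0 ∧
    ∀ l : List Test, ωB.toLin (monomial l) = ∫ β, quasifree (thermalTwoPoint β) l ∂ρ

/-! ### Balanced derivatives -/

/-- The functional `T`, thought of as a two-point function `T(x₁, x₂)`, admits on `Ω` the balanced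
derivative `lim_{ζ → 0} ∂_ζ^μ (T(x + ζ, x - ζ) - ω_∞(φ₀(x + ζ) φ₀(x - ζ)))`, `ζ` spacelike, and it is
given by the locally integrable function `x ↦ θ(x)`. The limit is taken in the sense of
distributions: it is smeared in `x` with a test function on `Ω`, and in `ζ` with the functions
`r⁴ χ(r ζ)`, `r → ∞`, where `χ` has support in the spacelike vectors. The factors are the
sign from the partial integration in `ζ` and the Jacobian, `dx dζ = 2⁻⁴ dx₁ dx₂`. -/
def HasBalancedDerivative (T : Test₂ → ℂ) (Ω : Opens Mink) (μ : List (Fin 4))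
    (θ : Mink → ℂ) : Prop :=
  LocallyIntegrableOn θ Ω ∧
  ∀ (f : 𝓓(Ω, ℂ)) (χ : 𝓓(spacelike, ℂ)),
    Tendsto (fun r : ℝ => (-1 : ℂ) ^ μ.length * (16 : ℂ)⁻¹ *
        (T (centerRelative f (multiDeriv μ (rescale χ r)))
          - vacuumTwoPoint (centerRelative f (multiDeriv μ (rescale χ r)))))
      atTop (𝓝 ((∫ ζ, χ ζ) * ∫ x, f x * θ x))

/-- The state `ω` extends to the balanced derivative `θ^μ(x)` of the normal ordered square, `x ∈ Ω`,
and its expectation values there are `ω(θ^μ(x)) = θ(x)`. -/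
def HasBalancedExpectation (ω : FieldState) (Ω : Opens Mink) (μ : List (Fin 4))
    (θ : Mink → ℂ) : Prop :=
  ∃ T : Test₂ →L[ℂ] ℂ, IsTwoPointDistribution ω T ∧ HasBalancedDerivative T Ω μ θ

/-- Let `θ μ x = ω(θ^μ(x))` be the expectation values in the state `ω` of the local observables at
the points `x` of the region `O`. The state is `𝒮_O`-thermal: for all `x ∈ O` it agrees on the
observables at `x` with some thermal reference state `ref x`, whose (constant) expectation values of
`θ^μ` are thus `θ μ x`, and these reference states have temperature supports in a common compact
set `B ⊆ V₊` for `x` in a given compact subset of `O`. The unit and the field `φ₀(x)` have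
expectation `1` and `0` in all gauge invariant states. -/
def IsThermalOn (O : Opens Mink) (ω : FieldState) (θ : List (Fin 4) → Mink → ℂ) : Prop :=
  (∀ μ, HasBalancedExpectation ω O μ (θ μ)) ∧
  ∃ ref : Mink → FieldState, ∀ K ⊆ (O : Set Mink), IsCompact K →
    ∃ B ⊆ forwardCone, IsCompact B ∧ ∀ x ∈ K,
      IsReferenceState B (ref x) ∧
      ∀ μ, HasBalancedExpectation (ref x) ⊤ μ (fun _ => θ μ x)

/-! ### Macro-observables -/

/-- `β ↦ Θ(β) = ω_β(θ^μ(0))` is the thermal function of the local observable `θ^μ`. -/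
def IsThermalFunction (μ : List (Fin 4)) (Θ : Mink → ℂ) : Prop :=
  ∀ β ∈ forwardCone, HasBalancedDerivative (thermalTwoPoint β) ⊤ μ (fun _ => Θ β)

/-- `v = ω(Ξ)(x)`: the value at the macro-observable with thermal function `Ξ` of the lift of the
state at the point `x`. The lift is given by `∑ c_μ Θ^μ ↦ ∑ c_μ ω(θ^μ(x))` on the macro-observables
of the local observables, and is extended by continuity with respect to the seminorms
`sup_{β ∈ B} |Ξ(β)|`, `B ⊆ V₊` compact. -/
def IsLiftedExpectation (θ : List (Fin 4) → Mink → ℂ) (x : Mink) (Ξ : Mink → ℂ) (v : ℂ) : Prop :=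
  ∃ Θ : List (Fin 4) → Mink → ℂ, (∀ μ, IsThermalFunction μ (Θ μ)) ∧
    ∀ B ⊆ forwardCone, IsCompact B → ∀ ε > 0, ∃ c : List (Fin 4) →₀ ℂ,
      (∀ β ∈ B, ‖Ξ β - c.sum fun μ a => a * Θ μ β‖ < ε) ∧
      ‖v - c.sum fun μ a => a * θ μ x‖ < ε

/-- The thermal function of the particle density `N_p`, Planck's formula
`N_p(β) = (2π)⁻³ / (e^{β p} - 1)`. -/
def particleDensity (p β : Mink) : ℂ :=
  (((2 * Real.pi) ^ 3)⁻¹ * (Real.exp (mdot β p) - 1)⁻¹ : ℝ)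

end FreeField

end

/-! In a KMS state the two-point function minus its vacuum part is an integral over the light cone
with the Planck weight, so the thermal functions (`thermalMoment`) are Planck integrals of momentum
monomials of even degree. At each x ∈ O the state looks like a mixture: θ^μ(x) = ∫ Θ^μ dρ_x
(`IsThermalOn.exists_isMixture`).

The central step is `exists_thermalCoeff_near`: for compact B there are coefficients b, independent
of ν, such that p^ν N_p is close to ∑ b_μ Θ^{νμ} uniformly on B. Indeed p^ν N_p(β) is the Planck
integral of k^ν times a delta function at p on the cone, and only the delta function has to be
approximated, by odd polynomials. These are dense in L² of an exponentially decaying measure on the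
forward cone. For if h is orthogonal to them, the measure with density h⁺ on the forward and h⁻ on
the backward cone has the same moments as the one with h⁺ and h⁻ exchanged; exponential
integrability makes the moments determine the measure, hence h⁺ = h⁻. Taking ν = 0 and dividing by
p⁰ shows that the lifted value exists, is unique, and equals ∫ N_p dρ_x.

Nothing is known about how ρ_x depends on x, so regularity and differential equations reach N only
through the approximation, which is uniform on compact subsets of O because the temperature supports
are common there (`IsThermalOn.isApproximated`). In the variables x, ζ the two wave equations become
∂_x·∂_ζ = 0 and □_x + □_ζ = 0. The first one gives the conservation law ∑ ∂_ν θ^{νμ} = 0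
(`sum_integral_lineDeriv_mul_eq_zero`), which turns into (p∂)N = 0 since b does not depend on ν. The
second one expresses □θ^μ by the contraction of θ^{ννμ} (`integral_box_mul_eq`), which vanishes
pointwise in a mixture because k² = 0 on the cone (`sum_metricSign_thermalMoment`); so □N = 0.

A state prescribes its two-point distribution on product test functions only. Their totality
(`eq_zero_of_tensor_eq_zero`) makes this distribution unique and carries the field equation over to
it. -/

noncomputable section

namespace FreeField

section

open scoped ContDiff FourierTransform

/-! ### Approximation of test functions by plane waves, together with derivatives. -/

section PlaneWaves

variable {W V : Type*} [NormedAddCommGroup W] [NormedSpace ℝ W]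
  [NormedAddCommGroup V] [InnerProductSpace ℝ V] [FiniteDimensional ℝ V]
  [MeasurableSpace V] [BorelSpace V]

/-- The plane wave `w ↦ exp (-2πi L(v, w))`. -/
def planeWave (L : V →L[ℝ] W →L[ℝ] ℝ) (v : V) (w : W) : ℂ := (Real.fourierChar (-L v w) : ℂ)

/-- As a Fourier transform of a Dirac measure, the plane wave gets its derivatives of all orders
from `VectorFourier.iteratedFDeriv_fourierIntegral`. -/
theorem planeWave_eq_fourierIntegral (L : V →L[ℝ] W →L[ℝ] ℝ) (v : V) :
    planeWave L v = VectorFourier.fourierIntegral Real.fourierChar (Measure.dirac v)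
      L.toLinearMap₁₂ (fun _ : V => (1 : ℂ)) := by
  ext w
  simp [VectorFourier.fourierIntegral, planeWave, Circle.smul_def]

theorem contDiff_planeWave (L : V →L[ℝ] W →L[ℝ] ℝ) (v : V) : ContDiff ℝ ∞ (planeWave L v) := by
  have : planeWave L v = fun w => Complex.exp ((2 * Real.pi * (-L v w) : ℝ) * Complex.I) := by
    ext w
    simp [planeWave, Real.fourierChar_apply]
  rw [this]
  refine Complex.contDiff_exp.comp ((Complex.ofRealCLM.contDiff.comp ?_).mul contDiff_const)
  exact contDiff_const.mul (L v).contDiff.neg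

theorem iteratedFDeriv_planeWave (L : V →L[ℝ] W →L[ℝ] ℝ) (v : V) (n : ℕ) (w : W) :
    iteratedFDeriv ℝ n (planeWave L v) w = Real.fourierChar (-L v w) •
      VectorFourier.fourierPowSMulRight L (fun _ : V => (1 : ℂ)) v n := by
  rw [planeWave_eq_fourierIntegral, VectorFourier.iteratedFDeriv_fourierIntegral (N := ⊤) L ?_ ?_
    le_top]
  · simp [VectorFourier.fourierIntegral]
  · intro n _
    exact integrable_dirac (by simp)
  · exact aestronglyMeasurable_const

variable (L : V →L[ℝ] W →L[ℝ] ℝ) (K : Set W) [CompactSpace K] (n : ℕ)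

/-- Families of continuous functions on `K` in which the derivatives of order at most `n` of smooth
functions take their values. -/
def JetSpace (W : Type*) [NormedAddCommGroup W] [NormedSpace ℝ W] (K : Set W) (n : ℕ) : Type _ :=
  (i : Fin (n + 1)) → C(K, W [×i]→L[ℝ] ℂ)

instance : NormedAddCommGroup (JetSpace W K n) :=
  inferInstanceAs (NormedAddCommGroup ((i : Fin (n + 1)) → C(K, W [×i]→L[ℝ] ℂ)))

instance : NormedSpace ℂ (JetSpace W K n) :=
  inferInstanceAs (NormedSpace ℂ ((i : Fin (n + 1)) → C(K, W [×i]→L[ℝ] ℂ)))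

instance : NormedSpace ℝ (JetSpace W K n) :=
  inferInstanceAs (NormedSpace ℝ ((i : Fin (n + 1)) → C(K, W [×i]→L[ℝ] ℂ)))

instance : CompleteSpace (JetSpace W K n) :=
  inferInstanceAs (CompleteSpace ((i : Fin (n + 1)) → C(K, W [×i]→L[ℝ] ℂ)))

/-- Evaluation of the derivative of order `j` at the point `x`. -/
def JetSpace.evalCLM (j : Fin (n + 1)) (x : K) : JetSpace W K n →L[ℂ] (W [×j]→L[ℝ] ℂ) :=
  (ContinuousMap.evalCLM ℂ x).comp (ContinuousLinearMap.proj (R := ℂ)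
    (φ := fun i : Fin (n + 1) => C(K, W [×i]→L[ℝ] ℂ)) j)

theorem JetSpace.norm_evalCLM_apply_le (j : Fin (n + 1)) (x : K) (y : JetSpace W K n) :
    ‖JetSpace.evalCLM K n j x y‖ ≤ ‖y‖ :=
  (ContinuousMap.norm_coe_le_norm (y j) x).trans
    (norm_le_pi_norm (show (i : Fin (n + 1)) → C(K, W [×i]→L[ℝ] ℂ) from y) j)

/-- The derivatives of order at most `n` of a plane wave, on a compact set. -/
def planeWaveJet (v : V) : JetSpace W K n := fun i =>
  ⟨fun x => Real.fourierChar (-L v x) •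
    VectorFourier.fourierPowSMulRight L (fun _ : V => (1 : ℂ)) v i, by fun_prop⟩

theorem continuous_planeWaveJet : Continuous (planeWaveJet L K n) := by
  refine continuous_pi fun i => ?_
  refine ContinuousMap.continuous_of_continuous_uncurry _ ?_
  have h1 : Continuous fun p : V × K => Real.fourierChar (-L p.1 p.2) := by fun_prop
  have h2 : Continuous fun p : V × K =>
      VectorFourier.fourierPowSMulRight L (fun _ : V => (1 : ℂ)) p.1 i :=
    (Continuous.fourierPowSMulRight L continuous_const i).comp continuous_fst
  exact h1.smul h2

/-- The growth in the frequency is only polynomial, so a Schwartz amplitude makes the superposition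
of jets Bochner integrable. -/
theorem norm_planeWaveJet_le (v : V) :
    ‖planeWaveJet L K n v‖ ≤ ∑ i ∈ Finset.range (n + 1), (2 * Real.pi * ‖L‖) ^ i * ‖v‖ ^ i := by
  refine (pi_norm_le_iff_of_nonneg (by positivity)).2 fun i => ?_
  refine (ContinuousMap.norm_le _ (by positivity)).2 fun x => ?_
  have h1 : ‖planeWaveJet L K n v i x‖ ≤ (2 * Real.pi * ‖L‖) ^ (i : ℕ) * ‖v‖ ^ (i : ℕ) := by
    have := VectorFourier.norm_fourierPowSMulRight_le L (fun _ : V => (1 : ℂ)) v i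
    simpa [planeWaveJet, Circle.smul_def, norm_smul, Circle.norm_coe] using this
  refine h1.trans ?_
  exact Finset.single_le_sum (f := fun i : ℕ => (2 * Real.pi * ‖L‖) ^ i * ‖v‖ ^ i)
    (fun _ _ => by positivity) (Finset.mem_range.2 i.2)

/-- In the quotient by the closed span the integrand is zero, and the quotient map commutes with the
integral. -/
theorem integral_mem_topologicalClosure_span {α E : Type*} [MeasurableSpace α] {μ : Measure α}
    [NormedAddCommGroup E] [NormedSpace ℂ E] [CompleteSpace E] {Φ : α → E} {g : α → ℂ}
    (hint : Integrable (fun a => g a • Φ a) μ) :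
    ∫ a, g a • Φ a ∂μ ∈ (Submodule.span ℂ (Set.range Φ)).topologicalClosure := by
  set S := (Submodule.span ℂ (Set.range Φ)).topologicalClosure with hS
  have hclosed : IsClosed (S : Set E) := Submodule.isClosed_topologicalClosure _
  rw [← Submodule.Quotient.mk_eq_zero]
  have h1 := ContinuousLinearMap.integral_comp_comm S.mkQL hint
  have h2 : ∀ a, S.mkQL (g a • Φ a) = 0 := fun a => by
    refine (Submodule.Quotient.mk_eq_zero S).2 (S.smul_mem _ ?_)
    exact Submodule.le_topologicalClosure _ (Submodule.subset_span ⟨a, rfl⟩)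
  simp only [h2, integral_zero] at h1
  exact h1.symm

/-- Fourier inversion writes h as a superposition of plane waves with Schwartz amplitude g. Read as
a Bochner integral in the Banach space of jets, it lies in the closed span of the plane wave jets,
so one finite combination approximates all derivatives up to order n at once. -/
theorem exists_planeWave_combination (e : W ≃L[ℝ] V) (hL : ∀ v w, L v w = inner ℝ v (e w))
    {h : W → ℂ} (hh : ContDiff ℝ ∞ h) (hc : HasCompactSupport h) {ε : ℝ} (hε : 0 < ε) :
    ∃ c : V →₀ ℂ, ∀ i ≤ n, ∀ x ∈ K,
      ‖iteratedFDeriv ℝ i (fun w => h w - c.sum fun v a => a * planeWave L v w) x‖ < ε := by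
  have hd : ContDiff ℝ ∞ (h ∘ e.symm) := hh.comp e.symm.contDiff
  have hs : HasCompactSupport (h ∘ e.symm) := hc.comp_homeomorph e.symm.toHomeomorph
  set φ : SchwartzMap V ℂ := hs.toSchwartzMap hd with hφ
  set g : SchwartzMap V ℂ := 𝓕⁻ φ with hg
  have hgi : ∀ m : ℕ, Integrable (fun v => ‖v‖ ^ m * ‖g v‖) := fun m => g.integrable_pow_mul volume m
  have hrep : h = VectorFourier.fourierIntegral Real.fourierChar volume L.toLinearMap₁₂ g := by
    have h0 : 𝓕 g = φ := by rw [hg]; exact FourierTransform.fourier_fourierInv_eq φ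
    ext w
    have h1 : 𝓕 g (e w) = h w := by
      rw [h0]; simp [hφ]
    rw [← h1, SchwartzMap.fourier_coe, Real.fourier_eq, VectorFourier.fourierIntegral]
    refine integral_congr_ae (Eventually.of_forall fun v => ?_)
    simp [hL]
  have hint : Integrable (fun v => g v • planeWaveJet L K n v) := by
    have hb : Integrable (fun v => ∑ i ∈ Finset.range (n + 1),
        (2 * Real.pi * ‖L‖) ^ i * (‖v‖ ^ i * ‖g v‖)) :=
      integrable_finsetSum _ fun i _ => (hgi i).const_mul _
    have : SecondCountableTopologyEither V (JetSpace W K n) :=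
      secondCountableTopologyEither_of_left _ _
    refine hb.mono' (g.continuous.smul (continuous_planeWaveJet L K n)).aestronglyMeasurable
      (Eventually.of_forall fun v => ?_)
    rw [norm_smul, mul_comm]
    refine (mul_le_mul_of_nonneg_right (norm_planeWaveJet_le L K n v) (norm_nonneg _)).trans ?_
    rw [Finset.sum_mul]
    exact le_of_eq (Finset.sum_congr rfl fun i _ => by ring)
  have hmem := integral_mem_topologicalClosure_span hint
  rw [← SetLike.mem_coe, Submodule.topologicalClosure_coe, Metric.mem_closure_iff] at hmem
  obtain ⟨y, hy, hyε⟩ := hmem ε hε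
  obtain ⟨c, rfl⟩ := Finsupp.mem_span_range_iff_exists_finsupp.1 hy
  refine ⟨c, fun i hi x hx => ?_⟩
  set j : Fin (n + 1) := ⟨i, Nat.lt_succ_of_le hi⟩
  have hev : ∀ v, JetSpace.evalCLM K n j ⟨x, hx⟩ (planeWaveJet L K n v)
      = iteratedFDeriv ℝ i (planeWave L v) x := fun v => by
    rw [iteratedFDeriv_planeWave]; rfl
  -- Evaluation commutes with the Bochner integral, which identifies the abstract integral with the
  -- jet of h.
  have hI : JetSpace.evalCLM K n j ⟨x, hx⟩ (∫ v, g v • planeWaveJet L K n v)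
      = iteratedFDeriv ℝ i h x := by
    refine (ContinuousLinearMap.integral_comp_comm (JetSpace.evalCLM K n j ⟨x, hx⟩) hint).symm.trans
      ?_
    rw [hrep, VectorFourier.iteratedFDeriv_fourierIntegral (N := ⊤) L (fun m _ => hgi m)
      g.continuous.aestronglyMeasurable le_top, VectorFourier.fourierIntegral]
    refine integral_congr_ae (Eventually.of_forall fun v => ?_)
    simp only [map_smul, hev, iteratedFDeriv_planeWave]
    ext m
    simp [Circle.smul_def]
    ring
  have hcd : ContDiff ℝ ∞ fun w => c.sum fun v a => a * planeWave L v w :=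
    ContDiff.sum fun v _ => contDiff_const.mul (contDiff_planeWave L v)
  have hsum : iteratedFDeriv ℝ i (fun w => c.sum fun v a => a * planeWave L v w) x
      = JetSpace.evalCLM K n j ⟨x, hx⟩ (c.sum fun v a => a • planeWaveJet L K n v) := by
    have hi' : ∀ v, ContDiff ℝ i (planeWave L v) := fun v =>
      (contDiff_planeWave L v).of_le (mod_cast le_top)
    simp only [Finsupp.sum, map_sum, map_smul, hev]
    rw [iteratedFDeriv_fun_sum_apply fun v _ => (contDiff_const.mul (hi' v)).contDiffAt]
    refine Finset.sum_congr rfl fun v _ => ?_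
    exact iteratedFDeriv_const_smul_apply' (a := c v) (hi' v).contDiffAt
  have hle : ((i : ℕ∞) : WithTop ℕ∞) ≤ ∞ := mod_cast le_top
  change ‖iteratedFDeriv ℝ i (h - fun w => c.sum fun v a => a * planeWave L v w) x‖ < ε
  rw [iteratedFDeriv_sub_apply (hh.of_le hle).contDiffAt (hcd.of_le hle).contDiffAt, hsum,
    ← hI, ← map_sub]
  refine (JetSpace.norm_evalCLM_apply_le K n j ⟨x, hx⟩ _).trans_lt ?_
  rwa [← dist_eq_norm]

end PlaneWaves

/-! ### Totality of product test functions. -/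

/-- The Euclidean space underlying pairs of points of Minkowski space. -/
def pairEquiv : (Mink × Mink) ≃L[ℝ] EuclideanSpace ℝ (Fin 4 ⊕ Fin 4) :=
  (LinearEquiv.sumArrowLequivProdArrow (Fin 4) (Fin 4) ℝ ℝ).symm.toContinuousLinearEquiv.trans
    (EuclideanSpace.equiv (Fin 4 ⊕ Fin 4) ℝ).symm

/-- The Euclidean pairing of frequencies with pairs of points of Minkowski space. -/
def pairPairing : EuclideanSpace ℝ (Fin 4 ⊕ Fin 4) →L[ℝ] (Mink × Mink) →L[ℝ] ℝ :=
  (innerSL ℝ).bilinearComp (ContinuousLinearMap.id ℝ _)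
    (pairEquiv : (Mink × Mink) →L[ℝ] EuclideanSpace ℝ (Fin 4 ⊕ Fin 4))

theorem pairPairing_apply (v : EuclideanSpace ℝ (Fin 4 ⊕ Fin 4)) (w : Mink × Mink) :
    pairPairing v w = inner ℝ v (pairEquiv w) := rfl

theorem pairPairing_eq_add (v : EuclideanSpace ℝ (Fin 4 ⊕ Fin 4)) (w : Mink × Mink) :
    pairPairing v w = pairPairing v (w.1, 0) + pairPairing v (0, w.2) := by
  rw [← map_add]; simp

theorem planeWave_pairPairing (v : EuclideanSpace ℝ (Fin 4 ⊕ Fin 4)) (w : Mink × Mink) :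
    planeWave pairPairing v w
      = planeWave pairPairing v (w.1, 0) * planeWave pairPairing v (0, w.2) := by
  simp only [planeWave]
  rw [pairPairing_eq_add, neg_add, AddChar.map_add_eq_mul, Circle.coe_mul]

/-- The product of a test function and a smooth function. -/
def mulSmooth {E : Type*} [NormedAddCommGroup E] [NormedSpace ℝ E] {Ω : Opens E}
    (f : 𝓓(Ω, ℂ)) (u : E → ℂ) (hu : ContDiff ℝ ∞ u) : 𝓓(Ω, ℂ) where
  toFun x := f x * u x
  contDiff' := f.contDiff.mul hu
  hasCompactSupport' := f.hasCompactSupport.mul_right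
  tsupport_subset' := (tsupport_mul_subset_left).trans f.tsupport_subset

theorem exists_test_eq_one_of_norm_le (R : ℝ) : ∃ χ : Test, ∀ x : Mink, ‖x‖ ≤ R → χ x = 1 := by
  let b : ContDiffBump (0 : Mink) := ⟨max R 1, max R 1 + 1, by positivity, by linarith⟩
  refine ⟨⟨fun x => (b x : ℂ), Complex.ofRealCLM.contDiff.comp b.contDiff,
    b.hasCompactSupport.comp_left (g := fun y : ℝ => (y : ℂ)) Complex.ofReal_zero,
    fun _ _ => trivial⟩, fun x hx => ?_⟩
  have : b x = 1 := b.one_of_mem_closedBall (by simpa [b] using Or.inl hx)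
  change ((b x : ℝ) : ℂ) = 1
  simp [this]

/-- On test functions supported in a fixed compact set a distribution has finite order. -/
theorem norm_apply_le_of_iteratedFDeriv_le {E : Type*} [NormedAddCommGroup E] [NormedSpace ℝ E]
    (T : 𝓓((⊤ : Opens E), ℂ) →L[ℂ] ℂ) (K : Compacts E) :
    ∃ C : ℝ, ∃ n : ℕ, 0 < C ∧ ∀ f : 𝓓((⊤ : Opens E), ℂ), tsupport f ⊆ K → ∀ δ : ℝ, 0 ≤ δ →
      (∀ i ≤ n, ∀ x ∈ K, ‖iteratedFDeriv ℝ i f x‖ ≤ δ) → ‖T f‖ ≤ C * δ := by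
  set T' := T ∘L TestFunction.ofSupportedInCLM ℂ (n := ⊤) (F := ℂ) (K := K)
    (Ω := (⊤ : Opens E)) (fun _ _ => trivial)
  obtain ⟨s, C, hC, hs⟩ := Seminorm.bound_of_continuous
    (ContDiffMapSupportedIn.withSeminorms ℂ E ℂ ⊤ K) ((normSeminorm ℂ ℂ).comp T'.toLinearMap)
    (by exact continuous_norm.comp T'.continuous)
  refine ⟨C, s.sup id, by positivity, fun f hf δ hδ hd => ?_⟩
  set fK : 𝓓_{K}(E, ℂ) := .of_support_subset f.contDiff ((subset_tsupport f).trans hf)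
  have hle : (s.sup (ContDiffMapSupportedIn.seminorm ℂ E ℂ ⊤ K)) fK ≤ δ := by
    refine Seminorm.finset_sup_apply_le hδ fun i hi => ?_
    exact (ContDiffMapSupportedIn.seminorm_top_le_iff ℂ hδ i fK).2 fun x hx =>
      hd i (Finset.le_sup (f := id) hi) x hx
  have h1 := hs fK
  have h2 : ((C • s.sup (ContDiffMapSupportedIn.seminorm ℂ E ℂ ⊤ K)) fK)
      = C * (s.sup (ContDiffMapSupportedIn.seminorm ℂ E ℂ ⊤ K)) fK := rfl
  rw [h2] at h1
  refine le_trans (le_of_eq ?_) (h1.trans (mul_le_mul_of_nonneg_left hle C.2))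
  rfl

/-- Tensor products of test functions are total in the test functions of two variables. -/
theorem eq_zero_of_tensor_eq_zero (T : Test₂ →L[ℂ] ℂ) (hT : ∀ f g : Test, T (tensor f g) = 0) :
    T = 0 := by
  ext h
  obtain ⟨R, hR⟩ := h.hasCompactSupport.isBounded.exists_norm_le
  obtain ⟨χ, hχ⟩ := exists_test_eq_one_of_norm_le R
  set χ₂ : Test₂ := tensor χ χ with hχ₂
  have hχ₂h : ∀ x, χ₂ x * h x = h x := fun x => by
    by_cases hx : x ∈ tsupport h
    · have h1 : χ₂ x = χ x.1 * χ x.2 := rfl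
      rw [h1, hχ _ ((norm_fst_le x).trans (hR x hx)), hχ _ ((norm_snd_le x).trans (hR x hx))]
      ring
    · simp [image_eq_zero_of_notMem_tsupport hx]
  set K : Compacts (Mink × Mink) := ⟨tsupport χ₂, χ₂.hasCompactSupport⟩
  obtain ⟨C, n, hC, hbound⟩ := norm_apply_le_of_iteratedFDeriv_le T K
  have hcb : ∀ j : ℕ, ∃ M, ∀ x, ‖iteratedFDeriv ℝ j χ₂ x‖ ≤ M := fun j =>
    Continuous.bounded_above_of_compact_support
      (χ₂.contDiff.continuous_iteratedFDeriv (mod_cast le_top))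
      (χ₂.hasCompactSupport.iteratedFDeriv j)
  choose M hM using hcb
  -- The Leibniz constants of the cut-off: multiplication by χ₂ enlarges bounds on the derivatives
  -- up to order n by at most the factor A.
  set A : ℝ := ∑ i ∈ Finset.range (n + 1), ∑ j ∈ Finset.range (i + 1), (i.choose j : ℝ) * M j
  have hM0 : ∀ j, 0 ≤ M j := fun j => (norm_nonneg _).trans (hM j 0)
  have hA : 0 ≤ A := Finset.sum_nonneg fun i _ => Finset.sum_nonneg fun j _ =>
    mul_nonneg (by positivity) (hM0 j)
  have : CompactSpace (K : Set (Mink × Mink)) := isCompact_iff_compactSpace.1 K.isCompact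
  have key : ∀ ε > 0, ‖T h‖ ≤ C * (A * ε) := by
    intro ε hε
    obtain ⟨c, hc⟩ := exists_planeWave_combination pairPairing (K : Set (Mink × Mink)) n pairEquiv
      pairPairing_apply h.contDiff h.hasCompactSupport hε
    have hcd : ContDiff ℝ ∞ fun w => c.sum fun v a => a * planeWave pairPairing v w :=
      ContDiff.sum fun v _ => contDiff_const.mul (contDiff_planeWave pairPairing v)
    have hu := h.contDiff.sub hcd
    -- Since h = χ₂ h, it is the cut-off approximation error plus cut-off plane waves. The cut-off
    -- and the plane waves both factorize, so the latter are products and T annihilates them.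
    have hsplit : h = mulSmooth χ₂ _ hu + c.sum fun v a =>
        a • mulSmooth χ₂ _ (contDiff_planeWave pairPairing v) := by
      ext x
      have h1 : (c.sum fun v a => a • mulSmooth χ₂ _ (contDiff_planeWave pairPairing v)) x
          = c.sum fun v a => a * (χ₂ x * planeWave pairPairing v x) := by
        simp only [Finsupp.sum, FunLike.coe_sum, Finset.sum_apply]
        rfl
      have h2 : (mulSmooth χ₂ _ hu) x
          = χ₂ x * (h x - c.sum fun v a => a * planeWave pairPairing v x) := rfl
      change h x = (mulSmooth χ₂ _ hu) x + _
      rw [h1, h2, mul_sub, hχ₂h, Finsupp.sum, Finsupp.sum, Finset.mul_sum]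
      rw [Finset.sum_congr rfl fun v _ => mul_left_comm (χ₂ x) (c v) (planeWave pairPairing v x)]
      ring
    have hzero : ∀ v, T (mulSmooth χ₂ _ (contDiff_planeWave pairPairing v)) = 0 := fun v => by
      have h1 : ContDiff ℝ ∞ fun x : Mink => planeWave pairPairing v (x, 0) :=
        (contDiff_planeWave pairPairing v).comp (contDiff_id.prodMk contDiff_const)
      have h2 : ContDiff ℝ ∞ fun x : Mink => planeWave pairPairing v (0, x) :=
        (contDiff_planeWave pairPairing v).comp (contDiff_const.prodMk contDiff_id)
      rw [← hT (mulSmooth χ _ h1) (mulSmooth χ _ h2)]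
      congr 1
      ext x
      change χ x.1 * χ x.2 * planeWave pairPairing v x = χ x.1 * _ * (χ x.2 * _)
      rw [planeWave_pairPairing]
      ring
    have hTh : T h = T (mulSmooth χ₂ _ hu) := by
      conv_lhs => rw [hsplit]
      rw [map_add, Finsupp.sum, map_sum]
      simp [hzero]
    rw [hTh]
    refine hbound _ tsupport_mul_subset_left _ (by positivity) fun i hi x hx => ?_
    refine (norm_iteratedFDeriv_mul_le (N := ∞) χ₂.contDiff hu x (mod_cast le_top)).trans ?_
    have h3 : ∑ j ∈ Finset.range (i + 1), (i.choose j : ℝ) * M j ≤ A :=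
      Finset.single_le_sum (f := fun i => ∑ j ∈ Finset.range (i + 1), (i.choose j : ℝ) * M j)
        (fun i _ => Finset.sum_nonneg fun j _ => mul_nonneg (by positivity) (hM0 j))
        (Finset.mem_range.2 (Nat.lt_succ_of_le hi))
    refine le_trans ?_ (mul_le_mul_of_nonneg_right h3 hε.le)
    rw [Finset.sum_mul]
    refine Finset.sum_le_sum fun j hj => ?_
    have h4 := (hc (i - j) ((Nat.sub_le i j).trans hi) x hx).le
    have h5 := hM j x
    exact mul_le_mul (mul_le_mul_of_nonneg_left h5 (by positivity)) h4 (norm_nonneg _)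
      (mul_nonneg (by positivity) (hM0 j))
  have : ‖T h‖ ≤ 0 := by
    refine le_of_forall_pos_le_add fun ε hε => ?_
    have h1 := key (ε / (C * (A + 1))) (by positivity)
    refine h1.trans ?_
    rw [zero_add, ← mul_assoc, mul_div_assoc', div_le_iff₀ (by positivity)]
    nlinarith [mul_pos hC hε]
  simpa using norm_le_zero_iff.1 this

end

section

open scoped ContDiff

/-! ### The Lorentz product and the light cone -/

theorem mdot_eq (x y : Mink) : mdot x y = x 0 * y 0 - x 1 * y 1 - x 2 * y 2 - x 3 * y 3 := by
  simp [mdot, metricSign, Fin.sum_univ_four]; ring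

theorem mdot_add_left (x y z : Mink) : mdot (x + y) z = mdot x z + mdot y z := by
  simp [mdot_eq]; ring

theorem mdot_smul_left (a : ℝ) (x y : Mink) : mdot (a • x) y = a * mdot x y := by
  simp [mdot_eq]; ring

theorem mdot_smul_right (a : ℝ) (x y : Mink) : mdot x (a • y) = a * mdot x y := by
  simp [mdot_eq]; ring

theorem mdot_neg_right (x y : Mink) : mdot x (-y) = -mdot x y := by
  simp [mdot_eq]; ring

theorem mdot_neg_left (x y : Mink) : mdot (-x) y = -mdot x y := by
  simp [mdot_eq]; ring

theorem mdot_sub_left (x y z : Mink) : mdot (x - y) z = mdot x z - mdot y z := by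
  simp [mdot_eq]; ring

theorem mdot_unitVec (ν : Fin 4) (q : Mink) : mdot (unitVec ν) q = metricSign ν * q ν := by
  simp only [mdot, unitVec]
  rw [Finset.sum_eq_single ν]
  · simp
  · intro b _ hb
    simp [hb]
  · simp

theorem continuous_mdot : Continuous fun x : Mink × Mink => mdot x.1 x.2 := by
  unfold mdot
  fun_prop

theorem metricSign_mul_self (ν : Fin 4) : metricSign ν * metricSign ν = 1 := by
  unfold metricSign; split_ifs <;> norm_num

theorem onShell_zero_apply (k : EuclideanSpace ℝ (Fin 3)) : onShell k 0 = ‖k‖ := rfl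

theorem onShell_succ_apply (k : EuclideanSpace ℝ (Fin 3)) (i : Fin 3) :
    onShell k i.succ = k i := rfl

theorem continuous_onShell : Continuous onShell := by
  refine continuous_pi fun ν => ?_
  refine Fin.cases ?_ (fun i => ?_) ν
  · exact continuous_norm
  · simp only [onShell_succ_apply]; fun_prop

theorem onShell_smul {t : ℝ} (ht : 0 ≤ t) (k : EuclideanSpace ℝ (Fin 3)) :
    onShell (t • k) = t • onShell k := by
  ext ν
  refine Fin.cases ?_ (fun i => ?_) ν
  · simp [onShell_zero_apply, norm_smul, abs_of_nonneg ht]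
  · simp [onShell_succ_apply]

theorem norm_sq_eq (k : EuclideanSpace ℝ (Fin 3)) :
    ‖k‖ ^ 2 = k 0 ^ 2 + k 1 ^ 2 + k 2 ^ 2 := by
  rw [EuclideanSpace.norm_sq_eq]; simp [Fin.sum_univ_three]

theorem mdot_onShell (β : Mink) (k : EuclideanSpace ℝ (Fin 3)) :
    mdot β (onShell k) = β 0 * ‖k‖ - β 1 * k 0 - β 2 * k 1 - β 3 * k 2 := by
  rw [mdot_eq]; rfl

theorem mdot_onShell_self (k : EuclideanSpace ℝ (Fin 3)) :
    mdot (onShell k) (onShell k) = 0 := by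
  have h := norm_sq_eq k
  have h1 : onShell k 1 = k 0 := rfl
  have h2 : onShell k 2 = k 1 := rfl
  have h3 : onShell k 3 = k 2 := rfl
  rw [mdot_onShell, onShell_zero_apply, h1, h2, h3]
  linear_combination h

theorem abs_onShell_le (k : EuclideanSpace ℝ (Fin 3)) (ν : Fin 4) : |onShell k ν| ≤ ‖k‖ := by
  refine Fin.cases ?_ (fun i => ?_) ν
  · simp [onShell_zero_apply]
  · rw [onShell_succ_apply]
    exact PiLp.norm_apply_le k i

theorem exists_onShell_eq {p : Mink} (hp : IsPositiveLightlike p) :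
    ∃ k : EuclideanSpace ℝ (Fin 3), k ≠ 0 ∧ onShell k = p := by
  obtain ⟨h0, hpp⟩ := hp
  set k : EuclideanSpace ℝ (Fin 3) := WithLp.toLp 2 fun i => p i.succ with hk
  have hk0 : k 0 = p 1 := rfl
  have hk1 : k 1 = p 2 := rfl
  have hk2 : k 2 = p 3 := rfl
  have hn : ‖k‖ = p 0 := by
    rw [mdot_eq] at hpp
    have h := norm_sq_eq k
    rw [hk0, hk1, hk2] at h
    nlinarith [norm_nonneg k]
  refine ⟨k, fun h => ?_, ?_⟩
  · rw [h, norm_zero] at hn; linarith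
  · ext ν
    refine Fin.cases ?_ (fun i => ?_) ν
    · rw [onShell_zero_apply, hn]
    · rfl

/-- Cauchy–Schwarz for the spatial parts, where the spatial length of β is strictly smaller than β⁰.
-/
theorem mdot_onShell_pos {β : Mink} (hβ : β ∈ forwardCone) {k : EuclideanSpace ℝ (Fin 3)}
    (hk : k ≠ 0) : 0 < mdot β (onShell k) := by
  obtain ⟨h0, h1⟩ := hβ
  rw [mdot_eq] at h1
  rw [mdot_onShell]
  have hn : 0 < ‖k‖ := norm_pos_iff.2 hk
  have h2 := norm_sq_eq k
  have hcs : (β 1 * k 0 + β 2 * k 1 + β 3 * k 2) ^ 2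
      ≤ (β 1 ^ 2 + β 2 ^ 2 + β 3 ^ 2) * (k 0 ^ 2 + k 1 ^ 2 + k 2 ^ 2) := by
    nlinarith [sq_nonneg (β 1 * k 1 - β 2 * k 0), sq_nonneg (β 1 * k 2 - β 3 * k 0),
      sq_nonneg (β 2 * k 2 - β 3 * k 1)]
  have h3 : (β 1 * k 0 + β 2 * k 1 + β 3 * k 2) ^ 2 < (β 0 * ‖k‖) ^ 2 := by
    rw [mul_pow, h2]
    refine hcs.trans_lt ?_
    rw [← h2]
    have : 0 < ‖k‖ ^ 2 := by positivity
    exact mul_lt_mul_of_pos_right (by nlinarith) this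
  have h4 := abs_lt_of_sq_lt_sq h3 (by positivity)
  have h5 := (abs_lt.1 h4).2
  linarith

/-- By homogeneity in k it suffices to take a positive lower bound on the compact set B × unit
sphere. -/
theorem exists_pos_mul_norm_le_mdot {B : Set Mink} (hB : B ⊆ forwardCone) (hc : IsCompact B) :
    ∃ c > 0, ∀ β ∈ B, ∀ k : EuclideanSpace ℝ (Fin 3), c * ‖k‖ ≤ mdot β (onShell k) := by
  have hcont : Continuous fun x : Mink × EuclideanSpace ℝ (Fin 3) => mdot x.1 (onShell x.2) :=
    continuous_mdot.comp (continuous_fst.prodMk (continuous_onShell.comp continuous_snd))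
  obtain ⟨c, hc0, hcB⟩ := (hc.prod (isCompact_sphere (0 : EuclideanSpace ℝ (Fin 3)) 1)).exists_forall_le'
    (a := 0) hcont.continuousOn (fun x hx => mdot_onShell_pos (hB hx.1) (by
      rintro h
      have := hx.2
      simp [h] at this))
  refine ⟨c, hc0, fun β hβ k => ?_⟩
  rcases eq_or_ne k 0 with rfl | hk
  · rw [mdot_onShell]; simp
  have hn : 0 < ‖k‖ := norm_pos_iff.2 hk
  have h1 := hcB (β, ‖k‖⁻¹ • k) ⟨hβ, by simp [norm_smul, hn.ne']⟩
  simp only [onShell_smul (inv_nonneg.2 hn.le), mdot_smul_right] at h1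
  rw [inv_mul_eq_div, le_div_iff₀ hn] at h1
  exact h1

/-! ### Test functions -/

section TestCalculus

variable {E : Type*} [NormedAddCommGroup E] [NormedSpace ℝ E] {Ω : Opens E}

theorem lineDeriv_test_apply (f : 𝓓(Ω, ℂ)) (v x : E) : (∂_{v} f) x = fderiv ℝ f x v := by
  rw [TestFunction.lineDerivOp_eq_lineDerivCLM ℝ, TestFunction.lineDerivCLM_eq_fderivCLM,
    TestFunction.fderivCLM_apply_of_le _ (by simp)]

variable [MeasurableSpace E] [BorelSpace E] (μ : Measure E)

theorem integrable_test_mul [IsFiniteMeasureOnCompacts μ] (f : 𝓓(Ω, ℂ)) {u : E → ℂ} (hu : Continuous u) :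
    Integrable (fun x => f x * u x) μ :=
  (f.continuous.mul hu).integrable_of_hasCompactSupport f.hasCompactSupport.mul_right

variable [FiniteDimensional ℝ E] [μ.IsAddHaarMeasure]

theorem integral_lineDeriv_mul (f : 𝓓(Ω, ℂ)) (v : E) {u : E → ℂ} (hu : ContDiff ℝ ∞ u) :
    ∫ x, (∂_{v} f) x * u x ∂μ = -∫ x, f x * fderiv ℝ u x v ∂μ := by
  have hdu : Continuous fun x => fderiv ℝ u x v :=
    (hu.continuous_fderiv (by simp)).clm_apply continuous_const
  have h := integral_mul_fderiv_eq_neg_fderiv_mul_of_integrable (μ := μ) (f := f) (g := u) (v := v)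
    (by simpa only [lineDeriv_test_apply] using integrable_test_mul μ (∂_{v} f) hu.continuous)
    (integrable_test_mul μ f hdu) (integrable_test_mul μ f hu.continuous)
    (fun x _ => (f.contDiff.differentiable (by simp)).differentiableAt)
    (fun x _ => (hu.differentiable (by simp)).differentiableAt)
  rw [h, neg_neg]
  simp only [lineDeriv_test_apply]

end TestCalculus

end

section

open scoped ContDiff

/-! ### Fourier transforms on the light cone -/

instance : (volume : Measure (Mink × Mink)).IsAddHaarMeasure :=
  Measure.prod.instIsAddHaarMeasure volume volume

/-- The phase `e^{-i (x₁ - x₂) q}`. -/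
def relativePhase (q : Mink) (z : Mink × Mink) : ℂ :=
  Complex.exp (-Complex.I * (mdot (z.1 - z.2) q : ℂ))

theorem contDiff_mdot_left (q : Mink) : ContDiff ℝ ∞ fun x : Mink => mdot x q := by
  unfold mdot
  fun_prop

theorem contDiff_relativePhase (q : Mink) : ContDiff ℝ ∞ (relativePhase q) :=
  Complex.contDiff_exp.comp (contDiff_const.mul (Complex.ofRealCLM.contDiff.comp
    ((contDiff_mdot_left q).comp (contDiff_fst.sub contDiff_snd))))

theorem norm_relativePhase (q : Mink) (z : Mink × Mink) : ‖relativePhase q z‖ = 1 := by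
  rw [relativePhase, neg_mul, mul_comm, ← neg_mul, ← Complex.ofReal_neg,
    Complex.norm_exp_ofReal_mul_I]

theorem fderiv_relativePhase (q : Mink) (z v : Mink × Mink) :
    fderiv ℝ (relativePhase q) z v
      = -Complex.I * (mdot (v.1 - v.2) q : ℂ) * relativePhase q z := by
  have h1 : HasLineDerivAt ℝ (relativePhase q)
      (-Complex.I * (mdot (v.1 - v.2) q : ℂ) * relativePhase q z) z v := by
    have h2 : ∀ t : ℝ, relativePhase q (z + t • v) = Complex.exp (-Complex.I *
        ((mdot (z.1 - z.2) q : ℂ) + (t : ℂ) * (mdot (v.1 - v.2) q : ℂ))) := fun t => by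
      rw [relativePhase]
      have : mdot ((z + t • v).1 - (z + t • v).2) q = mdot (z.1 - z.2) q + t * mdot (v.1 - v.2) q := by
        rw [← mdot_smul_left, ← mdot_add_left]; congr 1; simp [smul_sub]; abel
      rw [this]; push_cast; rfl
    rw [HasLineDerivAt]
    simp_rw [h2]
    have h3 : HasDerivAt (fun t : ℝ => (t : ℂ)) 1 0 := Complex.ofRealCLM.hasDerivAt
    have h4 := (((h3.mul_const (mdot (v.1 - v.2) q : ℂ)).const_add
      (mdot (z.1 - z.2) q : ℂ)).const_mul (-Complex.I)).cexp
    convert! h4 using 1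
    simp [relativePhase]; ring
  have hd : DifferentiableAt ℝ (relativePhase q) z :=
    ((contDiff_relativePhase q).differentiable (by simp)).differentiableAt
  rw [← hd.lineDeriv_eq_fderiv, h1.lineDeriv]

theorem relativeFourier_eq (h : Test₂) (q : Mink) :
    relativeFourier h q = ∫ z, h z * relativePhase q z := rfl

theorem integrable_mul_relativePhase (h : Test₂) (q : Mink) :
    Integrable fun z => h z * relativePhase q z :=
  integrable_test_mul volume h (contDiff_relativePhase q).continuous

theorem relativeFourier_add (h₁ h₂ : Test₂) (q : Mink) :
    relativeFourier (h₁ + h₂) q = relativeFourier h₁ q + relativeFourier h₂ q := by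
  simp only [relativeFourier_eq]
  rw [← integral_add (integrable_mul_relativePhase h₁ q) (integrable_mul_relativePhase h₂ q)]
  simp [add_mul]

theorem relativeFourier_smul (c : ℂ) (h : Test₂) (q : Mink) :
    relativeFourier (c • h) q = c * relativeFourier h q := by
  simp only [relativeFourier_eq]
  rw [← integral_const_mul]
  simp [mul_assoc]

theorem relativeFourier_lineDeriv (h : Test₂) (v : Mink × Mink) (q : Mink) :
    relativeFourier (∂_{v} h) q = Complex.I * (mdot (v.1 - v.2) q : ℂ) * relativeFourier h q := by
  simp only [relativeFourier_eq]
  rw [integral_lineDeriv_mul volume h v (contDiff_relativePhase q), ← integral_neg,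
    ← integral_const_mul]
  congr 1
  ext z
  rw [fderiv_relativePhase]
  ring

theorem norm_relativeFourier_le {K : Set (Mink × Mink)} (hK : IsCompact K) (h : Test₂)
    (hh : tsupport h ⊆ K) (q : Mink) :
    ‖relativeFourier h q‖ ≤ volume.real K * ‖(h : BoundedContinuousFunction (Mink × Mink) ℂ)‖ := by
  rw [relativeFourier_eq, ← setIntegral_eq_integral_of_forall_compl_eq_zero (s := K), mul_comm]
  · refine norm_setIntegral_le_of_norm_le_const hK.measure_lt_top fun z _ => ?_
    rw [norm_mul, norm_relativePhase, mul_one]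
    exact BoundedContinuousFunction.norm_coe_le_norm
      (h : BoundedContinuousFunction (Mink × Mink) ℂ) z
  · intro z hz
    rw [image_eq_zero_of_notMem_tsupport fun hz' => hz (hh hz'), zero_mul]

theorem continuous_relativeFourier (h : Test₂) : Continuous (relativeFourier h) := by
  have hc : ∀ z, Continuous fun q : Mink => h z * relativePhase q z := fun z => by
    unfold relativePhase
    refine continuous_const.mul (Complex.continuous_exp.comp (continuous_const.mul
      (Complex.continuous_ofReal.comp ?_)))
    exact continuous_mdot.comp (continuous_const.prodMk continuous_id)
  refine continuous_of_dominated (bound := fun z => ‖h z‖)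
    (fun q => (integrable_mul_relativePhase h q).aestronglyMeasurable)
    (fun q => Eventually.of_forall fun z => ?_) ?_ (Eventually.of_forall hc)
  · rw [norm_mul]
    exact le_of_eq ((congrArg _ (norm_relativePhase q z)).trans (mul_one _))
  · exact (h.continuous.integrable_of_hasCompactSupport h.hasCompactSupport).norm

/-- The time translation of the first variable. -/
def timeDir : Mink × Mink := (unitVec 0, 0)

/-- The fourth derivative in the time variable of `x₁`. -/
def timeDeriv₄ (h : Test₂) : Test₂ := ∂_{timeDir} (∂_{timeDir} (∂_{timeDir} (∂_{timeDir} h)))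

/-- On the cone |q⁰| = |𝐤|, so four time derivatives give decay of order |𝐤|⁻⁴, enough for
convergence at infinity of the integrals over the cone. -/
theorem relativeFourier_timeDeriv₄ (h : Test₂) (q : Mink) :
    relativeFourier (timeDeriv₄ h) q = (q 0 : ℂ) ^ 4 * relativeFourier h q := by
  have : mdot (timeDir.1 - timeDir.2) q = q 0 := by
    simp [timeDir, mdot_unitVec, metricSign]
  simp only [timeDeriv₄, relativeFourier_lineDeriv, this]
  linear_combination ((q 0 : ℂ) ^ 4 * relativeFourier h q * (Complex.I ^ 2 - 1)) * Complex.I_sq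

/-- A norm which controls the decay of `relativeFourier` on the light cone. -/
def decayNorm (h : Test₂) : ℝ :=
  ‖TestFunction.toBoundedContinuousFunctionCLM ℝ h‖
    + ‖TestFunction.toBoundedContinuousFunctionCLM ℝ (timeDeriv₄ h)‖

theorem continuous_timeDeriv₄ : Continuous timeDeriv₄ := by
  have h : Continuous fun f : Test₂ => ∂_{timeDir} f := LineDeriv.continuous_lineDerivOp timeDir
  exact h.comp (h.comp (h.comp h))

theorem continuous_decayNorm : Continuous decayNorm :=
  ((TestFunction.toBoundedContinuousFunctionCLM ℝ).continuous.norm).add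
    ((TestFunction.toBoundedContinuousFunctionCLM ℝ).continuous.comp continuous_timeDeriv₄).norm

theorem decayNorm_zero : decayNorm 0 = 0 := by
  have h : timeDeriv₄ 0 = 0 := by simp [timeDeriv₄, LineDeriv.lineDerivOp_zero]
  rw [decayNorm, h, map_zero, norm_zero, add_zero]

theorem tsupport_lineDeriv_subset (h : Test₂) (v : Mink × Mink) :
    tsupport (∂_{v} h : Test₂) ⊆ tsupport h := by
  have : ⇑(∂_{v} h : Test₂) = fun x => fderiv ℝ h x v :=
    funext fun x => lineDeriv_test_apply h v x
  rw [this]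
  exact tsupport_fderiv_apply_subset ℝ v

theorem relativeFourier_decay {K : Set (Mink × Mink)} (hK : IsCompact K) (h : Test₂)
    (hh : tsupport h ⊆ K) (q : Mink) :
    ‖relativeFourier h q‖ * (1 + |q 0| ^ 4) ≤ volume.real K * decayNorm h := by
  have h1 := norm_relativeFourier_le hK h hh q
  have h4 : tsupport (timeDeriv₄ h) ⊆ K :=
    (tsupport_lineDeriv_subset _ _).trans ((tsupport_lineDeriv_subset _ _).trans
      ((tsupport_lineDeriv_subset _ _).trans ((tsupport_lineDeriv_subset _ _).trans hh)))
  have h2 := norm_relativeFourier_le hK (timeDeriv₄ h) h4 q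
  rw [relativeFourier_timeDeriv₄, norm_mul, norm_pow, Complex.norm_real, Real.norm_eq_abs] at h2
  have h3 := add_le_add h1 h2
  calc _ = ‖relativeFourier h q‖ + |q 0| ^ 4 * ‖relativeFourier h q‖ := by ring
    _ ≤ _ := h3
    _ = _ := by rw [← mul_add]; rfl

/-! ### Integrals over the light cone -/

/-- The majorant of the integrands on the light cone. -/
def shellMajorant (k : EuclideanSpace ℝ (Fin 3)) : ℝ :=
  ‖k‖⁻¹ * (1 + ‖k‖⁻¹) * (1 + ‖k‖ ^ 4)⁻¹

/-- In polar coordinates the factor r² cancels the singularity r⁻² and leaves (r + 1)/(1 + r⁴),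
which is at most 4/(1 + r²). -/
theorem integrable_shellMajorant : Integrable shellMajorant := by
  have h := (integrable_fun_norm_addHaar (volume : Measure (EuclideanSpace ℝ (Fin 3)))
    (f := fun r : ℝ => r⁻¹ * (1 + r⁻¹) * (1 + r ^ 4)⁻¹)).2 ?_
  · exact h
  rw [finrank_euclideanSpace, Fintype.card_fin]
  have h2 : Integrable fun r : ℝ => 4 * (1 + r ^ 2)⁻¹ := integrable_inv_one_add_sq.const_mul 4
  refine h2.integrableOn.mono' (by fun_prop) ?_
  refine (ae_restrict_mem measurableSet_Ioi).mono fun r hr => ?_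
  have hr : 0 < r := hr
  have e : r ^ (3 - 1) • (r⁻¹ * (1 + r⁻¹) * (1 + r ^ 4)⁻¹) = (r + 1) / (1 + r ^ 4) := by
    simp only [smul_eq_mul]; field_simp
  rw [e, Real.norm_of_nonneg (by positivity), ← div_eq_mul_inv,
    div_le_div_iff₀ (by positivity) (by positivity)]
  nlinarith [sq_nonneg (r ^ 2 - r), sq_nonneg (r - 1), sq_nonneg (r ^ 2 - 1)]

/-- Weights on the light cone with at most the singularity of the Planck distribution at zero. -/
structure IsShellWeight (w : Mink → ℝ) (A : ℝ) : Prop where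
  measurable : Measurable w
  pos_bound : ∀ k : EuclideanSpace ℝ (Fin 3), k ≠ 0 → |w (onShell k)| ≤ A * (1 + ‖k‖⁻¹)
  neg_bound : ∀ k : EuclideanSpace ℝ (Fin 3), k ≠ 0 → |w (-onShell k)| ≤ A * (1 + ‖k‖⁻¹)

/-- The integrand of `shellDistribution`. -/
def shellIntegrand (w : Mink → ℝ) (h : Test₂) (k : EuclideanSpace ℝ (Fin 3)) : ℂ :=
  ((2 * ‖k‖ : ℝ) : ℂ)⁻¹ * ((w (onShell k) : ℂ) * relativeFourier h (onShell k)
      - (w (-onShell k) : ℂ) * relativeFourier h (-onShell k))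

theorem shellDistribution_eq (w : Mink → ℝ) (h : Test₂) :
    shellDistribution w h = ((2 * Real.pi) ^ 3 : ℝ)⁻¹ * ∫ k, shellIntegrand w h k := rfl

theorem ae_ne_zero : ∀ᵐ k : EuclideanSpace ℝ (Fin 3), k ≠ 0 := by
  simp [ae_iff, measure_singleton]

theorem norm_shellIntegrand_le {w : Mink → ℝ} {A : ℝ} (hw : IsShellWeight w A)
    {K : Set (Mink × Mink)} (hK : IsCompact K) (h : Test₂) (hh : tsupport h ⊆ K)
    {k : EuclideanSpace ℝ (Fin 3)} (hk : k ≠ 0) :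
    ‖shellIntegrand w h k‖ ≤ A * (volume.real K * decayNorm h) * shellMajorant k := by
  have hn : 0 < ‖k‖ := norm_pos_iff.2 hk
  have hp := relativeFourier_decay hK h hh (onShell k)
  have hm := relativeFourier_decay hK h hh (-onShell k)
  rw [Pi.neg_apply, abs_neg] at hm
  rw [onShell_zero_apply, abs_norm, ← le_div_iff₀ (by positivity)] at hp hm
  set D := volume.real K * decayNorm h
  rw [shellIntegrand, norm_mul, norm_inv, Complex.norm_real, Real.norm_of_nonneg (by positivity)]
  have h1 : ‖(w (onShell k) : ℂ) * relativeFourier h (onShell k)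
      - (w (-onShell k) : ℂ) * relativeFourier h (-onShell k)‖
      ≤ A * (1 + ‖k‖⁻¹) * (D / (1 + ‖k‖ ^ 4)) + A * (1 + ‖k‖⁻¹) * (D / (1 + ‖k‖ ^ 4)) := by
    refine (norm_sub_le _ _).trans (add_le_add ?_ ?_)
    · rw [norm_mul, Complex.norm_real, Real.norm_eq_abs]
      exact mul_le_mul (hw.pos_bound k hk) hp (norm_nonneg _)
        ((abs_nonneg _).trans (hw.pos_bound k hk))
    · rw [norm_mul, Complex.norm_real, Real.norm_eq_abs]
      exact mul_le_mul (hw.neg_bound k hk) hm (norm_nonneg _)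
        ((abs_nonneg _).trans (hw.neg_bound k hk))
  refine (mul_le_mul_of_nonneg_left h1 (by positivity)).trans (le_of_eq ?_)
  rw [shellMajorant]
  field_simp
  ring

theorem measurable_relativeFourier_onShell (h : Test₂) :
    Measurable fun k => relativeFourier h (onShell k) :=
  ((continuous_relativeFourier h).comp continuous_onShell).measurable

theorem measurable_relativeFourier_neg_onShell (h : Test₂) :
    Measurable fun k => relativeFourier h (-onShell k) :=
  ((continuous_relativeFourier h).comp continuous_onShell.neg).measurable

theorem measurable_shellIntegrand {w : Mink → ℝ} (hw : Measurable w) (h : Test₂) :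
    Measurable (shellIntegrand w h) := by
  have h1 := measurable_relativeFourier_onShell h
  have h2 := measurable_relativeFourier_neg_onShell h
  have h3 : Measurable fun k => w (onShell k) := hw.comp continuous_onShell.measurable
  have h4 : Measurable fun k => w (-onShell k) := hw.comp continuous_onShell.neg.measurable
  unfold shellIntegrand
  exact (by fun_prop : Measurable fun k : EuclideanSpace ℝ (Fin 3) => ((2 * ‖k‖ : ℝ) : ℂ)⁻¹).mul
    (((Complex.measurable_ofReal.comp h3).mul h1).sub ((Complex.measurable_ofReal.comp h4).mul h2))

theorem integrable_shellIntegrand {w : Mink → ℝ} {A : ℝ} (hw : IsShellWeight w A) (h : Test₂) :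
    Integrable (shellIntegrand w h) :=
  (integrable_shellMajorant.const_mul _).mono'
    (measurable_shellIntegrand hw.measurable h).aestronglyMeasurable
    (ae_ne_zero.mono fun _ hk => norm_shellIntegrand_le hw h.hasCompactSupport h subset_rfl hk)

theorem shellDistribution_add {w : Mink → ℝ} {A : ℝ} (hw : IsShellWeight w A) (h₁ h₂ : Test₂) :
    shellDistribution w (h₁ + h₂) = shellDistribution w h₁ + shellDistribution w h₂ := by
  simp only [shellDistribution_eq]
  rw [← mul_add, ← integral_add (integrable_shellIntegrand hw h₁) (integrable_shellIntegrand hw h₂)]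
  congr 2
  ext k
  simp only [shellIntegrand, relativeFourier_add]
  ring

theorem shellDistribution_smul (w : Mink → ℝ) (c : ℂ) (h : Test₂) :
    shellDistribution w (c • h) = c * shellDistribution w h := by
  simp only [shellDistribution_eq]
  have : shellIntegrand w (c • h) = fun k => c * shellIntegrand w h k := funext fun k => by
    simp only [shellIntegrand, relativeFourier_smul]
    ring
  rw [this, integral_const_mul, mul_left_comm]

theorem norm_shellDistribution_le {w : Mink → ℝ} {A : ℝ} (hw : IsShellWeight w A)
    {K : Set (Mink × Mink)} (hK : IsCompact K) (h : Test₂) (hh : tsupport h ⊆ K) :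
    ‖shellDistribution w h‖ ≤ ((2 * Real.pi) ^ 3)⁻¹ *
      (A * (volume.real K * decayNorm h) * ∫ k, shellMajorant k) := by
  rw [shellDistribution_eq, norm_mul, Complex.norm_real,
    Real.norm_of_nonneg (by positivity), ← integral_const_mul]
  refine mul_le_mul_of_nonneg_left ?_ (by positivity)
  exact norm_integral_le_of_norm_le (integrable_shellMajorant.const_mul _)
    (ae_ne_zero.mono fun _ hk => norm_shellIntegrand_le hw hK h hh hk)

/-- A linear functional on the test functions which is locally bounded by `decayNorm` is
continuous. -/
theorem exists_clm_of_norm_le (Φ : Test₂ → ℂ) (hadd : ∀ f g, Φ (f + g) = Φ f + Φ g)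
    (hsmul : ∀ (c : ℂ) f, Φ (c • f) = c • Φ f)
    (hb : ∀ K : Set (Mink × Mink), IsCompact K → ∃ C, ∀ h : Test₂, tsupport h ⊆ K →
      ‖Φ h‖ ≤ C * decayNorm h) :
    ∃ T : Test₂ →L[ℂ] ℂ, ∀ h, T h = Φ h := by
  refine ⟨TestFunction.mkCLM ℂ Φ hadd hsmul fun K hKΩ => ?_, fun h => rfl⟩
  obtain ⟨C, hC⟩ := hb K K.isCompact
  let L : 𝓓_{K}(Mink × Mink, ℂ) →+ ℂ :=
    { toFun := Φ ∘ TestFunction.ofSupportedIn hKΩ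
      map_zero' := by
        have := hsmul 0 0
        rw [zero_smul, zero_smul] at this
        exact this
      map_add' := fun f g => hadd (TestFunction.ofSupportedIn hKΩ f)
        (TestFunction.ofSupportedIn hKΩ g) }
  have hL : Continuous L := by
    refine continuous_of_continuousAt_zero L ?_
    rw [ContinuousAt, map_zero]
    refine squeeze_zero_norm (a := fun f => C * decayNorm (TestFunction.ofSupportedIn hKΩ f))
      (fun f => hC _ f.tsupport_subset) ?_
    have h1 : Continuous fun f : 𝓓_{K}(Mink × Mink, ℂ) =>
        C * decayNorm (TestFunction.ofSupportedIn hKΩ f) :=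
      continuous_const.mul (continuous_decayNorm.comp
        (TestFunction.continuous_ofSupportedIn hKΩ))
    have h2 := h1.tendsto 0
    have h3 : (TestFunction.ofSupportedIn hKΩ 0 : Test₂) = 0 := rfl
    rwa [h3, decayNorm_zero, mul_zero] at h2
  exact hL

end

section

open scoped ContDiff

/-! ### The Planck distribution -/

/-- Planck's distribution `1 / (e^{β k} - 1)` on the light cone. -/
def planck (β : Mink) (k : EuclideanSpace ℝ (Fin 3)) : ℝ :=
  (Real.exp (mdot β (onShell k)) - 1)⁻¹

/-- The temperature vector `β` satisfies `β k ≥ c |𝐤|` on the light cone. -/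
def IsColderThan (c : ℝ) (β : Mink) : Prop :=
  ∀ k : EuclideanSpace ℝ (Fin 3), c * ‖k‖ ≤ mdot β (onShell k)

theorem exists_isColderThan {B : Set Mink} (hB : B ⊆ forwardCone) (hc : IsCompact B) :
    ∃ c > 0, ∀ β ∈ B, IsColderThan c β := exists_pos_mul_norm_le_mdot hB hc

theorem exists_isColderThan_of_mem {β : Mink} (hβ : β ∈ forwardCone) :
    ∃ c > 0, IsColderThan c β := by
  obtain ⟨c, hc, h⟩ := exists_isColderThan (Set.singleton_subset_iff.2 hβ) isCompact_singleton
  exact ⟨c, hc, h β rfl⟩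

variable {c : ℝ} {β : Mink} {k : EuclideanSpace ℝ (Fin 3)}

theorem IsColderThan.pos (h : IsColderThan c β) (hc : 0 < c) (hk : k ≠ 0) :
    0 < mdot β (onShell k) :=
  (mul_pos hc (norm_pos_iff.2 hk)).trans_le (h k)

theorem planck_nonneg (h : IsColderThan c β) (hc : 0 < c) : 0 ≤ planck β k := by
  rw [planck, inv_nonneg, sub_nonneg, Real.one_le_exp_iff]
  exact (mul_nonneg hc.le (norm_nonneg k)).trans (h k)

/-- With y = c|𝐤|/2 one has e^{2y} - 1 = 2 e^y sinh y ≥ 2y e^y. Half of the decay rate is given up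
to keep the singularity at 0 of order |𝐤|⁻¹. -/
theorem planck_le (h : IsColderThan c β) (hc : 0 < c) (hk : k ≠ 0) :
    planck β k ≤ c⁻¹ * (‖k‖⁻¹ * Real.exp (-(c / 2) * ‖k‖)) := by
  have hn : 0 < ‖k‖ := norm_pos_iff.2 hk
  have h1 : c * ‖k‖ * Real.exp ((c / 2) * ‖k‖) ≤ Real.exp (mdot β (onShell k)) - 1 := by
    have h2 : Real.exp (c * ‖k‖) ≤ Real.exp (mdot β (onShell k)) := Real.exp_le_exp.2 (h k)
    have h3 : Real.exp (c * ‖k‖) = Real.exp ((c / 2) * ‖k‖) * Real.exp ((c / 2) * ‖k‖) := by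
      rw [← Real.exp_add]; ring_nf
    set y := (c / 2) * ‖k‖ with hy
    have hy0 : 0 < y := by positivity
    have h4 := Real.self_le_sinh_iff.2 hy0.le
    rw [Real.sinh_eq] at h4
    have h5 : Real.exp y * Real.exp (-y) = 1 := by rw [← Real.exp_add]; simp
    have h6 : c * ‖k‖ = 2 * y := by rw [hy]; ring
    rw [h6]
    nlinarith [Real.exp_pos y]
  rw [planck, neg_mul, Real.exp_neg, ← mul_inv, ← mul_inv, ← mul_assoc]
  exact inv_anti₀ (by positivity) h1

/-- For x = βk ≥ c|𝐤| the weight is at most 1 + 1/x on the forward cone and, in absolute value, at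
most 1/x on the backward cone. -/
theorem isShellWeight_thermal (h : IsColderThan c β) (hc : 0 < c) :
    IsShellWeight (fun p => (1 - Real.exp (-mdot β p))⁻¹) (1 + c⁻¹) := by
  have hb : ∀ k : EuclideanSpace ℝ (Fin 3), k ≠ 0 → (mdot β (onShell k))⁻¹ ≤ c⁻¹ * ‖k‖⁻¹ :=
    fun k hk => by
      rw [← mul_inv]
      exact inv_anti₀ (mul_pos hc (norm_pos_iff.2 hk)) (h k)
  have hle : ∀ k : EuclideanSpace ℝ (Fin 3), 1 + c⁻¹ * ‖k‖⁻¹ ≤ (1 + c⁻¹) * (1 + ‖k‖⁻¹) := fun k => by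
    have h1 : 0 ≤ c⁻¹ := by positivity
    have h2 : 0 ≤ ‖k‖⁻¹ := by positivity
    nlinarith
  refine ⟨?_, fun k hk => ?_, fun k hk => ?_⟩
  · have : Measurable fun p => mdot β p :=
      (continuous_mdot.comp (continuous_const.prodMk continuous_id)).measurable
    fun_prop
  · set x := mdot β (onShell k) with hx
    have hx0 : 0 < x := h.pos hc hk
    have h1 : Real.exp (-x) ≤ (1 + x)⁻¹ := by
      rw [Real.exp_neg]
      exact inv_anti₀ (by positivity) (by linarith [Real.add_one_le_exp x])
    have h2 : x / (1 + x) ≤ 1 - Real.exp (-x) := by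
      have : 1 - (1 + x)⁻¹ = x / (1 + x) := by field_simp; ring
      linarith
    have h3 : 0 < x / (1 + x) := by positivity
    rw [abs_of_nonneg (inv_nonneg.2 (h3.le.trans h2))]
    refine (inv_anti₀ h3 h2).trans ?_
    have : (x / (1 + x))⁻¹ = 1 + x⁻¹ := by field_simp; ring
    rw [this]
    linarith [hb k hk, hle k]
  · simp only [mdot_neg_right, neg_neg]
    set x := mdot β (onShell k) with hx
    have hx0 : 0 < x := h.pos hc hk
    have h1 : x ≤ Real.exp x - 1 := by linarith [Real.add_one_le_exp x]
    rw [abs_inv, abs_sub_comm, abs_of_nonneg (by linarith)]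
    exact (inv_anti₀ hx0 h1).trans (by linarith [hb k hk, hle k])

theorem isShellWeight_vacuum : IsShellWeight (fun p => if 0 < p 0 then 1 else 0) 1 := by
  have h : ∀ (p : Mink) (k : EuclideanSpace ℝ (Fin 3)),
      |if 0 < p 0 then (1 : ℝ) else 0| ≤ 1 * (1 + ‖k‖⁻¹) := fun p k => by
    have : 0 ≤ ‖k‖⁻¹ := by positivity
    split_ifs <;> simp [this, add_nonneg]
  refine ⟨?_, fun k _ => h _ k, fun k _ => h _ k⟩
  exact Measurable.ite (measurableSet_lt measurable_const (measurable_pi_apply 0))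
    measurable_const measurable_const

/-- The thermal contribution to the two-point function, without the vacuum. -/
theorem thermal_sub_vacuum (h : IsColderThan c β) (hc : 0 < c) (g : Test₂) :
    thermalTwoPoint β g - vacuumTwoPoint g = ((2 * Real.pi) ^ 3 : ℝ)⁻¹ *
      ∫ k : EuclideanSpace ℝ (Fin 3), ((2 * ‖k‖ : ℝ) : ℂ)⁻¹ * ((planck β k : ℂ) *
        (relativeFourier g (onShell k) + relativeFourier g (-onShell k))) := by
  rw [thermalTwoPoint, vacuumTwoPoint, shellDistribution_eq, shellDistribution_eq, ← mul_sub,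
    ← integral_sub (integrable_shellIntegrand (isShellWeight_thermal h hc) g)
      (integrable_shellIntegrand isShellWeight_vacuum g)]
  congr 1
  refine integral_congr_ae (ae_ne_zero.mono fun k hk => ?_)
  have hx := h.pos hc hk
  have hn : 0 < ‖k‖ := norm_pos_iff.2 hk
  have e1 : 0 < onShell k 0 := hn
  have e2 : ¬ 0 < (-onShell k) 0 := by
    rw [Pi.neg_apply]; linarith
  simp only [shellIntegrand, mdot_neg_right, neg_neg, if_pos e1, if_neg e2, planck]
  set x := mdot β (onShell k)
  have he : 1 < Real.exp x := Real.one_lt_exp_iff.2 hx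
  -- The thermal weight is 1 + `planck` on the forward and -`planck` on the backward cone. The
  -- vacuum removes the 1, and the sign ε(p₀) makes both remainders positive.
  have h1 : (1 - Real.exp (-x))⁻¹ = 1 + (Real.exp x - 1)⁻¹ := by
    rw [Real.exp_neg]
    have h2 : Real.exp x - 1 ≠ 0 := by linarith
    have h3 : 1 - (Real.exp x)⁻¹ ≠ 0 := by
      have := inv_lt_one_of_one_lt₀ he
      linarith
    field_simp
    ring
  have h2 : (1 - Real.exp x)⁻¹ = -(Real.exp x - 1)⁻¹ := by rw [← inv_neg]; ring
  rw [h1, h2]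
  push_cast
  ring

theorem measurable_planck_uncurry :
    Measurable fun x : Mink × EuclideanSpace ℝ (Fin 3) => planck x.1 x.2 := by
  have : Measurable fun x : Mink × EuclideanSpace ℝ (Fin 3) => mdot x.1 (onShell x.2) :=
    (continuous_mdot.comp (continuous_fst.prodMk (continuous_onShell.comp
      continuous_snd))).measurable
  unfold planck
  fun_prop

theorem stronglyMeasurable_thermalTwoPoint (h : Test₂) :
    StronglyMeasurable fun β => thermalTwoPoint β h := by
  unfold thermalTwoPoint
  simp only [shellDistribution_eq]
  refine StronglyMeasurable.const_mul ?_ _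
  refine StronglyMeasurable.integral_prod_right (f := fun (β : Mink) k =>
    shellIntegrand (fun p => (1 - Real.exp (-mdot β p))⁻¹) h k) (Measurable.stronglyMeasurable ?_)
  have h1 : Measurable fun x : Mink × EuclideanSpace ℝ (Fin 3) =>
      relativeFourier h (onShell x.2) := (measurable_relativeFourier_onShell h).comp measurable_snd
  have h2 : Measurable fun x : Mink × EuclideanSpace ℝ (Fin 3) =>
      relativeFourier h (-onShell x.2) :=
    (measurable_relativeFourier_neg_onShell h).comp measurable_snd
  have h3 : Measurable fun x : Mink × EuclideanSpace ℝ (Fin 3) => mdot x.1 (onShell x.2) :=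
    (continuous_mdot.comp (continuous_fst.prodMk (continuous_onShell.comp
      continuous_snd))).measurable
  have h4 : Measurable fun x : Mink × EuclideanSpace ℝ (Fin 3) => mdot x.1 (-onShell x.2) :=
    (continuous_mdot.comp (continuous_fst.prodMk (continuous_onShell.comp
      continuous_snd).neg)).measurable
  have h5 : Measurable fun x : Mink × EuclideanSpace ℝ (Fin 3) => ((2 * ‖x.2‖ : ℝ) : ℂ)⁻¹ := by
    fun_prop
  have h6 : Measurable fun x : Mink × EuclideanSpace ℝ (Fin 3) =>
      (((1 - Real.exp (-mdot x.1 (onShell x.2)))⁻¹ : ℝ) : ℂ) := by fun_prop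
  have h7 : Measurable fun x : Mink × EuclideanSpace ℝ (Fin 3) =>
      (((1 - Real.exp (-mdot x.1 (-onShell x.2)))⁻¹ : ℝ) : ℂ) := by fun_prop
  exact h5.mul ((h6.mul h1).sub (h7.mul h2))

/-! ### Fourier transforms in the relative variable -/

/-- The phase `e^{-2iζq}`. -/
def phase (q ζ : Mink) : ℂ := Complex.exp (-(2 * Complex.I) * (mdot ζ q : ℂ))

theorem contDiff_phase (q : Mink) : ContDiff ℝ ∞ (phase q) :=
  Complex.contDiff_exp.comp (contDiff_const.mul (Complex.ofRealCLM.contDiff.comp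
    (contDiff_mdot_left q)))

theorem norm_phase (q ζ : Mink) : ‖phase q ζ‖ = 1 := by
  have : -(2 * Complex.I) * (mdot ζ q : ℂ) = ((-2 * mdot ζ q : ℝ) : ℂ) * Complex.I := by
    push_cast; ring
  rw [phase, this, Complex.norm_exp_ofReal_mul_I]

theorem phase_eq_relativePhase (q ζ : Mink) : phase q ζ = relativePhase q (ζ, -ζ) := by
  have : mdot (ζ - -ζ) q = 2 * mdot ζ q := by rw [mdot_sub_left, mdot_neg_left]; ring
  simp only [phase, relativePhase, this]
  push_cast
  ring_nf

theorem fderiv_phase (q ζ v : Mink) :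
    fderiv ℝ (phase q) ζ v = -(2 * Complex.I) * (mdot v q : ℂ) * phase q ζ := by
  let A : Mink →L[ℝ] Mink × Mink := (ContinuousLinearMap.id ℝ Mink).prod (-ContinuousLinearMap.id ℝ Mink)
  have h1 : phase q = relativePhase q ∘ A := funext fun ζ => phase_eq_relativePhase q ζ
  have h2 : DifferentiableAt ℝ (relativePhase q) (A ζ) :=
    ((contDiff_relativePhase q).differentiable (by simp)).differentiableAt
  rw [h1, fderiv_comp ζ h2 A.differentiableAt, A.fderiv, ContinuousLinearMap.comp_apply,
    fderiv_relativePhase]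
  have : mdot ((A v).1 - (A v).2) q = 2 * mdot v q := by
    change mdot (v - -v) q = _
    rw [mdot_sub_left, mdot_neg_left]; ring
  rw [this]
  push_cast
  simp only [Function.comp]
  ring

/-- The Fourier transform `∫ g(ζ) e^{-2iζq}`. -/
def testFourier {Ω : Opens Mink} (g : 𝓓(Ω, ℂ)) (q : Mink) : ℂ := ∫ ζ, g ζ * phase q ζ

theorem norm_testFourier_le {Ω : Opens Mink} (g : 𝓓(Ω, ℂ)) (q : Mink) :
    ‖testFourier g q‖ ≤ ∫ ζ, ‖g ζ‖ := by
  refine (norm_integral_le_integral_norm _).trans (le_of_eq ?_)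
  simp [norm_phase]

theorem continuous_testFourier {Ω : Opens Mink} (g : 𝓓(Ω, ℂ)) : Continuous (testFourier g) := by
  have hc : ∀ ζ, Continuous fun q : Mink => g ζ * phase q ζ := fun ζ => by
    unfold phase
    refine continuous_const.mul (Complex.continuous_exp.comp (continuous_const.mul
      (Complex.continuous_ofReal.comp ?_)))
    exact continuous_mdot.comp (continuous_const.prodMk continuous_id)
  refine continuous_of_dominated (bound := fun z => ‖g z‖)
    (fun q => (integrable_test_mul volume g (contDiff_phase q).continuous).aestronglyMeasurable)
    (fun q => Eventually.of_forall fun z => ?_) ?_ (Eventually.of_forall hc)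
  · rw [norm_mul, norm_phase, mul_one]
  · exact (g.continuous.integrable_of_hasCompactSupport g.hasCompactSupport).norm

theorem testFourier_zero {Ω : Opens Mink} (g : 𝓓(Ω, ℂ)) : testFourier g 0 = ∫ ζ, g ζ := by
  have : ∀ ζ : Mink, mdot ζ 0 = 0 := fun ζ => by simp [mdot]
  simp [testFourier, phase, this]

theorem testFourier_upperDeriv (ν : Fin 4) (g : Test) (q : Mink) :
    testFourier (upperDeriv ν g) q = 2 * Complex.I * (q ν : ℂ) * testFourier g q := by
  have h1 : testFourier (upperDeriv ν g) q
      = (metricSign ν : ℂ) * ∫ ζ, (∂_{unitVec ν} g) ζ * phase q ζ := by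
    rw [testFourier, ← integral_const_mul]
    congr 1
    ext ζ
    have : upperDeriv ν g ζ = (metricSign ν : ℂ) * (∂_{unitVec ν} g) ζ := rfl
    rw [this, mul_assoc]
  rw [h1, integral_lineDeriv_mul volume g _ (contDiff_phase q)]
  simp only [fderiv_phase, mdot_unitVec]
  rw [testFourier, ← integral_neg, ← integral_const_mul, ← integral_const_mul]
  congr 1
  ext ζ
  have := congrArg (fun r : ℝ => (r : ℂ)) (metricSign_mul_self ν)
  push_cast at this ⊢
  linear_combination (2 * Complex.I * (q ν : ℂ) * g ζ * phase q ζ) * this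

/-- The monomial `q^{μ₁} ⋯ q^{μ_m}`. -/
def momentum (μ : List (Fin 4)) (q : Mink) : ℝ := (μ.map q).prod

theorem testFourier_multiDeriv (μ : List (Fin 4)) (g : Test) (q : Mink) :
    testFourier (multiDeriv μ g) q
      = (2 * Complex.I) ^ μ.length * (momentum μ q : ℂ) * testFourier g q := by
  induction μ with
  | nil => simp [multiDeriv, momentum]
  | cons ν μ ih =>
    have h1 : multiDeriv (ν :: μ) g = upperDeriv ν (multiDeriv μ g) := rfl
    have h2 : momentum (ν :: μ) q = q ν * momentum μ q := by simp [momentum]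
    rw [h1, testFourier_upperDeriv, ih, h2, List.length_cons]
    push_cast
    ring

theorem testFourier_rescale {Ω : Opens Mink} (χ : 𝓓(Ω, ℂ)) {r : ℝ} (hr : 0 < r) (q : Mink) :
    testFourier (rescale χ r) q = testFourier χ (r⁻¹ • q) := by
  have h1 : ∀ ζ, rescale χ r ζ * phase q ζ
      = (r : ℂ) ^ 4 * (χ (r • ζ) * phase (r⁻¹ • q) (r • ζ)) := fun ζ => by
    have h2 : rescale χ r ζ = (r : ℂ) ^ 4 * χ (r • ζ) := by
      rw [rescale, dif_neg hr.ne']; rfl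
    have h3 : phase (r⁻¹ • q) (r • ζ) = phase q ζ := by
      rw [phase, phase, mdot_smul_left, mdot_smul_right, mul_inv_cancel_left₀ hr.ne']
    rw [h2, h3, mul_assoc]
  rw [testFourier]
  simp_rw [h1]
  rw [integral_const_mul, Measure.integral_comp_smul volume
    (fun ζ => χ ζ * phase (r⁻¹ • q) ζ) r, testFourier]
  simp only [Module.finrank_fin_fun, Complex.real_smul]
  rw [abs_of_pos (by positivity), ← mul_assoc]
  push_cast
  rw [mul_inv_cancel₀ (by exact_mod_cast (pow_pos hr 4).ne'), one_mul]

/-- The phase depends on ζ = (x₁ - x₂)/2 only, so the integral factorizes and f enters through its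
total integral; this is why the expectation values in KMS states are constant in x. The factor 16 =
2⁴ is the Jacobian. -/
theorem relativeFourier_centerRelative {Ω : Opens Mink} (f : 𝓓(Ω, ℂ)) (g : Test) (q : Mink) :
    relativeFourier (centerRelative f g) q = 16 * (∫ x, f x) * testFourier g q := by
  have hu : Continuous fun ζ => g ζ * phase q ζ := g.continuous.mul (contDiff_phase q).continuous
  have h1 : ∀ z : Mink × Mink, centerRelative f g z * relativePhase q z
      = f ((2 : ℝ)⁻¹ • (z.1 + z.2)) * (g ((2 : ℝ)⁻¹ • (z.1 - z.2)) *
        phase q ((2 : ℝ)⁻¹ • (z.1 - z.2))) := fun z => by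
    have h2 : phase q ((2 : ℝ)⁻¹ • (z.1 - z.2)) = relativePhase q z := by
      rw [phase, mdot_smul_left, relativePhase]
      push_cast
      ring_nf
    rw [h2, ← mul_assoc]
    rfl
  have hint := integrable_mul_relativePhase (centerRelative f g) q
  have hprod : Integrable (fun w : Mink × Mink => f w.1 * (g w.2 * phase q w.2))
      (volume.prod volume) :=
    Integrable.mul_prod (f.continuous.integrable_of_hasCompactSupport f.hasCompactSupport)
      (integrable_test_mul volume g (contDiff_phase q).continuous)
  have hswap : Integrable (Function.uncurry fun y ζ : Mink => f (ζ + y) * (g ζ * phase q ζ))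
      (volume.prod volume) := by
    have hmp := measurePreserving_add_prod (volume : Measure Mink) (volume : Measure Mink)
    refine (hmp.integrable_comp_of_integrable hprod).congr (Eventually.of_forall fun z => ?_)
    simp only [Function.comp, Function.uncurry, add_comm]
  rw [relativeFourier_eq, Measure.volume_eq_prod, integral_prod_symm _ hint]
  simp only [h1]
  -- For fixed x₂ = y substitute x₁ = 2ζ + y; the centre is then ζ + y.
  have h3 : ∀ y : Mink, ∫ x : Mink, f ((2 : ℝ)⁻¹ • (x + y)) * (g ((2 : ℝ)⁻¹ • (x - y)) *
      phase q ((2 : ℝ)⁻¹ • (x - y))) = 16 * ∫ ζ, f (ζ + y) * (g ζ * phase q ζ) := fun y => by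
    have h4 := integral_add_right_eq_self (μ := (volume : Measure Mink)) (fun x : Mink =>
      f ((2 : ℝ)⁻¹ • (x + y)) * (g ((2 : ℝ)⁻¹ • (x - y)) * phase q ((2 : ℝ)⁻¹ • (x - y)))) y
    have h5 := Measure.integral_comp_smul (volume : Measure Mink)
      (fun ζ => f (ζ + y) * (g ζ * phase q ζ)) (2 : ℝ)⁻¹
    rw [← h4]
    have h6 : |(((2 : ℝ)⁻¹) ^ Module.finrank ℝ Mink)⁻¹| = 16 := by
      rw [Module.finrank_fin_fun]; norm_num
    rw [h6, Complex.real_smul] at h5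
    push_cast at h5
    rw [← h5]
    congr 1
    ext x
    have h7 : (2 : ℝ)⁻¹ • (x + y + y) = (2 : ℝ)⁻¹ • x + y := by
      ext i; simp; ring
    have h8 : x + y - y = x := by abel
    rw [h7, h8]
  simp_rw [h3]
  rw [integral_const_mul, integral_integral_swap hswap, mul_assoc]
  congr 1
  have h9 : ∀ ζ : Mink, ∫ y : Mink, f (ζ + y) * (g ζ * phase q ζ)
      = (∫ x, f x) * (g ζ * phase q ζ) := fun ζ => by
    rw [integral_mul_const, integral_add_left_eq_self (μ := (volume : Measure Mink)) (fun x => f x)]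
  simp_rw [h9]
  rw [integral_const_mul]
  rfl

end

section

open scoped ContDiff

/-! ### Thermal functions -/

/-- The weight `|𝐤|⁻² e^{-a |𝐤|}`. -/
def expWeight (a : ℝ) (k : EuclideanSpace ℝ (Fin 3)) : ℝ := ‖k‖⁻¹ * ‖k‖⁻¹ * Real.exp (-a * ‖k‖)

theorem expWeight_nonneg (a : ℝ) (k : EuclideanSpace ℝ (Fin 3)) : 0 ≤ expWeight a k := by
  unfold expWeight; positivity

theorem measurable_expWeight (a : ℝ) : Measurable (expWeight a) := by
  unfold expWeight; fun_prop

/-- In polar coordinates r² cancels the singularity, leaving r^m e^{-ar}. -/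
theorem integrable_expWeight_mul_pow {a : ℝ} (ha : 0 < a) (m : ℕ) :
    Integrable fun k => expWeight a k * ‖k‖ ^ m := by
  refine (integrable_fun_norm_addHaar (volume : Measure (EuclideanSpace ℝ (Fin 3)))
    (f := fun r : ℝ => r⁻¹ * r⁻¹ * Real.exp (-a * r) * r ^ m)).2 ?_
  rw [finrank_euclideanSpace, Fintype.card_fin]
  have h := integrableOn_rpow_mul_exp_neg_mul_rpow (p := 1) (s := (m : ℝ)) (b := a)
    (by linarith [m.cast_nonneg (α := ℝ)]) one_pos ha
  refine h.congr_fun (fun r hr => ?_) measurableSet_Ioi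
  have hr : 0 < r := hr
  simp only [Real.rpow_one, Real.rpow_natCast, smul_eq_mul]
  field_simp

variable {c : ℝ} {β : Mink} {k : EuclideanSpace ℝ (Fin 3)}

theorem planckWeight_le (h : IsColderThan c β) (hc : 0 < c) (hk : k ≠ 0) :
    (2 * ‖k‖)⁻¹ * planck β k ≤ c⁻¹ * expWeight (c / 2) k := by
  have h1 := planck_le h hc hk
  have h2 : (2 * ‖k‖)⁻¹ ≤ ‖k‖⁻¹ := by
    have hn : 0 < ‖k‖ := norm_pos_iff.2 hk
    exact inv_anti₀ hn (by linarith)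
  calc (2 * ‖k‖)⁻¹ * planck β k ≤ ‖k‖⁻¹ * (c⁻¹ * (‖k‖⁻¹ * Real.exp (-(c / 2) * ‖k‖))) :=
        mul_le_mul h2 h1 (planck_nonneg h hc) (by positivity)
    _ = _ := by rw [expWeight]; ring

/-- The integral of `F` with the Planck distribution over the light cone. -/
def planckIntegral (β : Mink) (F : EuclideanSpace ℝ (Fin 3) → ℂ) : ℂ :=
  ((2 * Real.pi) ^ 3 : ℝ)⁻¹ * ∫ k, (((2 * ‖k‖)⁻¹ * planck β k : ℝ) : ℂ) * F k

theorem norm_planckIntegrand_le (h : IsColderThan c β) (hc : 0 < c)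
    {F : EuclideanSpace ℝ (Fin 3) → ℂ} {D : ℝ} {m : ℕ} (hF : ∀ k, ‖F k‖ ≤ D * ‖k‖ ^ m)
    (hk : k ≠ 0) :
    ‖(((2 * ‖k‖)⁻¹ * planck β k : ℝ) : ℂ) * F k‖ ≤ c⁻¹ * D * (expWeight (c / 2) k * ‖k‖ ^ m) := by
  have h0 : 0 ≤ (2 * ‖k‖)⁻¹ * planck β k := mul_nonneg (by positivity) (planck_nonneg h hc)
  rw [norm_mul, Complex.norm_real, Real.norm_of_nonneg h0]
  calc _ ≤ (c⁻¹ * expWeight (c / 2) k) * (D * ‖k‖ ^ m) :=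
        mul_le_mul (planckWeight_le h hc hk) (hF k) (norm_nonneg _)
          (h0.trans (planckWeight_le h hc hk))
    _ = _ := by ring

theorem measurable_planck (β : Mink) : Measurable (planck β) :=
  measurable_planck_uncurry.comp measurable_prodMk_left

theorem measurable_planckWeight (β : Mink) :
    Measurable fun k => (2 * ‖k‖)⁻¹ * planck β k :=
  (by fun_prop : Measurable fun k : EuclideanSpace ℝ (Fin 3) => (2 * ‖k‖)⁻¹).mul
    (measurable_planck β)

theorem integrable_planckIntegrand (h : IsColderThan c β) (hc : 0 < c)
    {F : EuclideanSpace ℝ (Fin 3) → ℂ} {D : ℝ} {m : ℕ} (hF : ∀ k, ‖F k‖ ≤ D * ‖k‖ ^ m)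
    (hFm : Measurable F) :
    Integrable fun k => (((2 * ‖k‖)⁻¹ * planck β k : ℝ) : ℂ) * F k :=
  ((integrable_expWeight_mul_pow (half_pos hc) m).const_mul _).mono'
    (((Complex.measurable_ofReal.comp (measurable_planckWeight β)).mul hFm).aestronglyMeasurable)
    (ae_ne_zero.mono fun _ hk => norm_planckIntegrand_le h hc hF hk)

theorem norm_planckIntegral_le (h : IsColderThan c β) (hc : 0 < c)
    {F : EuclideanSpace ℝ (Fin 3) → ℂ} {D : ℝ} {m : ℕ} (hF : ∀ k, ‖F k‖ ≤ D * ‖k‖ ^ m) :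
    ‖planckIntegral β F‖ ≤ ((2 * Real.pi) ^ 3)⁻¹ *
      (c⁻¹ * D * ∫ k, expWeight (c / 2) k * ‖k‖ ^ m) := by
  rw [planckIntegral, norm_mul, Complex.norm_real, Real.norm_of_nonneg (by positivity),
    ← integral_const_mul]
  exact mul_le_mul_of_nonneg_left (norm_integral_le_of_norm_le
    ((integrable_expWeight_mul_pow (half_pos hc) m).const_mul _)
    (ae_ne_zero.mono fun _ hk => norm_planckIntegrand_le h hc hF hk)) (by positivity)

theorem planckIntegral_const_mul (β : Mink) (a : ℂ) (F : EuclideanSpace ℝ (Fin 3) → ℂ) :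
    planckIntegral β (fun k => a * F k) = a * planckIntegral β F := by
  have : ∀ k, (((2 * ‖k‖)⁻¹ * planck β k : ℝ) : ℂ) * (a * F k)
      = a * ((((2 * ‖k‖)⁻¹ * planck β k : ℝ) : ℂ) * F k) := fun k => mul_left_comm _ _ _
  simp only [planckIntegral, this]
  rw [integral_const_mul, mul_left_comm]

theorem stronglyMeasurable_planckIntegral {F : EuclideanSpace ℝ (Fin 3) → ℂ}
    (hF : Measurable F) : StronglyMeasurable fun β => planckIntegral β F := by
  unfold planckIntegral
  refine StronglyMeasurable.const_mul ?_ _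
  refine StronglyMeasurable.integral_prod_right (f := fun (β : Mink) k =>
    (((2 * ‖k‖)⁻¹ * planck β k : ℝ) : ℂ) * F k) (Measurable.stronglyMeasurable ?_)
  have h1 : Measurable fun x : Mink × EuclideanSpace ℝ (Fin 3) => (2 * ‖x.2‖)⁻¹ := by fun_prop
  exact (Complex.measurable_ofReal.comp (h1.mul measurable_planck_uncurry)).mul
    (hF.comp measurable_snd)

theorem momentum_cons (ν : Fin 4) (μ : List (Fin 4)) (q : Mink) :
    momentum (ν :: μ) q = q ν * momentum μ q := by simp [momentum]

theorem momentum_neg (μ : List (Fin 4)) (q : Mink) :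
    momentum μ (-q) = (-1) ^ μ.length * momentum μ q := by
  induction μ with
  | nil => simp [momentum]
  | cons ν μ ih =>
    rw [momentum_cons, momentum_cons, ih, List.length_cons, Pi.neg_apply]; ring

theorem abs_momentum_onShell_le (μ : List (Fin 4)) (k : EuclideanSpace ℝ (Fin 3)) :
    |momentum μ (onShell k)| ≤ ‖k‖ ^ μ.length := by
  induction μ with
  | nil => simp [momentum]
  | cons ν μ ih =>
    rw [momentum_cons, abs_mul, List.length_cons, pow_succ']
    exact mul_le_mul (abs_onShell_le k ν) ih (abs_nonneg _) (norm_nonneg _)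

theorem continuous_momentum_onShell (μ : List (Fin 4)) :
    Continuous fun k => momentum μ (onShell k) := by
  induction μ with
  | nil => simp only [momentum, List.map_nil, List.prod_nil]; exact continuous_const
  | cons ν μ ih =>
    simp only [momentum_cons]
    exact ((continuous_apply ν).comp continuous_onShell).mul ih

/-- The thermal function `Θ^μ(β)`. -/
def thermalMoment (μ : List (Fin 4)) (β : Mink) : ℂ :=
  planckIntegral β fun k => (-(2 * Complex.I)) ^ μ.length * (1 + (-1) ^ μ.length) *
    (momentum μ (onShell k) : ℂ)

/-- The regularized version of the integrand of `thermalMoment`. -/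
def smearedMoment (μ : List (Fin 4)) {Ω : Opens Mink} (χ : 𝓓(Ω, ℂ)) (r : ℝ)
    (k : EuclideanSpace ℝ (Fin 3)) : ℂ :=
  (-(2 * Complex.I)) ^ μ.length * (momentum μ (onShell k) : ℂ) *
    (testFourier χ (r⁻¹ • onShell k) + (-1) ^ μ.length * testFourier χ (r⁻¹ • -onShell k))

variable (μ : List (Fin 4)) {Ω Ω' : Opens Mink} (f : 𝓓(Ω', ℂ)) (χ : 𝓓(Ω, ℂ))

theorem norm_smearedMoment_le (r : ℝ) (k : EuclideanSpace ℝ (Fin 3)) :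
    ‖smearedMoment μ χ r k‖ ≤ (2 ^ μ.length * (2 * ∫ ζ, ‖χ ζ‖)) * ‖k‖ ^ μ.length := by
  have h1 : ‖testFourier χ (r⁻¹ • onShell k)
      + (-1) ^ μ.length * testFourier χ (r⁻¹ • -onShell k)‖ ≤ 2 * ∫ ζ, ‖χ ζ‖ := by
    refine (norm_add_le _ _).trans ?_
    rw [norm_mul, norm_pow, norm_neg, norm_one, one_pow, one_mul, two_mul]
    exact add_le_add (norm_testFourier_le χ _) (norm_testFourier_le χ _)
  have h2 := abs_momentum_onShell_le μ k
  rw [smearedMoment, norm_mul, norm_mul, norm_pow, Complex.norm_real, Real.norm_eq_abs, norm_neg,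
    norm_mul, Complex.norm_I, mul_one, Complex.norm_ofNat]
  calc _ ≤ 2 ^ μ.length * ‖k‖ ^ μ.length * (2 * ∫ ζ, ‖χ ζ‖) :=
        mul_le_mul (mul_le_mul_of_nonneg_left h2 (by positivity)) h1 (norm_nonneg _)
          (by positivity)
    _ = _ := by ring

theorem measurable_smearedMoment (r : ℝ) : Measurable (smearedMoment μ χ r) := by
  have h1 : Continuous fun k => testFourier χ (r⁻¹ • onShell k) :=
    (continuous_testFourier χ).comp ((continuous_const_smul r⁻¹).comp continuous_onShell)
  have h2 : Continuous fun k => testFourier χ (r⁻¹ • -onShell k) :=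
    (continuous_testFourier χ).comp ((continuous_const_smul r⁻¹).comp (continuous_neg.comp continuous_onShell))
  have h3 := continuous_momentum_onShell μ
  unfold smearedMoment
  exact ((continuous_const.mul (Complex.continuous_ofReal.comp h3)).mul
    (h1.add (continuous_const.mul h2))).measurable

/-- The sign of the partial integration joins the factors 2i from differentiating e^{-2iζq} to
(-2i)^m, the Jacobian cancels 16⁻¹, and the backward cone contributes (-1)^m by homogeneity of the
monomial. -/
theorem balanced_eq (h : IsColderThan c β) (hc : 0 < c) {r : ℝ} (hr : 0 < r) :
    (-1 : ℂ) ^ μ.length * (16 : ℂ)⁻¹ *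
        (thermalTwoPoint β (centerRelative f (multiDeriv μ (rescale χ r)))
          - vacuumTwoPoint (centerRelative f (multiDeriv μ (rescale χ r))))
      = (∫ x, f x) * planckIntegral β (smearedMoment μ χ r) := by
  have h1 : (-(2 * Complex.I)) ^ μ.length = (-1 : ℂ) ^ μ.length * (2 * Complex.I) ^ μ.length := by
    rw [← mul_pow]; ring
  rw [thermal_sub_vacuum h hc, ← planckIntegral_const_mul, planckIntegral, mul_left_comm]
  congr 1
  rw [← integral_const_mul]
  congr 1
  ext k
  simp only [relativeFourier_centerRelative, testFourier_multiDeriv, testFourier_rescale χ hr,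
    momentum_neg, smearedMoment, h1]
  push_cast
  ring

/-- The Fourier transform of the rescaled χ is bounded by ∫‖χ‖ and tends pointwise to ∫χ, while the
Planck weight absorbs the polynomial: dominated convergence. -/
theorem tendsto_planckIntegral (h : IsColderThan c β) (hc : 0 < c) :
    Tendsto (fun r => planckIntegral β (smearedMoment μ χ r)) atTop
      (𝓝 ((∫ ζ, χ ζ) * thermalMoment μ β)) := by
  have h0 : (∫ ζ, χ ζ) * thermalMoment μ β = planckIntegral β fun k =>
      (-(2 * Complex.I)) ^ μ.length * (momentum μ (onShell k) : ℂ) *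
        (testFourier χ 0 + (-1) ^ μ.length * testFourier χ 0) := by
    rw [thermalMoment, ← planckIntegral_const_mul, testFourier_zero]
    congr 1
    ext k
    ring
  rw [h0]
  refine Tendsto.const_mul _ ?_
  refine tendsto_integral_filter_of_dominated_convergence _
    (Eventually.of_forall fun r => (integrable_planckIntegrand h hc
      (norm_smearedMoment_le μ χ r) (measurable_smearedMoment μ χ r)).aestronglyMeasurable)
    (Eventually.of_forall fun r => ae_ne_zero.mono fun k hk => norm_planckIntegrand_le h hc
      (norm_smearedMoment_le μ χ r) hk)
    ((integrable_expWeight_mul_pow (half_pos hc) _).const_mul _)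
    (Eventually.of_forall fun k => ?_)
  have h1 : ∀ q : Mink, Tendsto (fun r : ℝ => testFourier χ (r⁻¹ • q)) atTop
      (𝓝 (testFourier χ 0)) := fun q => by
    have h2 : Tendsto (fun r : ℝ => r⁻¹ • q) atTop (𝓝 ((0 : ℝ) • q)) :=
      tendsto_inv_atTop_zero.smul_const q
    rw [zero_smul] at h2
    exact ((continuous_testFourier χ).tendsto 0).comp h2
  exact ((((h1 _).add ((h1 _).const_mul _))).const_mul _).const_mul _

theorem isThermalFunction_thermalMoment : IsThermalFunction μ (thermalMoment μ) := by
  intro β hβ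
  obtain ⟨c, hc, h⟩ := exists_isColderThan_of_mem hβ
  refine ⟨(locallyIntegrable_const _).locallyIntegrableOn _, fun f χ => ?_⟩
  rw [integral_mul_const, mul_left_comm]
  refine ((tendsto_planckIntegral μ χ h hc).const_mul (∫ x, f x)).congr' ?_
  filter_upwards [eventually_gt_atTop 0] with r hr
  rw [balanced_eq μ f χ h hc hr]

/-- There are test functions with non-zero integral on non-empty open sets. -/
theorem exists_test_integral_ne_zero (Ω : Opens Mink) (hΩ : (Ω : Set Mink).Nonempty) :
    ∃ f : 𝓓(Ω, ℂ), ∫ x, f x ≠ 0 := by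
  obtain ⟨x, hx⟩ := hΩ
  obtain ⟨ε, hε, hball⟩ := Metric.isOpen_iff.1 Ω.isOpen x hx
  let b : ContDiffBump x := ⟨ε / 4, ε / 2, by positivity, by linarith⟩
  refine ⟨⟨fun y => (b y : ℂ), Complex.ofRealCLM.contDiff.comp b.contDiff,
    b.hasCompactSupport.comp_left (g := fun y : ℝ => (y : ℂ)) Complex.ofReal_zero, ?_⟩, ?_⟩
  · refine (tsupport_comp_subset (g := fun y : ℝ => (y : ℂ)) Complex.ofReal_zero _).trans ?_
    rw [b.tsupport_eq]
    exact (Metric.closedBall_subset_ball (by change ε / 2 < ε; linarith)).trans hball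
  · change ∫ y, ((b y : ℝ) : ℂ) ≠ 0
    rw [integral_complex_ofReal]
    exact_mod_cast (b.integral_pos (μ := volume)).ne'

theorem exists_spacelike_test : ∃ χ : 𝓓(spacelike, ℂ), ∫ x, χ x ≠ 0 := by
  refine exists_test_integral_ne_zero _ ⟨unitVec 1, ?_⟩
  change mdot (unitVec 1) (unitVec 1) < 0
  rw [mdot_unitVec]
  simp [metricSign, unitVec]

theorem exists_top_test : ∃ f : Test, ∫ x, f x ≠ 0 :=
  exists_test_integral_ne_zero _ ⟨0, trivial⟩

/-- Limits are unique, and f and χ with non-zero integrals allow the smearing factors to be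
cancelled. -/
theorem IsThermalFunction.eq {μ : List (Fin 4)} {Θ : Mink → ℂ} (h : IsThermalFunction μ Θ)
    (hβ : β ∈ forwardCone) : Θ β = thermalMoment μ β := by
  obtain ⟨f, hf⟩ := exists_top_test
  obtain ⟨χ, hχ⟩ := exists_spacelike_test
  have h1 := tendsto_nhds_unique ((h β hβ).2 f χ)
    ((isThermalFunction_thermalMoment μ β hβ).2 f χ)
  rw [integral_mul_const, integral_mul_const] at h1
  exact mul_left_cancel₀ hf (mul_left_cancel₀ hχ h1)

end

/-! ### Two-point distributions -/

theorem IsTwoPointDistribution.unique {ω : FieldState} {T T' : Test₂ →L[ℂ] ℂ}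
    (h : IsTwoPointDistribution ω T) (h' : IsTwoPointDistribution ω T') : T = T' :=
  sub_eq_zero.1 (eq_zero_of_tensor_eq_zero (T - T') fun f g => by
    rw [sub_apply, h f g, h' f g, sub_self])

theorem exists_shellDistribution_clm {w : Mink → ℝ} {A : ℝ} (hw : IsShellWeight w A) :
    ∃ T : Test₂ →L[ℂ] ℂ, ∀ h, T h = shellDistribution w h := by
  refine exists_clm_of_norm_le _ (shellDistribution_add hw) (shellDistribution_smul w)
    fun K hK => ⟨((2 * Real.pi) ^ 3)⁻¹ * (A * volume.real K * ∫ k, shellMajorant k), fun h hh => ?_⟩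
  exact (norm_shellDistribution_le hw hK h hh).trans (le_of_eq (by ring))

theorem quasifree_pair (W : Test₂ → ℂ) (f g : Test) : quasifree W [f, g] = W (tensor f g) := by
  rw [quasifree]
  simp [quasifree]

theorem monomial_pair (f g : Test) : monomial [f, g] = field f * field g := by
  simp [monomial]

/-! ### Mixtures of KMS two-point functions. -/

section Mixtures

variable {B : Set Mink} {ρ : Measure Mink} [IsProbabilityMeasure ρ] {c : ℝ}

theorem integrable_thermalTwoPoint (hc : 0 < c) (hB : ∀ᵐ β ∂ρ, IsColderThan c β) (h : Test₂) :
    Integrable (fun β => thermalTwoPoint β h) ρ :=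
  Integrable.of_bound (stronglyMeasurable_thermalTwoPoint h).aestronglyMeasurable _
    (hB.mono fun _ hβ => norm_shellDistribution_le (isShellWeight_thermal hβ hc)
      h.hasCompactSupport h subset_rfl)

/-- The bounds for the individual β depend on β only through c, hence survive the average over ρ. -/
theorem exists_mixture_clm (hc : 0 < c) (hB : ∀ᵐ β ∂ρ, IsColderThan c β) :
    ∃ T : Test₂ →L[ℂ] ℂ, ∀ h, T h = ∫ β, thermalTwoPoint β h ∂ρ := by
  refine exists_clm_of_norm_le _ (fun f g => ?_) (fun a f => ?_) fun K hK =>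
    ⟨((2 * Real.pi) ^ 3)⁻¹ * ((1 + c⁻¹) * volume.real K * ∫ k, shellMajorant k), fun h hh => ?_⟩
  · rw [← integral_add (integrable_thermalTwoPoint hc hB f) (integrable_thermalTwoPoint hc hB g)]
    exact integral_congr_ae (hB.mono fun β hβ =>
      shellDistribution_add (isShellWeight_thermal hβ hc) f g)
  · rw [smul_eq_mul, ← integral_const_mul]
    exact integral_congr_ae (Eventually.of_forall fun β => shellDistribution_smul _ a f)
  · have h1 := norm_integral_le_of_norm_le_const (μ := ρ) (hB.mono fun β hβ =>
      norm_shellDistribution_le (isShellWeight_thermal hβ hc) hK h hh)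
    refine h1.trans (le_of_eq ?_)
    rw [probReal_univ]
    ring

theorem norm_thermalMoment_le (hc : 0 < c) (μ : List (Fin 4)) :
    ∃ C, ∀ β, IsColderThan c β → ‖thermalMoment μ β‖ ≤ C := by
  refine ⟨_, fun β hβ => norm_planckIntegral_le (m := μ.length) (D := 2 ^ μ.length * 2) hβ hc
    fun k => ?_⟩
  rw [norm_mul, norm_mul, norm_pow, norm_neg, norm_mul, Complex.norm_I, mul_one,
    Complex.norm_ofNat, Complex.norm_real, Real.norm_eq_abs]
  have h1 : ‖(1 + (-1) ^ μ.length : ℂ)‖ ≤ 2 := by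
    refine (norm_add_le _ _).trans ?_
    rw [norm_pow, norm_neg, norm_one, one_pow]; norm_num
  exact mul_le_mul (mul_le_mul_of_nonneg_left h1 (by positivity)) (abs_momentum_onShell_le μ k)
    (abs_nonneg _) (by positivity)

theorem stronglyMeasurable_thermalMoment (μ : List (Fin 4)) :
    StronglyMeasurable (thermalMoment μ) :=
  stronglyMeasurable_planckIntegral ((continuous_const.mul
    (Complex.continuous_ofReal.comp (continuous_momentum_onShell μ))).measurable)

theorem integrable_thermalMoment (hc : 0 < c) (hB : ∀ᵐ β ∂ρ, IsColderThan c β)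
    (μ : List (Fin 4)) : Integrable (thermalMoment μ) ρ := by
  obtain ⟨C, hC⟩ := norm_thermalMoment_le hc μ
  exact Integrable.of_bound (stronglyMeasurable_thermalMoment μ).aestronglyMeasurable C
    (hB.mono hC)

/-- A second dominated convergence, now in β, with a constant majorant that depends on c but not on
β or r. -/
theorem tendsto_mixture (hc : 0 < c) (hB : ∀ᵐ β ∂ρ, IsColderThan c β) (μ : List (Fin 4))
    (f : Test) (χ : 𝓓(spacelike, ℂ)) :
    Tendsto (fun r : ℝ => (-1 : ℂ) ^ μ.length * (16 : ℂ)⁻¹ *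
        ((∫ β, thermalTwoPoint β (centerRelative f (multiDeriv μ (rescale χ r))) ∂ρ)
          - vacuumTwoPoint (centerRelative f (multiDeriv μ (rescale χ r)))))
      atTop (𝓝 ((∫ ζ, χ ζ) * ((∫ x, f x) * ∫ β, thermalMoment μ β ∂ρ))) := by
  have h1 : Tendsto (fun r : ℝ => (∫ x, f x) * ∫ β, planckIntegral β (smearedMoment μ χ r) ∂ρ)
      atTop (𝓝 ((∫ x, f x) * ∫ β, (∫ ζ, χ ζ) * thermalMoment μ β ∂ρ)) := by
    refine Tendsto.const_mul _ (tendsto_integral_filter_of_dominated_convergence (fun _ =>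
      ((2 * Real.pi) ^ 3)⁻¹ * (c⁻¹ * (2 ^ μ.length * (2 * ∫ ζ, ‖χ ζ‖)) *
        ∫ k, expWeight (c / 2) k * ‖k‖ ^ μ.length)) ?_ ?_ (integrable_const _) ?_)
    · exact Eventually.of_forall fun r => (stronglyMeasurable_planckIntegral
        (measurable_smearedMoment μ χ r)).aestronglyMeasurable
    · exact Eventually.of_forall fun r => hB.mono fun β hβ =>
        norm_planckIntegral_le hβ hc (norm_smearedMoment_le μ χ r)
    · exact hB.mono fun β hβ => tendsto_planckIntegral μ χ hβ hc
  rw [integral_const_mul, mul_left_comm] at h1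
  refine h1.congr' ?_
  filter_upwards [eventually_gt_atTop 0] with r hr
  set h := centerRelative f (multiDeriv μ (rescale χ r)) with hh
  have h2 : (∫ β, thermalTwoPoint β h ∂ρ) - vacuumTwoPoint h
      = ∫ β, (thermalTwoPoint β h - vacuumTwoPoint h) ∂ρ := by
    rw [integral_sub (integrable_thermalTwoPoint hc hB h) (integrable_const _), integral_const,
      probReal_univ, one_smul]
  rw [h2, ← integral_const_mul, ← integral_const_mul]
  exact integral_congr_ae (hB.mono fun β hβ => (balanced_eq μ f χ hβ hc hr).symm)

end Mixtures

/-- The expectation values of the local observables in a reference state are mixtures of the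
thermal functions. -/
theorem IsReferenceState.exists_measure {B : Set Mink} {ωB : FieldState}
    (h : IsReferenceState B ωB) (hB : B ⊆ forwardCone) (hBc : IsCompact B) :
    ∃ ρ : Measure Mink, IsProbabilityMeasure ρ ∧ (∀ᵐ β ∂ρ, β ∈ B) ∧
      ∀ μ t, HasBalancedExpectation ωB ⊤ μ (fun _ => t) → t = ∫ β, thermalMoment μ β ∂ρ := by
  obtain ⟨ρ, hρ, hρB, hmon⟩ := h
  have hmem : ∀ᵐ β ∂ρ, β ∈ B := mem_ae_iff.2 hρB
  refine ⟨ρ, hρ, hmem, fun μ t ht => ?_⟩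
  obtain ⟨c, hc, hcB⟩ := exists_isColderThan hB hBc
  have hcold : ∀ᵐ β ∂ρ, IsColderThan c β := hmem.mono hcB
  obtain ⟨T, hT, -, hlim⟩ := ht
  obtain ⟨T₀, hT₀⟩ := exists_mixture_clm hc hcold
  have hT₀' : IsTwoPointDistribution ωB T₀ := fun f g => by
    rw [hT₀, ← monomial_pair, hmon]
    simp only [quasifree_pair]
  -- The distribution T comes from the definition of the expectation value and T₀ is the explicit
  -- mixture. They agree on products, hence everywhere.
  obtain rfl := hT.unique hT₀'
  obtain ⟨f, hf⟩ := exists_top_test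
  obtain ⟨χ, hχ⟩ := exists_spacelike_test
  have h1 := hlim f χ
  simp only [hT₀] at h1
  have h2 := tendsto_nhds_unique h1 (tendsto_mixture hc hcold μ f χ)
  rw [integral_mul_const] at h2
  exact mul_left_cancel₀ hf (mul_left_cancel₀ hχ h2)

/-! ### The field equation for the two-point function -/

section Products

variable {Ω : Opens Mink}

theorem fderiv_mul_comp {Ω' : Opens Mink} (f : 𝓓(Ω, ℂ)) (g : 𝓓(Ω', ℂ))
    (A B : Mink × Mink →L[ℝ] Mink) (z v : Mink × Mink) :
    fderiv ℝ (fun z => f (A z) * g (B z)) z v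
      = (∂_{A v} f) (A z) * g (B z) + f (A z) * (∂_{B v} g) (B z) := by
  have hf : HasFDerivAt (fun z => f (A z)) ((fderiv ℝ f (A z)).comp A) z :=
    ((f.contDiff.differentiable (by simp)).differentiableAt.hasFDerivAt).comp z A.hasFDerivAt
  have hg : HasFDerivAt (fun z => g (B z)) ((fderiv ℝ g (B z)).comp B) z :=
    ((g.contDiff.differentiable (by simp)).differentiableAt.hasFDerivAt).comp z B.hasFDerivAt
  have h := (hf.mul hg).fderiv
  refine (congrArg (fun L : Mink × Mink →L[ℝ] ℂ => L v) h).trans ?_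
  simp only [lineDeriv_test_apply, add_apply, smul_apply,
    ContinuousLinearMap.comp_apply, smul_eq_mul]
  ring

theorem lineDeriv_fst_tensor (f g : Test) (v : Mink) :
    ∂_{((v, 0) : Mink × Mink)} (tensor f g) = tensor (∂_{v} f) g := by
  ext z
  rw [lineDeriv_test_apply]
  refine (fderiv_mul_comp f g (ContinuousLinearMap.fst ℝ Mink Mink)
    (ContinuousLinearMap.snd ℝ Mink Mink) z (v, 0)).trans ?_
  simp [lineDeriv_test_apply]
  rfl

theorem lineDeriv_snd_tensor (f g : Test) (v : Mink) :
    ∂_{((0, v) : Mink × Mink)} (tensor f g) = tensor f (∂_{v} g) := by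
  ext z
  rw [lineDeriv_test_apply]
  refine (fderiv_mul_comp f g (ContinuousLinearMap.fst ℝ Mink Mink)
    (ContinuousLinearMap.snd ℝ Mink Mink) z (0, v)).trans ?_
  simp [lineDeriv_test_apply]
  rfl

theorem lineDeriv_fst_centerRelative (f : 𝓓(Ω, ℂ)) (g : Test) (v : Mink) :
    ∂_{((v, 0) : Mink × Mink)} (centerRelative f g)
      = (2⁻¹ : ℂ) • (centerRelative (∂_{v} f) g + centerRelative f (∂_{v} g)) := by
  ext z
  rw [lineDeriv_test_apply]
  refine (fderiv_mul_comp f g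
    ((2 : ℝ)⁻¹ • (ContinuousLinearMap.fst ℝ Mink Mink + ContinuousLinearMap.snd ℝ Mink Mink))
    ((2 : ℝ)⁻¹ • (ContinuousLinearMap.fst ℝ Mink Mink - ContinuousLinearMap.snd ℝ Mink Mink))
    z (v, 0)).trans ?_
  change _ = (2⁻¹ : ℂ) * ((∂_{v} f) ((2 : ℝ)⁻¹ • (z.1 + z.2)) * g ((2 : ℝ)⁻¹ • (z.1 - z.2))
    + f ((2 : ℝ)⁻¹ • (z.1 + z.2)) * (∂_{v} g) ((2 : ℝ)⁻¹ • (z.1 - z.2)))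
  simp [lineDeriv_test_apply]
  ring

theorem lineDeriv_snd_centerRelative (f : 𝓓(Ω, ℂ)) (g : Test) (v : Mink) :
    ∂_{((0, v) : Mink × Mink)} (centerRelative f g)
      = (2⁻¹ : ℂ) • (centerRelative (∂_{v} f) g - centerRelative f (∂_{v} g)) := by
  ext z
  rw [lineDeriv_test_apply]
  refine (fderiv_mul_comp f g
    ((2 : ℝ)⁻¹ • (ContinuousLinearMap.fst ℝ Mink Mink + ContinuousLinearMap.snd ℝ Mink Mink))
    ((2 : ℝ)⁻¹ • (ContinuousLinearMap.fst ℝ Mink Mink - ContinuousLinearMap.snd ℝ Mink Mink))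
    z (0, v)).trans ?_
  change _ = (2⁻¹ : ℂ) * ((∂_{v} f) ((2 : ℝ)⁻¹ • (z.1 + z.2)) * g ((2 : ℝ)⁻¹ • (z.1 - z.2))
    - f ((2 : ℝ)⁻¹ • (z.1 + z.2)) * (∂_{v} g) ((2 : ℝ)⁻¹ • (z.1 - z.2)))
  simp [lineDeriv_test_apply]
  ring

end Products

/-- A distribution of two variables which satisfies the wave equation in each of them. -/
structure IsWaveSolution (S : Test₂ →L[ℂ] ℂ) : Prop where
  fst : ∀ h : Test₂, ∑ ν, (metricSign ν : ℂ) *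
    S (∂_{((unitVec ν, 0) : Mink × Mink)} (∂_{((unitVec ν, 0) : Mink × Mink)} h)) = 0
  snd : ∀ h : Test₂, ∑ ν, (metricSign ν : ℂ) *
    S (∂_{((0, unitVec ν) : Mink × Mink)} (∂_{((0, unitVec ν) : Mink × Mink)} h)) = 0

theorem IsWaveSolution.sub {S S' : Test₂ →L[ℂ] ℂ} (h : IsWaveSolution S) (h' : IsWaveSolution S') :
    IsWaveSolution (S - S') := by
  constructor <;> intro g
  · have h1 := h.fst g
    have h2 := h'.fst g
    simp only [sub_apply, mul_sub, Finset.sum_sub_distrib, h1, h2, sub_zero]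
  · have h1 := h.snd g
    have h2 := h'.snd g
    simp only [sub_apply, mul_sub, Finset.sum_sub_distrib, h1, h2, sub_zero]

theorem field_box (f : Test) : field (box f) = 0 :=
  (RingQuot.mkAlgHom_rel ℂ (FieldRel.wave f)).trans (map_zero _)

theorem box_apply {Ω : Opens Mink} (f : 𝓓(Ω, ℂ)) (x : Mink) :
    (box f) x = ∑ ν, (metricSign ν : ℂ) * (∂_{unitVec ν} (∂_{unitVec ν} f)) x := by
  rw [box, Fin.sum_univ_four, Fin.sum_univ_four]
  rfl

theorem sum_smul_test₂_apply (a : Fin 4 → ℂ) (F : Fin 4 → Test₂) (z : Mink × Mink) :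
    (∑ ν, a ν • F ν) z = ∑ ν, a ν * F ν z := by
  rw [Fin.sum_univ_four, Fin.sum_univ_four]
  rfl

theorem tensor_apply (f g : Test) (z : Mink × Mink) : tensor f g z = f z.1 * g z.2 := rfl

theorem centerRelative_apply {Ω : Opens Mink} (f : 𝓓(Ω, ℂ)) (g : Test) (z : Mink × Mink) :
    centerRelative f g z = f ((2 : ℝ)⁻¹ • (z.1 + z.2)) * g ((2 : ℝ)⁻¹ • (z.1 - z.2)) := rfl

theorem tensor_box_left (f g : Test) :
    tensor (box f) g = ∑ ν, (metricSign ν : ℂ) • tensor (∂_{unitVec ν} (∂_{unitVec ν} f)) g := by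
  ext z
  simp only [sum_smul_test₂_apply, tensor_apply, box_apply, Finset.sum_mul, mul_assoc]

theorem tensor_box_right (f g : Test) :
    tensor f (box g) = ∑ ν, (metricSign ν : ℂ) • tensor f (∂_{unitVec ν} (∂_{unitVec ν} g)) := by
  ext z
  simp only [sum_smul_test₂_apply, tensor_apply, box_apply, Finset.mul_sum, mul_left_comm]

/-- On products this is the relation `field_box` in the algebra; totality extends it to all test
functions of two variables. -/
theorem IsTwoPointDistribution.isWaveSolution {ω : FieldState} {T : Test₂ →L[ℂ] ℂ}
    (hT : IsTwoPointDistribution ω T) : IsWaveSolution T := by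
  constructor
  · let D := fun ν => TestFunction.lineDerivCLM (n := ⊤) (k := ⊤) (Ω := (⊤ : Opens (Mink × Mink)))
      (F := ℂ) ℂ ((unitVec ν, 0) : Mink × Mink)
    have h : ∑ ν, (metricSign ν : ℂ) • (T ∘L D ν ∘L D ν) = 0 := by
      refine eq_zero_of_tensor_eq_zero _ fun f g => ?_
      have h1 : ∀ ν, (D ν) ((D ν) (tensor f g)) = tensor (∂_{unitVec ν} (∂_{unitVec ν} f)) g :=
        fun ν => by
          rw [← lineDeriv_fst_tensor, ← lineDeriv_fst_tensor]; rfl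
      have h2 := hT (box f) g
      rw [field_box, zero_mul, map_zero, tensor_box_left, map_sum] at h2
      rw [← h2, sum_apply]
      refine Finset.sum_congr rfl fun ν _ => ?_
      rw [map_smul, ← h1]
      rfl
    intro g
    have h1 := congrArg (fun L : Test₂ →L[ℂ] ℂ => L g) h
    simp only [sum_apply] at h1
    exact h1
  · let D := fun ν => TestFunction.lineDerivCLM (n := ⊤) (k := ⊤) (Ω := (⊤ : Opens (Mink × Mink)))
      (F := ℂ) ℂ ((0, unitVec ν) : Mink × Mink)
    have h : ∑ ν, (metricSign ν : ℂ) • (T ∘L D ν ∘L D ν) = 0 := by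
      refine eq_zero_of_tensor_eq_zero _ fun f g => ?_
      have h1 : ∀ ν, (D ν) ((D ν) (tensor f g)) = tensor f (∂_{unitVec ν} (∂_{unitVec ν} g)) :=
        fun ν => by
          rw [← lineDeriv_snd_tensor, ← lineDeriv_snd_tensor]; rfl
      have h2 := hT f (box g)
      rw [field_box, mul_zero, map_zero, tensor_box_right, map_sum] at h2
      rw [← h2, sum_apply]
      refine Finset.sum_congr rfl fun ν _ => ?_
      rw [map_smul, ← h1]
      rfl
    intro g
    have h1 := congrArg (fun L : Test₂ →L[ℂ] ℂ => L g) h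
    simp only [sum_apply] at h1
    exact h1

/-- Under `relativeFourier` the wave operator becomes multiplication by -q², which vanishes on both
cones, whatever the weight. It is needed for the vacuum contribution. -/
theorem isWaveSolution_of_relativeFourier {w : Mink → ℝ} {S : Test₂ →L[ℂ] ℂ}
    (hS : ∀ h, S h = shellDistribution w h) : IsWaveSolution S := by
  have hzero : ∀ h : Test₂, (∀ k, relativeFourier h (onShell k) = 0 ∧
      relativeFourier h (-onShell k) = 0) → S h = 0 := fun h hh => by
    rw [hS, shellDistribution_eq]
    have : shellIntegrand w h = fun _ => 0 := funext fun k => by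
      rw [shellIntegrand, (hh k).1, (hh k).2]; ring
    rw [this, integral_zero, mul_zero]
  have hm : ∀ q : Mink, mdot q q = 0 →
      ∑ ν, (metricSign ν : ℂ) * ((metricSign ν * q ν : ℝ) : ℂ) ^ 2 = 0 := fun q hq => by
    have h1 : ∑ ν, metricSign ν * (metricSign ν * q ν) ^ 2 = mdot q q := by
      refine Finset.sum_congr rfl fun ν _ => ?_
      linear_combination (metricSign ν * q ν ^ 2) * metricSign_mul_self ν
    rw [hq] at h1
    exact_mod_cast congrArg (fun x : ℝ => (x : ℂ)) h1
  have hRFsum : ∀ (F : Fin 4 → Test₂) (a : Fin 4 → ℂ) (q : Mink),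
      relativeFourier (∑ ν, a ν • F ν) q = ∑ ν, a ν * relativeFourier (F ν) q := fun F a q => by
    simp only [Fin.sum_univ_four, relativeFourier_add, relativeFourier_smul]
  have hRF : ∀ (v : Fin 4 → Mink × Mink), (∀ ν, (v ν).1 - (v ν).2 = unitVec ν ∨
      (v ν).1 - (v ν).2 = -unitVec ν) → ∀ (h : Test₂) (q : Mink), mdot q q = 0 →
      relativeFourier (∑ ν, (metricSign ν : ℂ) • ∂_{v ν} (∂_{v ν} h)) q = 0 := by
    intro v hv h q hq
    rw [hRFsum]
    have h1 : ∀ ν, (mdot ((v ν).1 - (v ν).2) q : ℂ) ^ 2 = ((metricSign ν * q ν : ℝ) : ℂ) ^ 2 :=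
      fun ν => by
        rcases hv ν with h | h <;> rw [h]
        · rw [mdot_unitVec]
        · rw [mdot_neg_left, mdot_unitVec]; push_cast; ring
    have h2 : ∀ ν, (metricSign ν : ℂ) * relativeFourier (∂_{v ν} (∂_{v ν} h)) q
        = (metricSign ν : ℂ) * ((metricSign ν * q ν : ℝ) : ℂ) ^ 2 *
          (Complex.I ^ 2 * relativeFourier h q) := fun ν => by
      rw [relativeFourier_lineDeriv, relativeFourier_lineDeriv, ← h1]
      ring
    simp only [h2]
    rw [← Finset.sum_mul, hm q hq, zero_mul]
  have hneg : ∀ k, mdot (-onShell k) (-onShell k) = 0 := fun k => by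
    rw [mdot_neg_left, mdot_neg_right, neg_neg, mdot_onShell_self]
  have hfin : ∀ (v : Fin 4 → Mink × Mink), (∀ ν, (v ν).1 - (v ν).2 = unitVec ν ∨
      (v ν).1 - (v ν).2 = -unitVec ν) → ∀ h : Test₂,
      ∑ ν, (metricSign ν : ℂ) * S (∂_{v ν} (∂_{v ν} h)) = 0 := by
    intro v hv h
    have h1 := hzero (∑ ν, (metricSign ν : ℂ) • ∂_{v ν} (∂_{v ν} h)) fun k =>
      ⟨hRF v hv h _ (mdot_onShell_self k), hRF v hv h _ (hneg k)⟩
    rw [map_sum] at h1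
    simpa only [map_smul, smul_eq_mul] using h1
  exact ⟨hfin _ fun ν => Or.inl (by simp), hfin _ fun ν => Or.inr (by simp)⟩

/-! ### The wave equations in centre and relative coordinates. -/

section CenterRelative

variable {Ω : Opens Mink} (f : 𝓓(Ω, ℂ)) (g : Test) {S : Test₂ →L[ℂ] ℂ}

/-- The square of ∂₁ = (∂_x + ∂_ζ)/2; for the second variable ∂₂ = (∂_x - ∂_ζ)/2. -/
theorem map_lineDeriv_fst_centerRelative (v : Mink) :
    S (∂_{((v, 0) : Mink × Mink)} (∂_{((v, 0) : Mink × Mink)} (centerRelative f g)))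
      = 4⁻¹ * (S (centerRelative (∂_{v} (∂_{v} f)) g) + 2 * S (centerRelative (∂_{v} f) (∂_{v} g))
        + S (centerRelative f (∂_{v} (∂_{v} g)))) := by
  rw [lineDeriv_fst_centerRelative, LineDeriv.lineDerivOp_smul, LineDeriv.lineDerivOp_add,
    lineDeriv_fst_centerRelative, lineDeriv_fst_centerRelative]
  simp only [map_smul, map_add, smul_eq_mul]
  ring

theorem map_lineDeriv_snd_centerRelative (v : Mink) :
    S (∂_{((0, v) : Mink × Mink)} (∂_{((0, v) : Mink × Mink)} (centerRelative f g)))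
      = 4⁻¹ * (S (centerRelative (∂_{v} (∂_{v} f)) g) - 2 * S (centerRelative (∂_{v} f) (∂_{v} g))
        + S (centerRelative f (∂_{v} (∂_{v} g)))) := by
  rw [lineDeriv_snd_centerRelative, LineDeriv.lineDerivOp_smul, sub_eq_add_neg,
    LineDeriv.lineDerivOp_add, LineDeriv.lineDerivOp_neg,
    lineDeriv_snd_centerRelative, lineDeriv_snd_centerRelative]
  simp only [map_smul, map_sub, map_add, map_neg, smul_eq_mul]
  ring

/-- This is □₁ - □₂ = ∂_x·∂_ζ. -/
theorem IsWaveSolution.sum_mixed (hS : IsWaveSolution S) :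
    ∑ ν, (metricSign ν : ℂ) * S (centerRelative (∂_{unitVec ν} f) (∂_{unitVec ν} g)) = 0 := by
  have h1 := hS.fst (centerRelative f g)
  have h2 := hS.snd (centerRelative f g)
  simp only [map_lineDeriv_fst_centerRelative, map_lineDeriv_snd_centerRelative,
    Fin.sum_univ_four] at h1 h2 ⊢
  linear_combination h1 - h2

/-- This is 2(□₁ + □₂) = □_x + □_ζ. -/
theorem IsWaveSolution.sum_pure (hS : IsWaveSolution S) :
    ∑ ν, (metricSign ν : ℂ) * S (centerRelative (∂_{unitVec ν} (∂_{unitVec ν} f)) g)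
      + ∑ ν, (metricSign ν : ℂ) * S (centerRelative f (∂_{unitVec ν} (∂_{unitVec ν} g))) = 0 := by
  have h1 := hS.fst (centerRelative f g)
  have h2 := hS.snd (centerRelative f g)
  simp only [map_lineDeriv_fst_centerRelative, map_lineDeriv_snd_centerRelative,
    Fin.sum_univ_four] at h1 h2 ⊢
  linear_combination 2 * h1 + 2 * h2

theorem map_centerRelative_upperDeriv (ν : Fin 4) :
    S (centerRelative f (upperDeriv ν g))
      = (metricSign ν : ℂ) * S (centerRelative f (∂_{unitVec ν} g)) := by
  have h : centerRelative f (upperDeriv ν g)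
      = (metricSign ν : ℂ) • centerRelative f (∂_{unitVec ν} g) := by
    ext z
    change f _ * ((metricSign ν : ℂ) * (∂_{unitVec ν} g) _)
      = (metricSign ν : ℂ) * (f _ * (∂_{unitVec ν} g) _)
    ring
  rw [h, map_smul, smul_eq_mul]

theorem map_centerRelative_upperDeriv₂ (ν : Fin 4) :
    S (centerRelative f (upperDeriv ν (upperDeriv ν g)))
      = S (centerRelative f (∂_{unitVec ν} (∂_{unitVec ν} g))) := by
  have h : upperDeriv ν (upperDeriv ν g) = ∂_{unitVec ν} (∂_{unitVec ν} g) := by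
    rw [upperDeriv, upperDeriv, LineDeriv.lineDerivOp_smul, smul_smul, metricSign_mul_self, one_smul]
  rw [h]

theorem map_centerRelative_box :
    S (centerRelative (box f) g)
      = ∑ ν, (metricSign ν : ℂ) * S (centerRelative (∂_{unitVec ν} (∂_{unitVec ν} f)) g) := by
  have h : centerRelative (box f) g
      = ∑ ν, (metricSign ν : ℂ) • centerRelative (∂_{unitVec ν} (∂_{unitVec ν} f)) g := by
    ext z
    simp only [sum_smul_test₂_apply, centerRelative_apply, box_apply, Finset.sum_mul, mul_assoc]
  rw [h, map_sum]
  simp only [map_smul, smul_eq_mul]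

end CenterRelative

/-! ### Differential equations for the local observables -/

section LocalObservables

variable {O : Opens Mink} {ω : FieldState} {θ : List (Fin 4) → Mink → ℂ}

/-- The two-point distribution of the state, minus the vacuum contribution, determines the
expectation values of all balanced derivatives. -/
theorem exists_normalOrdered (h : ∀ μ, HasBalancedExpectation ω O μ (θ μ)) :
    ∃ S : Test₂ →L[ℂ] ℂ, IsWaveSolution S ∧ ∀ (μ) (f : 𝓓(O, ℂ)) (χ : 𝓓(spacelike, ℂ)),
      Tendsto (fun r : ℝ => (-1 : ℂ) ^ μ.length * (16 : ℂ)⁻¹ *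
        S (centerRelative f (multiDeriv μ (rescale χ r))))
      atTop (𝓝 ((∫ ζ, χ ζ) * ∫ x, f x * θ μ x)) := by
  obtain ⟨V, hV⟩ := exists_shellDistribution_clm isShellWeight_vacuum
  obtain ⟨T, hT, -⟩ := h []
  refine ⟨T - V, hT.isWaveSolution.sub (isWaveSolution_of_relativeFourier hV), fun μ f χ => ?_⟩
  obtain ⟨T', hT', -, hlim⟩ := h μ
  obtain rfl := hT.unique hT'
  refine (hlim f χ).congr fun r => ?_
  rw [sub_apply, hV]
  rfl

/-- The weak form of the conservation law ∑ ∂_ν θ^{νμ} = 0. By ∂_x·∂_ζ = 0 the regularized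
expression vanishes for every r, already before the limit. -/
theorem sum_integral_lineDeriv_mul_eq_zero (h : ∀ μ, HasBalancedExpectation ω O μ (θ μ))
    (μ : List (Fin 4)) (f : 𝓓(O, ℂ)) :
    ∑ ν, ∫ x, (∂_{unitVec ν} f) x * θ (ν :: μ) x = 0 := by
  obtain ⟨S, hS, hlim⟩ := exists_normalOrdered h
  obtain ⟨χ, hχ⟩ := exists_spacelike_test
  have h1 := tendsto_finsetSum (Finset.univ : Finset (Fin 4))
    fun ν _ => hlim (ν :: μ) (∂_{unitVec ν} f) χ
  have h2 : ∀ r : ℝ, ∑ ν : Fin 4, (-1 : ℂ) ^ (ν :: μ).length * (16 : ℂ)⁻¹ *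
      S (centerRelative (∂_{unitVec ν} f) (multiDeriv (ν :: μ) (rescale χ r))) = 0 := fun r => by
    have h3 := hS.sum_mixed f (multiDeriv μ (rescale χ r))
    have h4 : ∀ ν, multiDeriv (ν :: μ) (rescale χ r)
        = upperDeriv ν (multiDeriv μ (rescale χ r)) := fun ν => rfl
    simp only [h4, map_centerRelative_upperDeriv, List.length_cons]
    rw [← Finset.mul_sum, h3, mul_zero]
  simp only [h2] at h1
  have h3 := tendsto_nhds_unique h1 tendsto_const_nhds
  rw [← Finset.mul_sum] at h3
  exact (mul_eq_zero.1 h3).resolve_left hχ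

/-- The limit of □_x + □_ζ = 0. That the right-hand side vanishes is not used here; it will follow
from thermality. -/
theorem integral_box_mul_eq (h : ∀ μ, HasBalancedExpectation ω O μ (θ μ))
    (μ : List (Fin 4)) (f : 𝓓(O, ℂ)) :
    ∫ x, (box f) x * θ μ x
      = -∑ ν, (metricSign ν : ℂ) * ∫ x, f x * θ (ν :: ν :: μ) x := by
  obtain ⟨S, hS, hlim⟩ := exists_normalOrdered h
  obtain ⟨χ, hχ⟩ := exists_spacelike_test
  have h1 := tendsto_finsetSum (Finset.univ : Finset (Fin 4))
    fun ν _ => (hlim (ν :: ν :: μ) f χ).const_mul (metricSign ν : ℂ)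
  have h2 := hlim μ (box f) χ
  have h3 : ∀ r : ℝ, ∑ ν : Fin 4, (metricSign ν : ℂ) * ((-1 : ℂ) ^ (ν :: ν :: μ).length *
      (16 : ℂ)⁻¹ * S (centerRelative f (multiDeriv (ν :: ν :: μ) (rescale χ r))))
      = -((-1 : ℂ) ^ μ.length * (16 : ℂ)⁻¹ *
        S (centerRelative (box f) (multiDeriv μ (rescale χ r)))) := fun r => by
    have h4 := hS.sum_pure f (multiDeriv μ (rescale χ r))
    have h5 : ∀ ν, multiDeriv (ν :: ν :: μ) (rescale χ r)
        = upperDeriv ν (upperDeriv ν (multiDeriv μ (rescale χ r))) := fun ν => rfl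
    simp only [h5, map_centerRelative_upperDeriv₂, List.length_cons, map_centerRelative_box]
    rw [Finset.sum_congr rfl fun ν _ => mul_left_comm (metricSign ν : ℂ) _ _, ← Finset.mul_sum,
      ← mul_neg, eq_neg_of_add_eq_zero_right h4, pow_succ, pow_succ]
    ring
  simp only [h3] at h1
  have h4 := tendsto_nhds_unique h1 h2.neg
  simp only [mul_left_comm _ (∫ ζ, χ ζ)] at h4
  rw [← Finset.mul_sum, ← mul_neg] at h4
  rw [mul_left_cancel₀ hχ h4, neg_neg]

end LocalObservables

/-! ### Uniqueness in the moment problem with exponential moments -/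

theorem eventuallyEq_of_iteratedDeriv_eq {f g : ℂ → ℂ} {z : ℂ} (hf : AnalyticAt ℂ f z)
    (hg : AnalyticAt ℂ g z) (h : ∀ n, iteratedDeriv n f z = iteratedDeriv n g z) :
    f =ᶠ[𝓝 z] g := by
  have h1 := hf.hasFPowerSeriesAt
  have h2 := hg.hasFPowerSeriesAt
  simp only [h] at h1
  filter_upwards [h1.eventually_hasSum_sub, h2.eventually_hasSum_sub] with w hw hw'
  exact hw.unique hw'

section Moments

variable {E : Type*} [NormedAddCommGroup E] [NormedSpace ℝ E] [MeasurableSpace E] [BorelSpace E]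
  {s : ℝ} {ν : Measure E}

/-- On this interval |t|‖L‖ ≤ s; the `+ 1` takes care of L = 0. -/
theorem Ioo_subset_integrableExpSet (h : Integrable (fun x => Real.exp (s * ‖x‖)) ν)
    (L : StrongDual ℝ E) :
    Set.Ioo (-(s / (‖L‖ + 1))) (s / (‖L‖ + 1)) ⊆ ProbabilityTheory.integrableExpSet L ν := by
  intro t ht
  refine h.mono' (by fun_prop) (ae_of_all _ fun x => ?_)
  rw [Real.norm_of_nonneg (Real.exp_pos _).le, Real.exp_le_exp]
  have h1 : |t| ≤ s / (‖L‖ + 1) := (abs_lt.2 ht).le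
  have h2 : |t| * ‖L‖ ≤ s := by
    rw [le_div_iff₀ (by positivity)] at h1
    nlinarith [abs_nonneg t]
  calc t * L x ≤ |t * L x| := le_abs_self _
    _ = |t| * ‖L x‖ := by rw [abs_mul, Real.norm_eq_abs]
    _ ≤ |t| * (‖L‖ * ‖x‖) := mul_le_mul_of_nonneg_left (L.le_opNorm x) (abs_nonneg t)
    _ = |t| * ‖L‖ * ‖x‖ := by ring
    _ ≤ s * ‖x‖ := mul_le_mul_of_nonneg_right h2 (norm_nonneg x)

/-- The complex moment generating functions of L are analytic in the strip |Re z| < r, and their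
derivatives at 0 are the moments. The identity theorem carries the equality from 0 to z = i, where
the values are the characteristic functions at L. -/
theorem measure_eq_of_moments_eq [SecondCountableTopology E] [CompleteSpace E]
    {ν' : Measure E} [IsFiniteMeasure ν] [IsFiniteMeasure ν'] (hs : 0 < s)
    (h : Integrable (fun x => Real.exp (s * ‖x‖)) ν)
    (h' : Integrable (fun x => Real.exp (s * ‖x‖)) ν')
    (hm : ∀ (L : StrongDual ℝ E) (n : ℕ), ∫ x, L x ^ n ∂ν = ∫ x, L x ^ n ∂ν') : ν = ν' := by
  refine Measure.ext_of_charFunDual (funext fun L => ?_)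
  set r := s / (‖L‖ + 1)
  have hr : 0 < r := by positivity
  have hsub := interior_maximal (Ioo_subset_integrableExpSet h L) isOpen_Ioo
  have hsub' := interior_maximal (Ioo_subset_integrableExpSet h' L) isOpen_Ioo
  let U : Set ℂ := {z | z.re ∈ Set.Ioo (-r) r}
  have hU : IsPreconnected U :=
    ((convex_Ioo (-r) r).linear_preimage Complex.reCLM.toLinearMap).isPreconnected
  have h0 : (0 : ℂ) ∈ U := ⟨by simpa using hr, by simpa using hr⟩
  have hI : Complex.I ∈ U := ⟨by simpa using hr, by simpa using hr⟩
  have ha : AnalyticOnNhd ℂ (ProbabilityTheory.complexMGF L ν) U :=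
    ProbabilityTheory.analyticOnNhd_complexMGF.mono fun z hz => hsub hz
  have ha' : AnalyticOnNhd ℂ (ProbabilityTheory.complexMGF L ν') U :=
    ProbabilityTheory.analyticOnNhd_complexMGF.mono fun z hz => hsub' hz
  have hev : ProbabilityTheory.complexMGF L ν =ᶠ[𝓝 0] ProbabilityTheory.complexMGF L ν' := by
    refine eventuallyEq_of_iteratedDeriv_eq (ha 0 h0) (ha' 0 h0) fun n => ?_
    rw [ProbabilityTheory.iteratedDeriv_complexMGF (hsub h0),
      ProbabilityTheory.iteratedDeriv_complexMGF (hsub' h0)]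
    have h1 := congrArg (fun t : ℝ => (t : ℂ)) (hm L n)
    simp only [← integral_complex_ofReal] at h1
    simpa using h1
  have h1 := ha.eqOn_of_preconnected_of_eventuallyEq ha' hU h0 hev hI
  simpa only [ProbabilityTheory.complexMGF, charFunDual_apply, mul_comm] using h1

end Moments

/-! ### Density of the odd polynomials on the light cone -/

section Density

variable {m : Measure (EuclideanSpace ℝ (Fin 3))} {s : ℝ}

/-- Each power of ‖k‖ is at most a constant times the exponential, by a single term of its series.
-/
theorem memLp_of_abs_le_pow (hs : 0 < s) (hm : MemLp (fun k => Real.exp (s * ‖k‖)) 2 m)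
    {F : EuclideanSpace ℝ (Fin 3) → ℝ} (hF : AEStronglyMeasurable F m) {D : ℝ} {n : ℕ}
    (h : ∀ k, |F k| ≤ D * ‖k‖ ^ n) : MemLp F 2 m := by
  refine hm.of_le_mul (c := |D| * (n.factorial / s ^ n)) hF (ae_of_all _ fun k => ?_)
  rw [Real.norm_eq_abs, Real.norm_of_nonneg (Real.exp_pos _).le]
  have h1 := Real.pow_div_factorial_le_exp (s * ‖k‖) (by positivity) n
  have h2 : ‖k‖ ^ n = (n.factorial / s ^ n) * ((s * ‖k‖) ^ n / n.factorial) := by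
    rw [mul_pow]; field_simp
  calc |F k| ≤ D * ‖k‖ ^ n := h k
    _ ≤ |D| * ‖k‖ ^ n := mul_le_mul_of_nonneg_right (le_abs_self D) (by positivity)
    _ ≤ _ := by
      rw [h2, mul_assoc]
      gcongr

theorem apply_eq_sum_coord (L : StrongDual ℝ Mink) (q : Mink) :
    L q = ∑ ν, L (unitVec ν) * q ν := by
  conv_lhs => rw [show q = ∑ ν, q ν • unitVec ν from
    (pi_eq_sum_univ' q).trans (Finset.sum_congr rfl fun ν _ => by
      congr 1)]
  rw [map_sum]
  exact Finset.sum_congr rfl fun ν _ => by rw [map_smul, smul_eq_mul, mul_comm]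

theorem norm_onShell_le (k : EuclideanSpace ℝ (Fin 3)) : ‖onShell k‖ ≤ ‖k‖ :=
  (pi_norm_le_iff_of_nonneg (norm_nonneg k)).2 fun ν => abs_onShell_le k ν

theorem continuous_neg_onShell : Continuous fun k => -onShell k := continuous_onShell.neg

theorem memLp_pow_mul_momentum (hs : 0 < s) (hm : MemLp (fun k => Real.exp (s * ‖k‖)) 2 m)
    (L : StrongDual ℝ Mink) (n : ℕ) (μ : List (Fin 4)) :
    MemLp (fun k => L (onShell k) ^ n * momentum μ (onShell k)) 2 m := by
  refine memLp_of_abs_le_pow hs hm (D := ‖L‖ ^ n) (n := n + μ.length)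
    (((L.continuous.comp continuous_onShell).pow n).mul
      (continuous_momentum_onShell μ)).aestronglyMeasurable fun k => ?_
  rw [abs_mul, abs_pow, pow_add, ← mul_assoc, ← mul_pow]
  have h1 : |L (onShell k)| ≤ ‖L‖ * ‖k‖ :=
    (L.le_opNorm _).trans (mul_le_mul_of_nonneg_left (norm_onShell_le k) (norm_nonneg L))
  exact mul_le_mul (pow_le_pow_left₀ (abs_nonneg _) h1 n) (abs_momentum_onShell_le μ k)
    (abs_nonneg _) (by positivity)

/-- Expanding one factor L(q) = ∑ L(e_ν) q^ν moves it into the monomial and keeps the total degree,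
hence the parity. -/
theorem integral_pow_mul_momentum_mul_eq_zero (hs : 0 < s)
    (hm : MemLp (fun k => Real.exp (s * ‖k‖)) 2 m) {h : EuclideanSpace ℝ (Fin 3) → ℝ}
    (hh : MemLp h 2 m)
    (h0 : ∀ μ : List (Fin 4), Odd μ.length → ∫ k, momentum μ (onShell k) * h k ∂m = 0)
    (L : StrongDual ℝ Mink) (n : ℕ) : ∀ μ : List (Fin 4), Odd (n + μ.length) →
      ∫ k, L (onShell k) ^ n * momentum μ (onShell k) * h k ∂m = 0 := by
  induction n with
  | zero => intro μ hμ; simpa using h0 μ (by simpa using hμ)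
  | succ n ih =>
    intro μ hμ
    have h1 : ∀ k, L (onShell k) ^ (n + 1) * momentum μ (onShell k) * h k
        = ∑ ν, L (unitVec ν) * (L (onShell k) ^ n * momentum (ν :: μ) (onShell k) * h k) :=
      fun k => by
        have h2 : ∀ ν, L (unitVec ν) * (L (onShell k) ^ n * momentum (ν :: μ) (onShell k) * h k)
            = L (unitVec ν) * onShell k ν * (L (onShell k) ^ n * momentum μ (onShell k) * h k) :=
          fun ν => by rw [momentum_cons]; ring
        simp only [h2]
        rw [← Finset.sum_mul, ← apply_eq_sum_coord]
        ring
    simp only [h1]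
    have h2 : ∀ ν, Integrable
        (fun k => L (unitVec ν) * (L (onShell k) ^ n * momentum (ν :: μ) (onShell k) * h k)) m :=
      fun ν => ((memLp_pow_mul_momentum hs hm L n (ν :: μ)).integrable_mul hh).const_mul _
    rw [integral_finsetSum _ fun ν _ => h2 ν]
    refine Finset.sum_eq_zero fun ν _ => ?_
    rw [integral_const_mul, ih (ν :: μ) (by
      rw [List.length_cons, ← add_assoc, add_right_comm]; exact hμ), mul_zero]

/-- The measure with density `g` on the forward and density `g'` on the backward light cone. -/
def coneMeasure (m : Measure (EuclideanSpace ℝ (Fin 3))) (g g' : EuclideanSpace ℝ (Fin 3) → ℝ) :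
    Measure Mink :=
  (m.withDensity fun k => ENNReal.ofReal (g k)).map onShell
    + (m.withDensity fun k => ENNReal.ofReal (g' k)).map fun k => -onShell k

variable {g g' : EuclideanSpace ℝ (Fin 3) → ℝ} {F : Mink → ℝ}

theorem integrable_max_mul (hg : Measurable g) {u : EuclideanSpace ℝ (Fin 3) → ℝ}
    (hu : Measurable u) (h : Integrable (fun k => u k * g k) m) :
    Integrable (fun k => max (g k) 0 * u k) m := by
  refine h.mono ((hg.max measurable_const).mul hu).aestronglyMeasurable (ae_of_all _ fun k => ?_)
  rw [norm_mul, norm_mul, mul_comm ‖u k‖]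
  refine mul_le_mul_of_nonneg_right ?_ (norm_nonneg _)
  rw [Real.norm_of_nonneg (le_max_right _ _)]
  exact max_le (le_abs_self _) (abs_nonneg _)

theorem integrable_withDensity_ofReal (hg : Measurable g) {u : EuclideanSpace ℝ (Fin 3) → ℝ}
    (hu : Measurable u) (h : Integrable (fun k => u k * g k) m) :
    Integrable u (m.withDensity fun k => ENNReal.ofReal (g k)) :=
  (integrable_withDensity_iff_integrable_smul hg.real_toNNReal).2 (integrable_max_mul hg hu h)

theorem integral_withDensity_ofReal (hg : Measurable g) (u : EuclideanSpace ℝ (Fin 3) → ℝ) :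
    ∫ k, u k ∂(m.withDensity fun k => ENNReal.ofReal (g k)) = ∫ k, max (g k) 0 * u k ∂m :=
  integral_withDensity_eq_integral_smul hg.real_toNNReal u

theorem integrable_coneMeasure (hg : Measurable g) (hg' : Measurable g') (hF : Continuous F)
    (h : Integrable (fun k => F (onShell k) * g k) m)
    (h' : Integrable (fun k => F (-onShell k) * g' k) m) :
    Integrable F (coneMeasure m g g') := by
  have h1 := continuous_onShell
  refine Integrable.add_measure ?_ ?_
  · rw [integrable_map_measure hF.aestronglyMeasurable h1.aemeasurable]
    exact integrable_withDensity_ofReal hg (hF.comp h1).measurable h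
  · rw [integrable_map_measure hF.aestronglyMeasurable continuous_neg_onShell.aemeasurable]
    exact integrable_withDensity_ofReal hg' (hF.comp continuous_neg_onShell).measurable h'

theorem integral_coneMeasure (hg : Measurable g) (hg' : Measurable g') (hF : Continuous F)
    (h : Integrable (fun k => F (onShell k) * g k) m)
    (h' : Integrable (fun k => F (-onShell k) * g' k) m) :
    ∫ q, F q ∂(coneMeasure m g g')
      = ∫ k, max (g k) 0 * F (onShell k) ∂m + ∫ k, max (g' k) 0 * F (-onShell k) ∂m := by
  have h1 := continuous_onShell
  have h2 := integrable_coneMeasure hg hg' hF h h'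
  rw [coneMeasure, integral_add_measure h2.left_of_add_measure h2.right_of_add_measure,
    integral_map h1.aemeasurable hF.aestronglyMeasurable,
    integral_map continuous_neg_onShell.aemeasurable hF.aestronglyMeasurable, integral_withDensity_ofReal hg,
    integral_withDensity_ofReal hg']

/-- Recovers the forward density: the condition q⁰ > 0 excludes the backward cone, and the tip
removed with it is a null set. -/
theorem coneMeasure_apply (h0 : m {0} = 0) {A : Set (EuclideanSpace ℝ (Fin 3))}
    (hA : MeasurableSet A) :
    coneMeasure m g g' {q | 0 < q 0 ∧ WithLp.toLp 2 (fun i : Fin 3 => q i.succ) ∈ A}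
      = m.withDensity (fun k => ENNReal.ofReal (g k)) A := by
  have h1 := continuous_onShell
  have hS : MeasurableSet
      {q : Mink | 0 < q 0 ∧ WithLp.toLp 2 (fun i : Fin 3 => q i.succ) ∈ A} := by
    refine (measurableSet_lt measurable_const (measurable_pi_apply 0)).inter ?_
    have h2 : Continuous fun q : Mink => WithLp.toLp 2 (fun i : Fin 3 => q i.succ) := by fun_prop
    exact h2.measurable hA
  rw [coneMeasure, Measure.add_apply, Measure.map_apply h1.measurable hS,
    Measure.map_apply continuous_neg_onShell.measurable hS]
  have h2 : (fun k => -onShell k) ⁻¹'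
      {q : Mink | 0 < q 0 ∧ WithLp.toLp 2 (fun i : Fin 3 => q i.succ) ∈ A} = ∅ := by
    refine Set.eq_empty_of_forall_notMem fun k hk => ?_
    have h3 : 0 < (-onShell k) 0 := hk.1
    rw [Pi.neg_apply, onShell_zero_apply] at h3
    linarith [norm_nonneg k]
  have h3 : onShell ⁻¹'
      {q : Mink | 0 < q 0 ∧ WithLp.toLp 2 (fun i : Fin 3 => q i.succ) ∈ A} = A \ {0} := by
    ext k
    simp only [Set.mem_preimage, Set.mem_ofPred_eq, onShell_zero_apply, onShell_succ_apply,
      norm_pos_iff, Set.mem_sdiff, Set.mem_singleton_iff]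
    exact and_comm
  rw [h2, h3, measure_empty, add_zero]
  exact measure_sdiff_null (withDensity_absolutelyContinuous _ _ h0)

theorem ae_eq_zero_of_integral_odd_momentum [IsFiniteMeasure m] (h0 : m {0} = 0) (hs : 0 < s)
    (hm : MemLp (fun k => Real.exp (s * ‖k‖)) 2 m) {h : EuclideanSpace ℝ (Fin 3) → ℝ}
    (hh : MemLp h 2 m) (hmeas : Measurable h)
    (hodd : ∀ μ : List (Fin 4), Odd μ.length → ∫ k, momentum μ (onShell k) * h k ∂m = 0) :
    h =ᵐ[m] 0 := by
  have hmeas' : Measurable fun k => -h k := hmeas.neg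
  have hint : Integrable h m := hh.integrable one_le_two
  have hfin : ∀ g : EuclideanSpace ℝ (Fin 3) → ℝ, Integrable g m →
      IsFiniteMeasure (m.withDensity fun k => ENNReal.ofReal (g k)) := fun g hg =>
    isFiniteMeasure_withDensity_ofReal hg.2
  have hfin1 := hfin h hint
  have hfin2 := hfin (fun k => -h k) hint.neg
  have hi : ∀ F : Mink → ℝ, Continuous F → MemLp (fun k => F (onShell k)) 2 m →
      MemLp (fun k => F (-onShell k)) 2 m →
      (Integrable (fun k => F (onShell k) * h k) m ∧ Integrable (fun k => F (-onShell k) * h k) m)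
        ∧ (Integrable (fun k => F (onShell k) * -h k) m ∧
          Integrable (fun k => F (-onShell k) * -h k) m) := fun F _ h1 h2 =>
    ⟨⟨h1.integrable_mul hh, h2.integrable_mul hh⟩,
      ⟨h1.integrable_mul hh.neg, h2.integrable_mul hh.neg⟩⟩
  have hexp : MemLp (fun k => Real.exp (s * ‖onShell k‖)) 2 m := by
    refine hm.of_le (by have := continuous_onShell; fun_prop) (ae_of_all _ fun k => ?_)
    rw [Real.norm_of_nonneg (Real.exp_pos _).le, Real.norm_of_nonneg (Real.exp_pos _).le,
      Real.exp_le_exp]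
    exact mul_le_mul_of_nonneg_left (norm_onShell_le k) hs.le
  have hexpc : Continuous fun q : Mink => Real.exp (s * ‖q‖) := by fun_prop
  obtain ⟨⟨e1, e2⟩, e3, e4⟩ := hi _ hexpc hexp (by simpa only [norm_neg] using hexp)
  -- `ENNReal.ofReal` takes positive parts, so the two sides carry h⁺ and h⁻ on opposite cones. Even
  -- moments do not see q ↦ -q; odd moments differ by 2∫ Lⁿ h, which is zero by the hypothesis on h.
  have key : coneMeasure m h (fun k => -h k) = coneMeasure m (fun k => -h k) h := by
    have f1 : IsFiniteMeasure (coneMeasure m h fun k => -h k) := by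
      unfold coneMeasure; infer_instance
    have f2 : IsFiniteMeasure (coneMeasure m (fun k => -h k) h) := by
      unfold coneMeasure; infer_instance
    refine measure_eq_of_moments_eq hs (integrable_coneMeasure hmeas hmeas' hexpc e1 e4)
      (integrable_coneMeasure hmeas' hmeas hexpc e3 e2) fun L n => ?_
    have hLc : Continuous fun q : Mink => L q ^ n := by fun_prop
    have hL : MemLp (fun k => L (onShell k) ^ n) 2 m := by
      simpa [momentum] using memLp_pow_mul_momentum hs hm L n []
    have hL' : MemLp (fun k => L (-onShell k) ^ n) 2 m := by
      have : (fun k => L (-onShell k) ^ n) = fun k => (-1) ^ n * L (onShell k) ^ n := by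
        ext k; rw [map_neg, neg_pow]
      rw [this]
      exact hL.const_mul _
    obtain ⟨⟨l1, l2⟩, l3, l4⟩ := hi _ hLc hL hL'
    rw [integral_coneMeasure hmeas hmeas' hLc l1 l4,
      integral_coneMeasure hmeas' hmeas hLc l3 l2]
    have h1 : ∀ (g : EuclideanSpace ℝ (Fin 3) → ℝ), ∫ k, max (g k) 0 * L (-onShell k) ^ n ∂m
        = (-1) ^ n * ∫ k, max (g k) 0 * L (onShell k) ^ n ∂m := fun g => by
      rw [← integral_const_mul]
      congr 1; ext k; rw [map_neg, neg_pow]; ring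
    rw [h1, h1]
    rcases n.even_or_odd with hn | hn
    · rw [hn.neg_one_pow]; ring
    · have h2 : ∫ k, max (h k) 0 * L (onShell k) ^ n ∂m
          - ∫ k, max (-h k) 0 * L (onShell k) ^ n ∂m = 0 := by
        have hLm : Measurable fun k => L (onShell k) ^ n :=
          (hLc.comp continuous_onShell).measurable
        rw [← integral_sub (integrable_max_mul hmeas hLm l1) (integrable_max_mul hmeas' hLm l3)]
        have h3 := integral_pow_mul_momentum_mul_eq_zero hs hm hh hodd L n [] (by simpa using hn)
        refine (integral_congr_ae (ae_of_all _ fun k => ?_)).trans h3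
        change max (h k) 0 * _ - max (-h k) 0 * _ = _
        rw [← sub_mul, max_zero_sub_eq_self]
        simp [momentum, mul_comm]
      rw [hn.neg_one_pow]
      linarith
  have hwd : m.withDensity (fun k => ENNReal.ofReal (h k))
      = m.withDensity fun k => ENNReal.ofReal (-h k) := by
    ext A hA
    rw [← coneMeasure_apply (g' := fun k => -h k) h0 hA, key, coneMeasure_apply h0 hA]
  have hae := (withDensity_eq_iff_of_sigmaFinite hmeas.ennreal_ofReal.aemeasurable
    hmeas'.ennreal_ofReal.aemeasurable).1 hwd
  filter_upwards [hae] with k hk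
  have hk : ENNReal.ofReal (h k) = ENNReal.ofReal (-h k) := hk
  rcases le_total 0 (h k) with hn | hn
  · rw [ENNReal.ofReal_of_nonpos (neg_nonpos.2 hn)] at hk
    exact le_antisymm (ENNReal.ofReal_eq_zero.1 hk) hn
  · rw [ENNReal.ofReal_of_nonpos hn, eq_comm, ENNReal.ofReal_eq_zero] at hk
    exact le_antisymm hn (neg_nonpos.1 hk)

/-- The momentum monomial if its degree is odd, with a factor two, and zero otherwise. -/
def oddMomentum (μ : List (Fin 4)) (k : EuclideanSpace ℝ (Fin 3)) : ℝ :=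
  (1 + (-1) ^ (μ.length + 1)) * momentum μ (onShell k)

theorem continuous_oddMomentum (μ : List (Fin 4)) : Continuous (oddMomentum μ) :=
  continuous_const.mul (continuous_momentum_onShell μ)

theorem abs_oddMomentum_le (μ : List (Fin 4)) (k : EuclideanSpace ℝ (Fin 3)) :
    |oddMomentum μ k| ≤ 2 * ‖k‖ ^ μ.length := by
  rw [oddMomentum, abs_mul]
  refine mul_le_mul ?_ (abs_momentum_onShell_le μ k) (abs_nonneg _) zero_le_two
  rcases neg_one_pow_eq_or ℝ (μ.length + 1) with h | h <;> rw [h] <;> norm_num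

theorem memLp_oddMomentum (hs : 0 < s) (hm : MemLp (fun k => Real.exp (s * ‖k‖)) 2 m)
    (μ : List (Fin 4)) : MemLp (oddMomentum μ) 2 m :=
  memLp_of_abs_le_pow hs hm (continuous_oddMomentum μ).aestronglyMeasurable (abs_oddMomentum_le μ)

theorem topologicalClosure_span_oddMomentum [IsFiniteMeasure m] (h0 : m {0} = 0) (hs : 0 < s)
    (hm : MemLp (fun k => Real.exp (s * ‖k‖)) 2 m) :
    (Submodule.span ℝ (Set.range fun μ =>
      (memLp_oddMomentum hs hm μ).toLp (oddMomentum μ))).topologicalClosure = ⊤ := by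
  rw [Submodule.topologicalClosure_eq_top_iff, Submodule.eq_bot_iff]
  intro h hh
  rw [Lp.eq_zero_iff_ae_eq_zero]
  refine ae_eq_zero_of_integral_odd_momentum h0 hs hm (Lp.memLp h)
    (Lp.stronglyMeasurable h).measurable fun μ hμ => ?_
  have h1 := Submodule.mem_orthogonal _ _ |>.1 hh _ (Submodule.subset_span ⟨μ, rfl⟩)
  rw [L2.inner_def] at h1
  have h2 : ∫ k, 2 * (momentum μ (onShell k) * h k) ∂m = 0 := by
    rw [← h1]
    refine integral_congr_ae ?_
    filter_upwards [(memLp_oddMomentum hs hm μ).coeFn_toLp] with k hk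
    rw [hk, oddMomentum, (hμ.add_odd odd_one).neg_one_pow]
    simp only [RCLike.inner_apply, conj_trivial]
    ring
  rw [integral_const_mul] at h2
  exact (mul_eq_zero.1 h2).resolve_left two_ne_zero

theorem integral_abs_mul_abs_le (f g : Lp ℝ 2 m) : ∫ k, |f k| * |g k| ∂m ≤ ‖f‖ * ‖g‖ := by
  have h1 : inner ℝ |g| |f| = ∫ k, |f k| * |g k| ∂m := by
    rw [L2.inner_def]
    refine integral_congr_ae ?_
    filter_upwards [Lp.coeFn_abs f, Lp.coeFn_abs g] with k hf hg
    rw [hf, hg]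
    simp
  rw [← h1, ← norm_abs_eq_norm f, ← norm_abs_eq_norm g, mul_comm]
  exact real_inner_le_norm _ _

/-- Cauchy–Schwarz converts the density in L² into approximation in L¹ with the additional weight w.
-/
theorem exists_integral_abs_sub_oddMomentum_lt [IsFiniteMeasure m] (h0 : m {0} = 0) (hs : 0 < s)
    (hm : MemLp (fun k => Real.exp (s * ‖k‖)) 2 m) {g w : EuclideanSpace ℝ (Fin 3) → ℝ}
    (hg : MemLp g 2 m) (hw : MemLp w 2 m) {ε : ℝ} (hε : 0 < ε) :
    ∃ a : List (Fin 4) →₀ ℝ,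
      ∫ k, |w k| * |g k - a.sum fun μ t => t * oddMomentum μ k| ∂m < ε := by
  have h1 : hg.toLp g ∈ (Submodule.span ℝ (Set.range fun μ =>
      (memLp_oddMomentum hs hm μ).toLp (oddMomentum μ))).topologicalClosure := by
    rw [topologicalClosure_span_oddMomentum h0 hs hm]; trivial
  obtain ⟨b, hb, hgb⟩ := Metric.mem_closure_iff.1 h1 (ε / (‖hw.toLp w‖ + 1)) (by positivity)
  obtain ⟨a, rfl⟩ := Finsupp.mem_span_range_iff_exists_finsupp.1 hb
  refine ⟨a, ?_⟩
  rw [dist_eq_norm] at hgb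
  set b := a.sum fun μ t => t • (memLp_oddMomentum hs hm μ).toLp (oddMomentum μ)
  have hae : ∀ᵐ k ∂m, b k = a.sum fun μ t => t * oddMomentum μ k := by
    have h2 : ∀ᵐ k ∂m, ∀ μ, (memLp_oddMomentum hs hm μ).toLp (oddMomentum μ) k = oddMomentum μ k :=
      ae_all_iff.2 fun μ => (memLp_oddMomentum hs hm μ).coeFn_toLp
    have h3 : ∀ᵐ k ∂m, ∀ μ, (a μ • (memLp_oddMomentum hs hm μ).toLp (oddMomentum μ) : Lp ℝ 2 m) k
        = a μ * (memLp_oddMomentum hs hm μ).toLp (oddMomentum μ) k :=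
      ae_all_iff.2 fun μ => Lp.coeFn_smul _ _
    filter_upwards [h2, h3, Lp.coeFn_finsetSum a.support
      fun μ => (a μ • (memLp_oddMomentum hs hm μ).toLp (oddMomentum μ) : Lp ℝ 2 m)] with k hk hk' hs
    rw [Finset.sum_apply] at hs
    refine hs.trans ?_
    exact Finset.sum_congr rfl fun μ _ => by rw [hk', hk]
  have h4 : ∫ k, |w k| * |g k - a.sum fun μ t => t * oddMomentum μ k| ∂m
      = ∫ k, |hw.toLp w k| * |(hg.toLp g - b) k| ∂m := by
    refine integral_congr_ae ?_
    filter_upwards [hae, hw.coeFn_toLp, hg.coeFn_toLp, Lp.coeFn_sub (hg.toLp g) b]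
      with k hk hk1 hk2 hk3
    rw [hk1, hk3, Pi.sub_apply, hk2, hk]
  rw [h4]
  refine (integral_abs_mul_abs_le _ _).trans_lt ?_
  have h5 : 0 ≤ ‖hw.toLp w‖ := norm_nonneg _
  rw [lt_div_iff₀ (by positivity)] at hgb
  nlinarith [norm_nonneg (hg.toLp g - b)]

end Density

/-! ### Approximation of the particle density by thermal functions -/

/-- The measure `|𝐤|⁻² e^{-a |𝐤|} d³k`. -/
def expMeasure (a : ℝ) : Measure (EuclideanSpace ℝ (Fin 3)) :=
  volume.withDensity fun k => ENNReal.ofReal (expWeight a k)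

variable {a c ε : ℝ} {β p : Mink} {B : Set Mink}

theorem isFiniteMeasure_expMeasure (ha : 0 < a) : IsFiniteMeasure (expMeasure a) :=
  isFiniteMeasure_withDensity_ofReal (by simpa using (integrable_expWeight_mul_pow ha 0).2)

theorem expMeasure_singleton_zero (a : ℝ) : expMeasure a {0} = 0 :=
  withDensity_absolutelyContinuous _ _ (measure_singleton _)

theorem integrable_expMeasure_iff {u : EuclideanSpace ℝ (Fin 3) → ℝ} :
    Integrable u (expMeasure a) ↔ Integrable fun k => expWeight a k * u k := by
  refine (integrable_withDensity_iff_integrable_smul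
    (measurable_expWeight a).real_toNNReal).trans (integrable_congr (ae_of_all _ fun k => ?_))
  change max (expWeight a k) 0 * u k = _
  rw [max_eq_left (expWeight_nonneg a k)]

theorem integral_expMeasure (u : EuclideanSpace ℝ (Fin 3) → ℝ) :
    ∫ k, u k ∂(expMeasure a) = ∫ k, expWeight a k * u k := by
  refine (integral_withDensity_ofReal (measurable_expWeight a) u).trans
    (integral_congr_ae (ae_of_all _ fun k => ?_))
  change max (expWeight a k) 0 * u k = _
  rw [max_eq_left (expWeight_nonneg a k)]

/-- The rate a/4 doubles under the square and still leaves half of the decay e^{-a|𝐤|}. -/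
theorem memLp_exp_expMeasure (ha : 0 < a) :
    MemLp (fun k => Real.exp (a / 4 * ‖k‖)) 2 (expMeasure a) := by
  rw [memLp_two_iff_integrable_sq (by fun_prop), integrable_expMeasure_iff]
  refine (integrable_expWeight_mul_pow (half_pos ha) 0).congr (ae_of_all _ fun k => ?_)
  change expWeight (a / 2) k * ‖k‖ ^ 0 = expWeight a k * Real.exp (a / 4 * ‖k‖) ^ 2
  rw [expWeight, expWeight, pow_zero, mul_one, mul_assoc _ (Real.exp _), ← Real.exp_nat_mul,
    ← Real.exp_add]
  congr 2
  push_cast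
  ring

theorem planckIntegral_ofReal (β : Mink) (F : EuclideanSpace ℝ (Fin 3) → ℝ) :
    planckIntegral β (fun k => (F k : ℂ))
      = ((((2 * Real.pi) ^ 3)⁻¹ * ∫ k, (2 * ‖k‖)⁻¹ * planck β k * F k : ℝ) : ℂ) := by
  rw [planckIntegral, Complex.ofReal_mul, ← integral_complex_ofReal]
  push_cast
  rfl

theorem integrable_planckWeight_mul (h : IsColderThan c β) (hc : 0 < c)
    {F : EuclideanSpace ℝ (Fin 3) → ℝ} {D : ℝ} {m : ℕ} (hF : ∀ k, |F k| ≤ D * ‖k‖ ^ m)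
    (hFm : Measurable F) : Integrable fun k => (2 * ‖k‖)⁻¹ * planck β k * F k := by
  have h1 := (integrable_planckIntegrand h hc (F := fun k => (F k : ℂ)) (D := D) (m := m)
    (by simpa using hF) (Complex.measurable_ofReal.comp hFm)).re
  exact h1.congr (ae_of_all _ fun k => Complex.re_ofReal_mul _ _)

/-- Splitting off one momentum k^ν from an even monomial leaves an odd one. This isolates ν, so that
a polynomial approximating the delta function serves all four components. -/
theorem thermalMoment_cons (ν : Fin 4) (μ : List (Fin 4)) (β : Mink) :
    thermalMoment (ν :: μ) β = (-(2 * Complex.I)) ^ (μ.length + 1) *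
      planckIntegral β fun k => ((oddMomentum μ k * onShell k ν : ℝ) : ℂ) := by
  rw [← planckIntegral_const_mul, thermalMoment]
  congr 1
  ext k
  rw [momentum_cons, oddMomentum, List.length_cons]
  push_cast
  ring

/-- The coefficients for which a combination of thermal functions `Θ^{νμ}` is the Planck integral of
a combination of odd momenta times `p^ν`. -/
def thermalCoeff (b : List (Fin 4) →₀ ℝ) : List (Fin 4) →₀ ℂ :=
  Finsupp.onFinset b.support (fun μ => ((-(2 * Complex.I)) ^ (μ.length + 1))⁻¹ * (b μ : ℂ))
    fun μ h => by
      rw [Finsupp.mem_support_iff]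
      rintro h0
      simp [h0] at h

theorem thermalCoeff_sum (h : IsColderThan c β) (hc : 0 < c) (b : List (Fin 4) →₀ ℝ) (ν : Fin 4) :
    (thermalCoeff b).sum (fun μ a => a * thermalMoment (ν :: μ) β)
      = ((((2 * Real.pi) ^ 3)⁻¹ * ∫ k, (2 * ‖k‖)⁻¹ * planck β k *
        ((b.sum fun μ t => t * oddMomentum μ k) * onShell k ν) : ℝ) : ℂ) := by
  have h1 : ∀ k, (2 * ‖k‖)⁻¹ * planck β k * ((b.sum fun μ t => t * oddMomentum μ k) * onShell k ν)
      = ∑ μ ∈ b.support, b μ * ((2 * ‖k‖)⁻¹ * planck β k * (oddMomentum μ k * onShell k ν)) :=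
    fun k => by
      rw [Finsupp.sum, Finset.sum_mul, Finset.mul_sum]
      exact Finset.sum_congr rfl fun μ _ => by ring
  have h2 : ∀ μ, Integrable fun k => (2 * ‖k‖)⁻¹ * planck β k * (oddMomentum μ k * onShell k ν) :=
    fun μ => integrable_planckWeight_mul h hc (D := 2) (m := μ.length + 1) (fun k => by
      rw [abs_mul, pow_succ, ← mul_assoc]
      exact mul_le_mul (abs_oddMomentum_le μ k) (abs_onShell_le k ν) (abs_nonneg _)
        (by positivity))
      ((continuous_oddMomentum μ).mul ((continuous_apply ν).comp continuous_onShell)).measurable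
  simp only [h1]
  rw [thermalCoeff, Finsupp.onFinset_sum _ fun μ => zero_mul _,
    integral_finsetSum _ fun μ _ => (h2 μ).const_mul _, Finset.mul_sum, Complex.ofReal_sum]
  refine Finset.sum_congr rfl fun μ _ => ?_
  have h3 : (-(2 * Complex.I)) ^ (μ.length + 1) ≠ 0 :=
    pow_ne_zero _ (neg_ne_zero.2 (mul_ne_zero two_ne_zero Complex.I_ne_zero))
  rw [thermalMoment_cons, planckIntegral_ofReal, integral_const_mul]
  push_cast
  field_simp

/-- Joint continuity in (k, β) near k₀ ≠ 0; compactness of B makes the radius uniform in β. -/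
theorem exists_ball_planck_near (hB : B ⊆ forwardCone) (hBc : IsCompact B)
    {k₀ : EuclideanSpace ℝ (Fin 3)} (hk₀ : k₀ ≠ 0) (hε : 0 < ε) :
    ∃ δ > 0, ∀ k ∈ Metric.ball k₀ δ, k ≠ 0 ∧ ∀ β ∈ B, ∀ ν,
      |onShell k ν * planck β k - onShell k₀ ν * planck β k₀| < ε := by
  obtain ⟨c, hc, hcold⟩ := exists_isColderThan hB hBc
  have hev : ∀ᶠ k in 𝓝 k₀, ∀ β ∈ B, ∀ ν,
      |onShell k ν * planck β k - onShell k₀ ν * planck β k₀| < ε := by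
    refine hBc.eventually_forall_of_forall_eventually fun β hβ => ?_
    refine eventually_all.2 fun ν => ?_
    have h1 : ContinuousAt (fun z : EuclideanSpace ℝ (Fin 3) × Mink => planck z.2 z.1) (k₀, β) := by
      have h2 : Continuous fun z : EuclideanSpace ℝ (Fin 3) × Mink => mdot z.2 (onShell z.1) :=
        continuous_mdot.comp (continuous_snd.prodMk (continuous_onShell.comp continuous_fst))
      refine ContinuousAt.inv₀ ((Real.continuous_exp.comp h2).sub
        continuous_const).continuousAt ?_
      have h3 := (hcold β hβ).pos hc hk₀
      exact (sub_pos.2 (Real.one_lt_exp_iff.2 h3)).ne'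
    have h4 : ContinuousAt (fun z : EuclideanSpace ℝ (Fin 3) × Mink => planck z.2 k₀) (k₀, β) :=
      ContinuousAt.comp (f := fun z : EuclideanSpace ℝ (Fin 3) × Mink => (k₀, z.2)) (x := (k₀, β))
        h1 (by fun_prop)
    have h5 : ContinuousAt (fun z : EuclideanSpace ℝ (Fin 3) × Mink => onShell z.1 ν) (k₀, β) :=
      ((continuous_apply ν).comp (continuous_onShell.comp continuous_fst)).continuousAt
    have h6 := ((h5.mul h1).sub (continuousAt_const (y := onShell k₀ ν) |>.mul h4)).abs
    exact h6.eventually_lt continuousAt_const (by simpa using hε)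
  obtain ⟨δ, hδ, h⟩ := Metric.eventually_nhds_iff_ball.1 ((eventually_ne_nhds hk₀).and hev)
  exact ⟨δ, hδ, h⟩

/-- The normalized indicator function of a ball, with respect to the invariant measure on the light
cone. -/
def ballAverage (k₀ : EuclideanSpace ℝ (Fin 3)) (δ : ℝ) (k : EuclideanSpace ℝ (Fin 3)) : ℝ :=
  (volume.real (Metric.ball k₀ δ))⁻¹ * (Metric.ball k₀ δ).indicator (fun k => 2 * ‖k‖) k

theorem measurable_ballAverage (k₀ : EuclideanSpace ℝ (Fin 3)) (δ : ℝ) :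
    Measurable (ballAverage k₀ δ) :=
  measurable_const.mul ((by fun_prop : Measurable fun k : EuclideanSpace ℝ (Fin 3) =>
    2 * ‖k‖).indicator Metric.isOpen_ball.measurableSet)

theorem abs_ballAverage_le (k₀ : EuclideanSpace ℝ (Fin 3)) (δ : ℝ)
    (k : EuclideanSpace ℝ (Fin 3)) :
    |ballAverage k₀ δ k| ≤ (volume.real (Metric.ball k₀ δ))⁻¹ * 2 * ‖k‖ ^ 1 := by
  rw [ballAverage, abs_mul, abs_of_nonneg (inv_nonneg.2 measureReal_nonneg), pow_one, mul_assoc]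
  refine mul_le_mul_of_nonneg_left ?_ (inv_nonneg.2 measureReal_nonneg)
  by_cases hk : k ∈ Metric.ball k₀ δ
  · rw [Set.indicator_of_mem hk, abs_of_nonneg (by positivity)]
  · rw [Set.indicator_of_notMem hk, abs_zero]
    positivity

/-- The factor 2|𝐤| in `ballAverage` cancels the density of the invariant measure, so the integral
is the plain mean of G over the ball. -/
theorem abs_integral_ballAverage_sub_le {k₀ : EuclideanSpace ℝ (Fin 3)} {δ : ℝ} (hδ : 0 < δ)
    {G : EuclideanSpace ℝ (Fin 3) → ℝ}
    (hG : ∀ k ∈ Metric.ball k₀ δ, k ≠ 0 ∧ |G k - G k₀| ≤ ε) (hGm : Measurable G) :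
    |(∫ k, (2 * ‖k‖)⁻¹ * G k * ballAverage k₀ δ k) - G k₀| ≤ ε := by
  have hV : 0 < volume.real (Metric.ball k₀ δ) :=
    ENNReal.toReal_pos (Metric.measure_ball_pos _ _ hδ).ne' measure_ball_lt_top.ne
  have h1 : ∀ k, (2 * ‖k‖)⁻¹ * G k * ballAverage k₀ δ k
      = (volume.real (Metric.ball k₀ δ))⁻¹ * (Metric.ball k₀ δ).indicator G k := fun k => by
    rw [ballAverage]
    by_cases hk : k ∈ Metric.ball k₀ δ
    · have := norm_pos_iff.2 (hG k hk).1
      rw [Set.indicator_of_mem hk, Set.indicator_of_mem hk]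
      field_simp
    · rw [Set.indicator_of_notMem hk, Set.indicator_of_notMem hk]
      simp
  have h2 : IntegrableOn G (Metric.ball k₀ δ) := by
    refine Measure.integrableOn_of_bounded (M := |G k₀| + ε) measure_ball_lt_top.ne
      hGm.aestronglyMeasurable ?_
    refine (ae_restrict_iff' Metric.isOpen_ball.measurableSet).2 (ae_of_all _ fun k hk => ?_)
    have h3 := (hG k hk).2
    rw [Real.norm_eq_abs]
    linarith [abs_sub_abs_le_abs_sub (G k) (G k₀)]
  have h3 : IntegrableOn (fun _ => G k₀) (Metric.ball k₀ δ) :=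
    integrableOn_const measure_ball_lt_top.ne
  have h4 : G k₀ = (volume.real (Metric.ball k₀ δ))⁻¹ * ∫ _ in Metric.ball k₀ δ, G k₀ := by
    rw [setIntegral_const, smul_eq_mul, inv_mul_cancel_left₀ hV.ne']
  simp only [h1]
  rw [integral_const_mul, integral_indicator Metric.isOpen_ball.measurableSet]
  conv_lhs => rw [h4]
  rw [← mul_sub, ← integral_sub h2 h3, abs_mul, abs_of_pos (inv_pos.2 hV)]
  have h5 := norm_setIntegral_le_of_norm_le_const (μ := volume) (s := Metric.ball k₀ δ)
    (f := fun k => G k - G k₀) (C := ε) measure_ball_lt_top fun k hk => (hG k hk).2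
  calc _ ≤ (volume.real (Metric.ball k₀ δ))⁻¹ * (ε * volume.real (Metric.ball k₀ δ)) :=
        mul_le_mul_of_nonneg_left h5 (inv_nonneg.2 hV.le)
    _ = ε := by field_simp

/-- The delta function at k₀ is replaced by `ballAverage`, and this by an odd polynomial; each
replacement costs at most ε/2. -/
theorem exists_thermalCoeff_near (hp : IsPositiveLightlike p) (hB : B ⊆ forwardCone)
    (hBc : IsCompact B) (hε : 0 < ε) :
    ∃ b : List (Fin 4) →₀ ℂ, ∀ β ∈ B, ∀ ν,
      ‖(p ν : ℂ) * particleDensity p β - b.sum fun μ a => a * thermalMoment (ν :: μ) β‖ < ε := by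
  obtain ⟨c, hc, hcold⟩ := exists_isColderThan hB hBc
  obtain ⟨k₀, hk₀, rfl⟩ := exists_onShell_eq hp
  obtain ⟨δ, hδ, hball⟩ := exists_ball_planck_near hB hBc hk₀ (half_pos hε)
  have := isFiniteMeasure_expMeasure (half_pos hc)
  have hexp := memLp_exp_expMeasure (half_pos hc)
  have h4 : 0 < c / 2 / 4 := by positivity
  have hg : MemLp (ballAverage k₀ δ) 2 (expMeasure (c / 2)) :=
    memLp_of_abs_le_pow h4 hexp (measurable_ballAverage k₀ δ).aestronglyMeasurable
      (abs_ballAverage_le k₀ δ)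
  have hw : MemLp (fun k => ‖k‖) 2 (expMeasure (c / 2)) :=
    memLp_of_abs_le_pow (D := 1) (n := 1) h4 hexp (by fun_prop) fun k => by simp
  -- The weight ‖k‖ dominates every |k^ν|, and the Planck weight is at most c⁻¹ `expWeight (c / 2)`
  -- for all β ∈ B, so one b serves all β and ν. The factor c in the tolerance compensates c⁻¹.
  obtain ⟨b, hb⟩ := exists_integral_abs_sub_oddMomentum_lt (expMeasure_singleton_zero _) h4 hexp
    hg hw (mul_pos hc (half_pos hε))
  refine ⟨thermalCoeff b, fun β hβ ν => ?_⟩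
  have hβc := hcold β hβ
  set P : EuclideanSpace ℝ (Fin 3) → ℝ := fun k => b.sum fun μ t => t * oddMomentum μ k
  have hPc : Continuous P := continuous_finsetSum _ fun μ _ =>
    continuous_const.mul (continuous_oddMomentum μ)
  have hP : MemLp P 2 (expMeasure (c / 2)) :=
    memLp_finsetSum _ fun μ _ => (memLp_oddMomentum h4 hexp μ).const_mul (b μ)
  have hνc : Continuous fun k => onShell k ν := (continuous_apply ν).comp continuous_onShell
  have hd : Integrable fun k =>
      expWeight (c / 2) k * (|‖k‖| * |ballAverage k₀ δ k - P k|) := by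
    rw [← integrable_expMeasure_iff]
    exact hw.abs.integrable_mul (hg.sub hP).abs
  have hle : ∀ᵐ k : EuclideanSpace ℝ (Fin 3),
      ‖(2 * ‖k‖)⁻¹ * planck β k * ((ballAverage k₀ δ k - P k) * onShell k ν)‖
        ≤ c⁻¹ * (expWeight (c / 2) k * (|‖k‖| * |ballAverage k₀ δ k - P k|)) :=
    ae_ne_zero.mono fun k hk => by
      have h0 : 0 ≤ (2 * ‖k‖)⁻¹ * planck β k :=
        mul_nonneg (by positivity) (planck_nonneg hβc hc)
      rw [norm_mul, Real.norm_of_nonneg h0, Real.norm_eq_abs, abs_mul, ← mul_assoc c⁻¹,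
        mul_comm |‖k‖|, abs_norm]
      exact mul_le_mul (planckWeight_le hβc hc hk)
        (mul_le_mul_of_nonneg_left (abs_onShell_le k ν) (abs_nonneg _)) (by positivity)
        (h0.trans (planckWeight_le hβc hc hk))
  have hdm : AEStronglyMeasurable (fun k => (2 * ‖k‖)⁻¹ * planck β k *
      ((ballAverage k₀ δ k - P k) * onShell k ν)) volume :=
    ((measurable_planckWeight β).mul (((measurable_ballAverage k₀ δ).sub hPc.measurable).mul
      hνc.measurable)).aestronglyMeasurable
  have hdi := (hd.const_mul c⁻¹).mono' hdm hle
  have hgi : Integrable fun k => (2 * ‖k‖)⁻¹ * planck β k * (ballAverage k₀ δ k * onShell k ν) :=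
    integrable_planckWeight_mul hβc hc
      (D := (volume.real (Metric.ball k₀ δ))⁻¹ * 2) (m := 2) (fun k => by
        rw [abs_mul, pow_succ, ← mul_assoc]
        exact mul_le_mul (abs_ballAverage_le k₀ δ k) (abs_onShell_le k ν) (abs_nonneg _)
          (by positivity))
      ((measurable_ballAverage k₀ δ).mul hνc.measurable)
  have e1 : |∫ k, (2 * ‖k‖)⁻¹ * planck β k * ((ballAverage k₀ δ k - P k) * onShell k ν)| < ε / 2 := by
    refine (norm_integral_le_of_norm_le (hd.const_mul c⁻¹) hle).trans_lt ?_
    rw [integral_const_mul, ← integral_expMeasure, inv_mul_lt_iff₀ hc]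
    exact hb
  have e2 : |(∫ k, (2 * ‖k‖)⁻¹ * (onShell k ν * planck β k) * ballAverage k₀ δ k)
      - onShell k₀ ν * planck β k₀| ≤ ε / 2 :=
    abs_integral_ballAverage_sub_le hδ (G := fun k => onShell k ν * planck β k)
      (fun k hk => ⟨(hball k hk).1, ((hball k hk).2 β hβ ν).le⟩)
      (hνc.measurable.mul (measurable_planck β))
  have e3 : ∀ k, (2 * ‖k‖)⁻¹ * (onShell k ν * planck β k) * ballAverage k₀ δ k
      = (2 * ‖k‖)⁻¹ * planck β k * (ballAverage k₀ δ k * onShell k ν) := fun k => by ring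
  have e4 : ∀ k, (2 * ‖k‖)⁻¹ * planck β k * (P k * onShell k ν)
      = (2 * ‖k‖)⁻¹ * planck β k * (ballAverage k₀ δ k * onShell k ν)
        - (2 * ‖k‖)⁻¹ * planck β k * ((ballAverage k₀ δ k - P k) * onShell k ν) := fun k => by ring
  rw [thermalCoeff_sum hβc hc]
  change ‖_ - ((_ * ∫ k, (2 * ‖k‖)⁻¹ * planck β k * (P k * onShell k ν) : ℝ) : ℂ)‖ < ε
  simp only [e4]
  simp only [e3] at e2
  rw [integral_sub hgi hdi, particleDensity, ← Complex.ofReal_mul, ← Complex.ofReal_sub,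
    Complex.norm_real, mul_left_comm, ← mul_sub, norm_mul, Real.norm_eq_abs, Real.norm_eq_abs]
  -- The common prefactor (2π)⁻³ can only reduce the error.
  have hT : |((2 * Real.pi) ^ 3)⁻¹| ≤ 1 := by
    rw [abs_of_nonneg (by positivity)]
    exact inv_le_one_of_one_le₀ (one_le_pow₀ (by linarith [Real.pi_gt_three]))
  refine (mul_le_of_le_one_left (abs_nonneg _) hT).trans_lt ?_
  have e5 : (Real.exp (mdot β (onShell k₀)) - 1)⁻¹ = planck β k₀ := rfl
  rw [e5]
  rw [abs_lt] at e1 ⊢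
  rw [abs_le] at e2
  constructor <;> linarith [e1.1, e1.2, e2.1, e2.2]

/-! ### Expectation values in mixtures of thermal states -/

/-- Under the integral the contraction yields k² = 0. -/
theorem sum_metricSign_thermalMoment {c : ℝ} {β : Mink} (h : IsColderThan c β) (hc : 0 < c)
    (μ : List (Fin 4)) :
    ∑ ν, (metricSign ν : ℂ) * thermalMoment (ν :: ν :: μ) β = 0 := by
  have h1 : ∀ ν, (metricSign ν : ℂ) * thermalMoment (ν :: ν :: μ) β
      = ((2 * Real.pi) ^ 3 : ℝ)⁻¹ * ∫ k, (((2 * ‖k‖)⁻¹ * planck β k : ℝ) : ℂ) *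
        ((-(2 * Complex.I)) ^ (μ.length + 2) * (1 + (-1) ^ (μ.length + 2)) *
          ((metricSign ν * onShell k ν * onShell k ν * momentum μ (onShell k) : ℝ) : ℂ)) := by
    intro ν
    rw [thermalMoment, ← planckIntegral_const_mul, planckIntegral]
    congr 2
    ext k
    rw [momentum_cons, momentum_cons, List.length_cons, List.length_cons]
    push_cast
    ring
  have h2 : ∀ ν, Integrable fun k => (((2 * ‖k‖)⁻¹ * planck β k : ℝ) : ℂ) *
        ((-(2 * Complex.I)) ^ (μ.length + 2) * (1 + (-1) ^ (μ.length + 2)) *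
          ((metricSign ν * onShell k ν * onShell k ν * momentum μ (onShell k) : ℝ) : ℂ)) := by
    intro ν
    refine integrable_planckIntegrand h hc (m := μ.length + 2)
      (D := ‖(-(2 * Complex.I)) ^ (μ.length + 2) * (1 + (-1) ^ (μ.length + 2))‖ * |metricSign ν|)
      (fun k => ?_) ?_
    · rw [norm_mul, Complex.norm_real, Real.norm_eq_abs, abs_mul, abs_mul, abs_mul]
      have h3 := abs_onShell_le k ν
      have h4 := abs_momentum_onShell_le μ k
      calc _ ≤ ‖(-(2 * Complex.I)) ^ (μ.length + 2) * (1 + (-1) ^ (μ.length + 2))‖ *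
            (|metricSign ν| * ‖k‖ * ‖k‖ * ‖k‖ ^ μ.length) := by gcongr
        _ = _ := by ring
    · have h3 : Continuous fun k => onShell k ν := (continuous_apply ν).comp continuous_onShell
      exact (continuous_const.mul (Complex.continuous_ofReal.comp
        (((continuous_const.mul h3).mul h3).mul (continuous_momentum_onShell μ)))).measurable
  simp only [h1]
  rw [← Finset.mul_sum, ← integral_finsetSum _ fun ν _ => h2 ν]
  refine mul_eq_zero_of_right _ (integral_eq_zero_of_ae (ae_of_all _ fun k => ?_))
  simp only [← Finset.mul_sum, ← Complex.ofReal_sum, ← Finset.sum_mul]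
  have h4 : ∑ ν, metricSign ν * onShell k ν * onShell k ν = 0 := mdot_onShell_self k
  rw [h4]
  simp

/-- The expectation values at `x` are those of the mixture `∫ dρ(β) ω_β` with `ρ` supported
in `B`. -/
structure IsMixture (θ : List (Fin 4) → Mink → ℂ) (x : Mink) (B : Set Mink) (ρ : Measure Mink) :
    Prop where
  prob : IsProbabilityMeasure ρ
  ae_mem : ∀ᵐ β ∂ρ, β ∈ B
  eq_integral : ∀ μ, θ μ x = ∫ β, thermalMoment μ β ∂ρ

variable {O : Opens Mink} {ω : FieldState} {θ : List (Fin 4) → Mink → ℂ} {p x : Mink}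
  {B : Set Mink} {ρ : Measure Mink} {ε : ℝ}

theorem IsThermalOn.exists_isMixture (h : IsThermalOn O ω θ) {K : Set Mink} (hK : K ⊆ O)
    (hKc : IsCompact K) :
    ∃ B ⊆ forwardCone, IsCompact B ∧ ∀ x ∈ K, ∃ ρ, IsMixture θ x B ρ := by
  obtain ⟨-, ref, href⟩ := h
  obtain ⟨B, hB, hBc, hx⟩ := href K hK hKc
  refine ⟨B, hB, hBc, fun x hxK => ?_⟩
  obtain ⟨ρ, hρ, hae, hint⟩ := (hx x hxK).1.exists_measure hB hBc
  exact ⟨ρ, hρ, hae, fun μ => hint μ _ ((hx x hxK).2 μ)⟩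

theorem IsMixture.integrable (h : IsMixture θ x B ρ) (hB : B ⊆ forwardCone) (hBc : IsCompact B)
    (μ : List (Fin 4)) : Integrable (thermalMoment μ) ρ := by
  have := h.prob
  obtain ⟨c, hc, hcold⟩ := exists_isColderThan hB hBc
  exact integrable_thermalMoment hc (h.ae_mem.mono hcold) μ

theorem IsMixture.integrable_particleDensity (h : IsMixture θ x B ρ) (hB : B ⊆ forwardCone)
    (hBc : IsCompact B) (hp : IsPositiveLightlike p) : Integrable (particleDensity p) ρ := by
  have := h.prob
  obtain ⟨k, hk, rfl⟩ := exists_onShell_eq hp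
  have h1 : ContinuousOn (particleDensity (onShell k)) B := by
    have h2 : Continuous fun β : Mink => mdot β (onShell k) :=
      continuous_mdot.comp (continuous_id.prodMk continuous_const)
    refine Complex.continuous_ofReal.comp_continuousOn (continuousOn_const.mul
      (ContinuousOn.inv₀ ((Real.continuous_exp.comp h2).sub continuous_const).continuousOn
        fun β hβ => ?_))
    exact (sub_pos.2 (Real.one_lt_exp_iff.2 (mdot_onShell_pos (hB hβ) hk))).ne'
  obtain ⟨C, hC⟩ := hBc.exists_bound_of_continuousOn h1
  have h3 : Measurable (particleDensity (onShell k)) := by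
    have h2 : Measurable fun β : Mink => mdot β (onShell k) :=
      (continuous_mdot.comp (continuous_id.prodMk continuous_const)).measurable
    unfold particleDensity
    fun_prop
  exact Integrable.of_bound h3.aestronglyMeasurable C (h.ae_mem.mono hC)

/-- A bound uniform on B survives integration against the probability measure ρ. The map σ relabels
indices; it is used for `List.cons ν` and for the identity. -/
theorem IsMixture.norm_integral_sub_sum_le (h : IsMixture θ x B ρ) (hB : B ⊆ forwardCone)
    (hBc : IsCompact B) {Ξ : Mink → ℂ} (hΞ : Integrable Ξ ρ) (b : List (Fin 4) →₀ ℂ)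
    (σ : List (Fin 4) → List (Fin 4))
    (hb : ∀ β ∈ B, ‖Ξ β - b.sum fun μ a => a * thermalMoment (σ μ) β‖ ≤ ε) :
    ‖(∫ β, Ξ β ∂ρ) - b.sum fun μ a => a * θ (σ μ) x‖ ≤ ε := by
  have := h.prob
  have hi := fun μ => (h.integrable hB hBc (σ μ)).const_mul (b μ)
  have his : Integrable (fun β => b.sum fun μ a => a * thermalMoment (σ μ) β) ρ :=
    integrable_finsetSum _ fun μ _ => hi μ
  have h1 : (b.sum fun μ a => a * θ (σ μ) x)
      = ∫ β, b.sum fun μ a => a * thermalMoment (σ μ) β ∂ρ := by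
    simp only [Finsupp.sum]
    rw [integral_finsetSum _ fun μ _ => hi μ]
    exact Finset.sum_congr rfl fun μ _ => by rw [h.eq_integral, integral_const_mul]
  rw [h1, ← integral_sub hΞ his]
  have h2 := norm_integral_le_of_norm_le_const (h.ae_mem.mono hb)
  simpa using h2

theorem IsMixture.sum_metricSign (h : IsMixture θ x B ρ) (hB : B ⊆ forwardCone)
    (hBc : IsCompact B) (μ : List (Fin 4)) :
    ∑ ν, (metricSign ν : ℂ) * θ (ν :: ν :: μ) x = 0 := by
  obtain ⟨c, hc, hcold⟩ := exists_isColderThan hB hBc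
  simp only [h.eq_integral, ← integral_const_mul]
  rw [← integral_finsetSum _ fun ν _ => (h.integrable hB hBc _).const_mul _]
  exact integral_eq_zero_of_ae
    (h.ae_mem.mono fun β hβ => sum_metricSign_thermalMoment (hcold β hβ) hc μ)

theorem IsMixture.isLiftedExpectation (h : IsMixture θ x B ρ) (hB : B ⊆ forwardCone)
    (hBc : IsCompact B) (hp : IsPositiveLightlike p) :
    IsLiftedExpectation θ x (particleDensity p) (∫ β, particleDensity p β ∂ρ) := by
  refine ⟨thermalMoment, isThermalFunction_thermalMoment, fun B' hB' hB'c ε hε => ?_⟩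
  -- The seminorm lives on B', the value of the lift on the support B of ρ; approximating on the
  -- union controls both. Only ν = 0 is used, and the factor p⁰ in the tolerance anticipates
  -- division by p⁰.
  obtain ⟨b, hb⟩ := exists_thermalCoeff_near hp (Set.union_subset hB hB') (hBc.union hB'c)
    (mul_pos hp.1 (half_pos hε))
  have hp0 : (p 0 : ℂ) ≠ 0 := Complex.ofReal_ne_zero.2 hp.1.ne'
  have hb' : ∀ β ∈ B ∪ B', ‖particleDensity p β
      - ((p 0 : ℂ)⁻¹ • b).sum fun μ a => a * thermalMoment (0 :: μ) β‖ < ε / 2 := fun β hβ => by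
    have h1 := hb β hβ 0
    have h2 : (p 0 : ℂ) * particleDensity p β - b.sum (fun μ a => a * thermalMoment (0 :: μ) β)
        = p 0 * (particleDensity p β
          - ((p 0 : ℂ)⁻¹ • b).sum fun μ a => a * thermalMoment (0 :: μ) β) := by
      rw [Finsupp.sum_smul_index fun _ => zero_mul _, mul_sub, Finsupp.mul_sum]
      congr 1
      exact Finset.sum_congr rfl fun μ _ => by field_simp
    rw [h2, norm_mul, Complex.norm_real, Real.norm_of_nonneg hp.1.le] at h1
    exact lt_of_mul_lt_mul_left h1 hp.1.le
  have hsum : ∀ f : List (Fin 4) → ℂ, (((p 0 : ℂ)⁻¹ • b).mapDomain (List.cons 0)).sum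
      (fun μ a => a * f μ) = ((p 0 : ℂ)⁻¹ • b).sum fun μ a => a * f (0 :: μ) := fun f =>
    Finsupp.sum_mapDomain_index (fun _ => zero_mul _) fun _ _ _ => add_mul _ _ _
  refine ⟨((p 0 : ℂ)⁻¹ • b).mapDomain (List.cons 0), fun β hβ => ?_, ?_⟩
  · rw [hsum]
    exact (hb' β (Or.inr hβ)).trans (half_lt_self hε)
  · rw [hsum]
    exact (h.norm_integral_sub_sum_le hB hBc (h.integrable_particleDensity hB hBc hp) _ (List.cons 0)
      fun β hβ => (hb' β (Or.inl hβ)).le).trans_lt (half_lt_self hε)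

/-- The seminorm over B, which carries ρ, already controls the integral of the particle density, so
that every lifted value is forced to be this integral. -/
theorem IsMixture.eq_of_isLiftedExpectation (h : IsMixture θ x B ρ) (hB : B ⊆ forwardCone)
    (hBc : IsCompact B) (hp : IsPositiveLightlike p) {v : ℂ}
    (hv : IsLiftedExpectation θ x (particleDensity p) v) : v = ∫ β, particleDensity p β ∂ρ := by
  obtain ⟨Θ, hΘ, hlim⟩ := hv
  refine eq_of_forall_dist_le fun ε hε => ?_
  obtain ⟨b, hb, hvb⟩ := hlim B hB hBc (ε / 2) (half_pos hε)
  have h1 := h.norm_integral_sub_sum_le hB hBc (h.integrable_particleDensity hB hBc hp) b id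
    (ε := ε / 2) fun β hβ => by
      have h2 : ∀ μ, Θ μ β = thermalMoment μ β := fun μ => (hΘ μ).eq (hB hβ)
      simpa only [h2, id_eq] using (hb β hβ).le
  rw [← dist_eq_norm] at h1 hvb
  calc _ ≤ _ := dist_triangle_right _ _ (b.sum fun μ a => a * θ μ x)
    _ ≤ ε / 2 + ε / 2 := add_le_add hvb.le h1
    _ = ε := add_halves ε

/-! ### The transport equation and the wave equation for the particle density -/

theorem integrable_test_mul_of_locallyIntegrableOn {u : Mink → ℂ}
    (hu : LocallyIntegrableOn u (O : Set Mink)) (f : 𝓓(O, ℂ)) : Integrable fun x => f x * u x := by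
  have h1 : IntegrableOn (fun x => f x * u x) (tsupport f) :=
    (hu.integrableOn_compact_subset f.tsupport_subset f.hasCompactSupport).continuousOn_mul
      f.contDiff.continuous.continuousOn f.hasCompactSupport
  refine (integrableOn_iff_integrable_of_support_subset fun x hx => ?_).1 h1
  exact subset_tsupport _ (left_ne_zero_of_mul hx)

theorem lineDeriv_eq_sum (f : 𝓓(O, ℂ)) (v x : Mink) :
    (∂_{v} f) x = ∑ ν, (v ν : ℂ) * (∂_{unitVec ν} f) x := by
  simp only [lineDeriv_test_apply]
  conv_lhs => rw [show v = ∑ ν, v ν • unitVec ν from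
    (pi_eq_sum_univ' v).trans (Finset.sum_congr rfl fun ν _ => by congr 1)]
  rw [map_sum]
  exact Finset.sum_congr rfl fun ν _ => by rw [map_smul, Complex.real_smul]

/-- A function on `O` such that the functions `p^ν N`, `ν = 0, …, 3`, are approximated, uniformly on
compact sets, by combinations of the functions `θ^{νμ}` with coefficients independent of `ν`. -/
def IsApproximated (O : Opens Mink) (θ : List (Fin 4) → Mink → ℂ) (p : Mink) (N : Mink → ℂ) :
    Prop :=
  ∀ K ⊆ (O : Set Mink), IsCompact K → ∀ ε > 0, ∃ b : List (Fin 4) →₀ ℂ, ∀ x ∈ K, ∀ ν,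
    ‖(p ν : ℂ) * N x - b.sum fun μ a => a * θ (ν :: μ) x‖ ≤ ε

variable {N : Mink → ℂ}

/-- The measures ρ vary with x in an uncontrolled way, but they are all carried by one compact B for
x ∈ K, and b depends on B only. -/
theorem IsThermalOn.isApproximated (h : IsThermalOn O ω θ) (hp : IsPositiveLightlike p)
    (hN : ∀ x ∈ O, IsLiftedExpectation θ x (particleDensity p) (N x)) :
    IsApproximated O θ p N := by
  intro K hK hKc ε hε
  obtain ⟨B, hB, hBc, hρ⟩ := h.exists_isMixture hK hKc
  obtain ⟨b, hb⟩ := exists_thermalCoeff_near hp hB hBc hε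
  refine ⟨b, fun x hx ν => ?_⟩
  obtain ⟨ρ, hρ⟩ := hρ x hx
  have hi := hρ.integrable_particleDensity hB hBc hp
  rw [hρ.eq_of_isLiftedExpectation hB hBc hp (hN x (hK hx)), ← integral_const_mul]
  exact hρ.norm_integral_sub_sum_le hB hBc (hi.const_mul _) b (List.cons ν)
    fun β hβ => (hb β hβ ν).le

theorem locallyIntegrableOn_sum (hθ : ∀ μ, LocallyIntegrableOn (θ μ) (O : Set Mink))
    (b : List (Fin 4) →₀ ℂ) (ν : Fin 4) :
    LocallyIntegrableOn (fun x => b.sum fun μ a => a * θ (ν :: μ) x) (O : Set Mink) := by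
  rw [locallyIntegrableOn_iff O.isOpen.isLocallyClosed]
  exact fun K hK hKc => integrable_finsetSum _ fun μ _ =>
    ((hθ (ν :: μ)).integrableOn_compact_subset hK hKc).const_mul (b μ)

/-- Measurability on K comes from the uniform limit, integrability from the bounded difference to
the first approximant. -/
theorem IsApproximated.locallyIntegrableOn (h : IsApproximated O θ p N) (hp : 0 < p 0)
    (hθ : ∀ μ, LocallyIntegrableOn (θ μ) (O : Set Mink)) :
    LocallyIntegrableOn N (O : Set Mink) := by
  have hp0 : (p 0 : ℂ) ≠ 0 := Complex.ofReal_ne_zero.2 hp.ne'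
  rw [locallyIntegrableOn_iff O.isOpen.isLocallyClosed]
  intro K hK hKc
  choose b hb using fun n : ℕ => h K hK hKc (1 / ((n : ℝ) + 1)) Nat.one_div_pos_of_nat
  have hi := fun n => (locallyIntegrableOn_sum hθ (b n) 0).integrableOn_compact_subset hK hKc
  have hmeas : AEStronglyMeasurable (fun x => (p 0 : ℂ) * N x) (volume.restrict K) := by
    refine aestronglyMeasurable_of_tendsto_ae atTop (fun n => (hi n).aestronglyMeasurable) ?_
    refine ae_restrict_of_forall_mem hKc.measurableSet fun x hx => ?_
    rw [tendsto_iff_norm_sub_tendsto_zero]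
    refine squeeze_zero (fun _ => norm_nonneg _) (fun n => ?_)
      tendsto_one_div_add_atTop_nhds_zero_nat
    rw [norm_sub_rev]
    exact hb n x hx 0
  have hfin : IsFiniteMeasure (volume.restrict K) := ⟨by simpa using hKc.measure_lt_top⟩
  have h1 : IntegrableOn (fun x => (p 0 : ℂ) * N x
      - (b 0).sum fun μ a => a * θ (0 :: μ) x) K :=
    Integrable.of_bound (hmeas.sub (hi 0).aestronglyMeasurable) _
      (ae_restrict_of_forall_mem hKc.measurableSet fun x hx => hb 0 x hx 0)
  have h2 : IntegrableOn (fun x => (p 0 : ℂ)⁻¹ * (((p 0 : ℂ) * N x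
      - (b 0).sum fun μ a => a * θ (0 :: μ) x) + (b 0).sum fun μ a => a * θ (0 :: μ) x)) K :=
    (h1.add (hi 0)).const_mul _
  refine h2.congr (ae_of_all _ fun x => ?_)
  field_simp
  ring

theorem norm_integral_test_mul_sub_le (hN : LocallyIntegrableOn N (O : Set Mink))
    (hθ : ∀ μ, LocallyIntegrableOn (θ μ) (O : Set Mink)) (f : 𝓓(O, ℂ)) (b : List (Fin 4) →₀ ℂ)
    (ν : Fin 4) (hb : ∀ x ∈ tsupport f, ‖(p ν : ℂ) * N x - b.sum fun μ a => a * θ (ν :: μ) x‖ ≤ ε) :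
    ‖(p ν : ℂ) * (∫ x, f x * N x) - b.sum fun μ a => a * ∫ x, f x * θ (ν :: μ) x‖
      ≤ (∫ x, ‖f x‖) * ε := by
  have hf : Integrable f := f.contDiff.continuous.integrable_of_hasCompactSupport f.hasCompactSupport
  have hi := fun μ => (integrable_test_mul_of_locallyIntegrableOn (hθ (ν :: μ)) f).const_mul (b μ)
  have hNi := (integrable_test_mul_of_locallyIntegrableOn hN f).const_mul (p ν : ℂ)
  have h1 : (b.sum fun μ a => a * ∫ x, f x * θ (ν :: μ) x)
      = ∫ x, ∑ μ ∈ b.support, b μ * (f x * θ (ν :: μ) x) := by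
    rw [integral_finsetSum _ fun μ _ => hi μ, Finsupp.sum]
    exact Finset.sum_congr rfl fun μ _ => (integral_const_mul _ _).symm
  rw [h1, ← integral_const_mul, ← integral_sub hNi (integrable_finsetSum _ fun μ _ => hi μ),
    ← integral_mul_const]
  refine norm_integral_le_of_norm_le (hf.norm.mul_const ε) (ae_of_all _ fun x => ?_)
  have h2 : (p ν : ℂ) * (f x * N x) - ∑ μ ∈ b.support, b μ * (f x * θ (ν :: μ) x)
      = f x * ((p ν : ℂ) * N x - b.sum fun μ a => a * θ (ν :: μ) x) := by
    rw [mul_sub, Finsupp.mul_sum, Finsupp.sum]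
    simp only [mul_left_comm]
  rw [h2, norm_mul]
  by_cases hx : x ∈ tsupport f
  · exact mul_le_mul_of_nonneg_left (hb x hx) (norm_nonneg _)
  · rw [image_eq_zero_of_notMem_tsupport hx, norm_zero, zero_mul, zero_mul]

/-- Since b does not depend on ν, the sum over ν can be carried out inside the approximant, where it
vanishes for each μ. The tolerance ε/(C + 1) remains meaningful for C = 0. -/
theorem IsApproximated.sum_integral_test_mul (h : IsApproximated O θ p N)
    (hN : LocallyIntegrableOn N (O : Set Mink))
    (hθ : ∀ μ, LocallyIntegrableOn (θ μ) (O : Set Mink)) (g : Fin 4 → 𝓓(O, ℂ))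
    (hg : ∀ μ, ∑ ν, ∫ x, g ν x * θ (ν :: μ) x = 0) :
    ∑ ν, (p ν : ℂ) * ∫ x, g ν x * N x = 0 := by
  set C := ∑ ν, ∫ x, ‖g ν x‖
  have hC : 0 ≤ C := Finset.sum_nonneg fun ν _ => integral_nonneg fun x => norm_nonneg _
  rw [← norm_le_zero_iff]
  refine le_of_forall_pos_le_add fun ε hε => ?_
  obtain ⟨b, hb⟩ := h (⋃ ν, tsupport (g ν)) (Set.iUnion_subset fun ν => (g ν).tsupport_subset)
    (isCompact_iUnion fun ν => (g ν).hasCompactSupport) (ε / (C + 1)) (by positivity)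
  have h2 := fun ν => norm_integral_test_mul_sub_le hN hθ (g ν) b ν
    fun x hx => hb x (Set.mem_iUnion.2 ⟨ν, hx⟩) ν
  have h3 : ∑ ν, b.sum (fun μ a => a * ∫ x, g ν x * θ (ν :: μ) x) = 0 := by
    simp only [Finsupp.sum]
    rw [Finset.sum_comm]
    refine Finset.sum_eq_zero fun μ _ => ?_
    rw [← Finset.mul_sum, hg, mul_zero]
  rw [zero_add, ← sub_zero (∑ ν, _), ← h3, ← Finset.sum_sub_distrib]
  calc _ ≤ ∑ ν, (∫ x, ‖g ν x‖) * (ε / (C + 1)) := norm_sum_le_of_le _ fun ν _ => h2 ν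
    _ = C / (C + 1) * ε := by rw [← Finset.sum_mul]; ring
    _ ≤ ε := mul_le_of_le_one_left hε.le ((div_le_one (by positivity)).2 (by linarith))

theorem IsApproximated.integral_mul_lineDeriv (h : IsApproximated O θ p N)
    (hN : LocallyIntegrableOn N (O : Set Mink))
    (hθ : ∀ μ, HasBalancedExpectation ω O μ (θ μ)) (f : 𝓓(O, ℂ)) :
    ∫ x, N x * (∂_{p} f) x = 0 := by
  have hθ' : ∀ μ, LocallyIntegrableOn (θ μ) (O : Set Mink) := fun μ => by
    obtain ⟨-, -, h1, -⟩ := hθ μ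
    exact h1
  let g : Fin 4 → 𝓓(O, ℂ) := fun ν => ∂_{unitVec ν} f
  rw [← h.sum_integral_test_mul hN hθ' g fun μ => sum_integral_lineDeriv_mul_eq_zero hθ μ f]
  have h1 : ∀ ν, Integrable fun x => (p ν : ℂ) * (g ν x * N x) := fun ν =>
    (integrable_test_mul_of_locallyIntegrableOn hN (g ν)).const_mul _
  simp only [← integral_const_mul]
  rw [← integral_finsetSum _ fun ν _ => h1 ν]
  congr 1
  ext x
  rw [lineDeriv_eq_sum, Finset.mul_sum]
  exact Finset.sum_congr rfl fun ν _ => by ring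

/-- Here thermality enters beyond the field equation: the contraction of θ^{ννμ} vanishes at each
point of the support of f because the expectation values there are those of a mixture. -/
theorem IsThermalOn.integral_box_mul (h : IsThermalOn O ω θ) (f : 𝓓(O, ℂ)) (μ : List (Fin 4)) :
    ∫ x, (box f) x * θ μ x = 0 := by
  have hi : ∀ ν : Fin 4, Integrable fun x => f x * θ (ν :: ν :: μ) x := fun ν => by
    obtain ⟨-, -, h1, -⟩ := h.1 (ν :: ν :: μ)
    exact integrable_test_mul_of_locallyIntegrableOn h1 f
  obtain ⟨B, hB, hBc, hρ⟩ := h.exists_isMixture f.tsupport_subset f.hasCompactSupport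
  rw [integral_box_mul_eq h.1, neg_eq_zero]
  simp only [← integral_const_mul]
  rw [← integral_finsetSum _ fun ν _ => (hi ν).const_mul _]
  refine integral_eq_zero_of_ae (ae_of_all _ fun x => ?_)
  change ∑ ν, (metricSign ν : ℂ) * (f x * θ (ν :: ν :: μ) x) = 0
  by_cases hx : x ∈ tsupport f
  · obtain ⟨ρ, hρ⟩ := hρ x hx
    simp only [mul_left_comm _ (f x)]
    rw [← Finset.mul_sum, hρ.sum_metricSign hB hBc, mul_zero]
  · simp [image_eq_zero_of_notMem_tsupport hx]

theorem IsThermalOn.integral_mul_box (h : IsThermalOn O ω θ) (hN : IsApproximated O θ p N)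
    (hNi : LocallyIntegrableOn N (O : Set Mink)) (hp : 0 < p 0) (f : 𝓓(O, ℂ)) :
    ∫ x, N x * (box f) x = 0 := by
  have hθ' : ∀ μ, LocallyIntegrableOn (θ μ) (O : Set Mink) := fun μ => by
    obtain ⟨-, -, h1, -⟩ := h.1 μ
    exact h1
  have hp0 : (p 0 : ℂ) ≠ 0 := Complex.ofReal_ne_zero.2 hp.ne'
  -- Only the component ν = 0 is occupied, so the required relation is □θ^{0μ} = 0, and p⁰ can be
  -- divided out.
  have hs := hN.sum_integral_test_mul hNi hθ' (fun ν => if ν = 0 then box f else 0) fun μ => by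
    simp [Fin.sum_univ_four, h.integral_box_mul]
  simp only [Fin.sum_univ_four, if_true, Fin.reduceEq, one_ne_zero, if_false] at hs
  have hs : (p 0 : ℂ) * ∫ x, (box f) x * N x = 0 := by simpa using hs
  simpa only [mul_comm (N _)] using (mul_eq_zero.1 hs).resolve_left hp0

theorem IsThermalOn.existsUnique_isLiftedExpectation (h : IsThermalOn O ω θ)
    (hp : IsPositiveLightlike p) (hx : x ∈ O) :
    ∃! v : ℂ, IsLiftedExpectation θ x (particleDensity p) v := by
  obtain ⟨B, hB, hBc, hρ⟩ :=
    h.exists_isMixture (Set.singleton_subset_iff.2 hx) isCompact_singleton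
  obtain ⟨ρ, hρ⟩ := hρ x rfl
  exact ⟨_, hρ.isLiftedExpectation hB hBc hp, fun v hv =>
    hρ.eq_of_isLiftedExpectation hB hBc hp hv⟩

end FreeField

end

theorem mainTheorem4 (O : Opens FreeField.Mink) (ω : FreeField.FieldState)
    (θ : List (Fin 4) → FreeField.Mink → ℂ) (hω : FreeField.IsThermalOn O ω θ)
    (p : FreeField.Mink) (hp : FreeField.IsPositiveLightlike p) :
    (∀ x ∈ O, ∃! v : ℂ,
      FreeField.IsLiftedExpectation θ x (FreeField.particleDensity p) v) ∧
    ∀ N : FreeField.Mink → ℂ,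
      (∀ x ∈ O, FreeField.IsLiftedExpectation θ x (FreeField.particleDensity p) (N x)) →
      LocallyIntegrableOn N O ∧
      (∀ f : 𝓓(O, ℂ), ∫ x, N x * (∂_{p} f) x = 0) ∧
      (∀ f : 𝓓(O, ℂ), ∫ x, N x * (FreeField.box f) x = 0) := by
  have hθ : ∀ μ, LocallyIntegrableOn (θ μ) (O : Set FreeField.Mink) := fun μ => by
    obtain ⟨-, -, h, -⟩ := hω.1 μ
    exact h
  refine ⟨fun x hx => hω.existsUnique_isLiftedExpectation hp hx, fun N hN => ?_⟩
  have hA := hω.isApproximated hp hN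
  have hNi := hA.locallyIntegrableOn hp.1 hθ
  exact ⟨hNi, hA.integral_mul_lineDeriv hNi hω.1, hω.integral_mul_box hA hNi hp.1⟩
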